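/- Let $n\ge 2$, $Q=n+2$ (so $Q\ge4$), and consider $\mathbb R^{n+1}=\mathbb R^n\times\mathbb R$ with points $(x,t)$ and origin $o$. Put $\nabla_G=(\nabla_x,|x|\partial_t)$, $\mathcal L_G=\Delta_x+|x|^2\partial_t^2$, $\varrho(x,t)=(|x|^4+4t^2)^{1/4}$, and, for $0<R\le\infty$, $B_R=\{(x,t):\varrho(x,t)<R\}$. For a function $u$ let $u_\varrho$ be its radial derivative with respect to the dilations $\delta_\lambda(x,t)=(\lambda x,\lambda^2t)$, that is, $u_\varrho(z)=\frac{d}{ds}\big|_{s=\varrho(z)}u\big(\delta_{s/\varrho(z)}(z)\big)$ for $z\neq o$. Let $(V,W)$ be a $Q$-dimensional Bessel pair on $(0,R)$ with positive solution $f$: $V,W\in C^1(0,R)$, and $f>0$ solves $(r^{Q-1}Vf')'+r^{Q-1}Wf=0$ on $(0,R)$. Assume that $V$ is twice differentiable on $(0,R)$, that $V\ge0$, and that $$(Q-5)\frac{V(r)}{r^2}+3\frac{V'(r)}{r}-V''(r)\ge0\qquad(0<r<R).$$ Then for every real-valued $u\in C_c^\infty(B_R\setminus\{o\})$, not necessarily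 radial, the three integrals on the right below converge absolutely and $$\int_{B_R}V(\varrho)\frac{(\mathcal L_Gu)^2}{|\nabla_G\varrho|^2}\,dx\,dt\ \ge\ \int_{B_R}W(\varrho)|\nabla_Gu|^2\,dx\,dt+(Q-1)\int_{B_R}\Big(\frac{V(\varrho)}{\varrho^2}-\frac{V'(\varrho)}{\varrho}\Big)|\nabla_Gu|^2\,dx\,dt+\int_{B_R}V(\varrho)\Big|\nabla_G\Big(\frac{u_\varrho}{f(\varrho)}\Big)\Big|^2f(\varrho)^2\,dx\,dt,$$ where the left side is an integral of a nonnegative function, with values in $[0,\infty]$. -/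

import Mathlib

open MeasureTheory
open scoped ContDiff ENNReal

noncomputable section

namespace Grushin

/-- The Grushin space `ℝⁿ × ℝ`, with points `(x, t)`; it carries Lebesgue measure `dx dt`. -/
abbrev Space (n : ℕ) : Type := EuclideanSpace ℝ (Fin n) × ℝ

/-- The homogeneous dimension `Q = n + 2`. -/
abbrev homDim (n : ℕ) : ℕ := n + 2

variable {n : ℕ}

/-- The vector field `X_i = ∂/∂x_i`. -/
def fieldX (i : Fin n) (u : Space n → ℝ) (z : Space n) : ℝ :=
  fderiv ℝ u z (EuclideanSpace.single i 1, 0)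

/-- The partial derivative `∂/∂t`. -/
def partialT (u : Space n → ℝ) (z : Space n) : ℝ :=
  fderiv ℝ u z (0, 1)

/-- The vector field `Y = |x| ∂/∂t`. -/
def fieldY (u : Space n → ℝ) (z : Space n) : ℝ :=
  ‖z.1‖ * partialT u z

/-- `|∇_G u|²`, where `∇_G = (X_1, …, X_n, Y)`. -/
def gradSq (u : Space n → ℝ) (z : Space n) : ℝ :=
  (∑ i, fieldX i u z ^ 2) + fieldY u z ^ 2

/-- The Grushin operator `L_G = Δ_x + |x|² ∂²/∂t²`. -/
def laplacian (u : Space n → ℝ) (z : Space n) : ℝ :=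
  (∑ i, fieldX i (fieldX i u) z) + ‖z.1‖ ^ 2 * partialT (partialT u) z

/-- The homogeneous norm `ϱ(x, t) = (|x|⁴ + 4 t²)^{1/4}`. -/
def rho (z : Space n) : ℝ :=
  (‖z.1‖ ^ 4 + 4 * z.2 ^ 2) ^ (1 / 4 : ℝ)

/-- The anisotropic dilation `δ_λ(x, t) = (λ x, λ² t)`. -/
def dilation (l : ℝ) (z : Space n) : Space n :=
  (l • z.1, l ^ 2 * z.2)

/-- The derivative `u_ϱ = ∂u/∂ϱ` in the polar coordinates `z = δ_ϱ(σ)`, `ϱ(σ) = 1`. The point with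
polar coordinates `(s, σ)` is `δ_{s / ϱ(z)}(z)`, and `u_ϱ(z)` is the derivative of `u` at this point
with respect to `s` at `s = ϱ(z)`. -/
def radialDeriv (u : Space n → ℝ) (z : Space n) : ℝ :=
  deriv (fun s : ℝ => u (dilation (s / rho z) z)) (rho z)

/-- The gauge ball `B_R(o) = {ϱ < R}`, `0 < R ≤ ∞`. -/
def ball (n : ℕ) (R : ℝ≥0∞) : Set (Space n) :=
  {z | ENNReal.ofReal (rho z) < R}

/-- The interval `(0, R)`, `0 < R ≤ ∞`. -/
def radii (R : ℝ≥0∞) : Set ℝ :=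
  {r | 0 < r ∧ ENNReal.ofReal r < R}

/-- `(V, W)` is a `Q`-dimensional Bessel pair on `(0, R)` with positive solution `f`: `V` and `W`
are `C¹` on `(0, R)`, and `f` is a positive solution of `(r^{Q-1} V y')' + r^{Q-1} W y = 0` there. -/
structure IsBesselPair (Q : ℕ) (R : ℝ≥0∞) (V W f : ℝ → ℝ) : Prop where
  contDiffOn_V : ContDiffOn ℝ 1 V (radii R)
  contDiffOn_W : ContDiffOn ℝ 1 W (radii R)
  pos : ∀ r ∈ radii R, 0 < f r
  differentiableAt : ∀ r ∈ radii R, DifferentiableAt ℝ f r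
  ode : ∀ r ∈ radii R,
    HasDerivAt (fun s : ℝ => s ^ (Q - 1) * V s * deriv f s) (-(r ^ (Q - 1) * W r * f r)) r

end Grushin

end

open Grushin

noncomputable section

namespace Grushin

/-! ### One-dimensional Hardy inequalities -/

section

open Set Filter Topology

theorem integral_nonneg_of_deriv_le {F F' φ : ℝ → ℝ} (hF : Continuous F)
    (hF' : ∀ x, x ≠ 0 → HasDerivAt F (F' x) x) (hφ : Integrable φ)
    (hle : ∀ x, x ≠ 0 → F' x ≤ φ x)
    (hbot : Tendsto F atBot (𝓝 0)) (htop : Tendsto F atTop (𝓝 0)) : 0 ≤ ∫ x, φ x := by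
  have key : ∀ᶠ k : ℝ in atTop, F k - F (-k) ≤ ∫ x in (-k)..k, φ x := by
    filter_upwards [eventually_ge_atTop 0] with k hk
    have h1 : F 0 - F (-k) ≤ ∫ x in (-k)..0, φ x :=
      intervalIntegral.sub_le_integral_of_hasDeriv_right_of_le (by linarith) hF.continuousOn
        (fun x hx => (hF' x hx.2.ne).hasDerivWithinAt) hφ.integrableOn (fun x hx => hle x hx.2.ne)
    have h2 : F k - F 0 ≤ ∫ x in (0:ℝ)..k, φ x :=
      intervalIntegral.sub_le_integral_of_hasDeriv_right_of_le hk hF.continuousOn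
        (fun x hx => (hF' x hx.1.ne').hasDerivWithinAt) hφ.integrableOn (fun x hx => hle x hx.1.ne')
    rw [← intervalIntegral.integral_add_adjacent_intervals (b := (0:ℝ))
      hφ.intervalIntegrable hφ.intervalIntegrable]
    linarith
  have lim1 := intervalIntegral_tendsto_integral hφ tendsto_neg_atTop_atBot tendsto_id
  have lim2 : Tendsto (fun k : ℝ => F k - F (-k)) atTop (𝓝 (0 - 0)) :=
    htop.sub (hbot.comp tendsto_neg_atTop_atBot)
  have := le_of_tendsto_of_tendsto lim2 lim1 key
  linarith

/-- If `g 0 = 0`, then `g ^ 2 / x` is continuous wherever `g` is differentiable. -/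
theorem continuous_sq_div {g : ℝ → ℝ} (hg : Differentiable ℝ g) (h0 : g 0 = 0) :
    Continuous fun x => g x ^ 2 / x := by
  rw [continuous_iff_continuousAt]
  intro x
  rcases eq_or_ne x 0 with rfl | hx
  · have h1 := hasDerivAt_iff_tendsto_slope.1 (hg 0).hasDerivAt
    have h2 : Tendsto g (𝓝[≠] 0) (𝓝 0) := by
      have := (hg 0).continuousAt.tendsto
      rw [h0] at this
      exact this.mono_left nhdsWithin_le_nhds
    have h3 := h1.mul h2
    rw [mul_zero] at h3
    rw [continuousAt_iff_punctured_nhds]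
    simp only [div_zero]
    refine h3.congr' ?_
    filter_upwards [self_mem_nhdsWithin] with y hy
    rw [slope_def_field, h0]
    ring
  · exact ((hg x).continuousAt.pow 2).div continuousAt_id hx

theorem gaussian_hardy {g : ℝ → ℝ} (hg : Differentiable ℝ g) {C : ℝ}
    (hC : ∀ x, |deriv g x| ≤ C) :
    Integrable (fun x => (g x - g 0) ^ 2 * Real.exp (-x ^ 2 / 2)) ∧
    Integrable (fun x => deriv g x ^ 2 * Real.exp (-x ^ 2 / 2)) ∧
    ∫ x, (g x - g 0) ^ 2 * Real.exp (-x ^ 2 / 2) ≤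
      ∫ x, deriv g x ^ 2 * Real.exp (-x ^ 2 / 2) := by
  have hC0 : 0 ≤ C := (abs_nonneg _).trans (hC 0)
  set k : ℝ → ℝ := fun x => g x - g 0 with hk
  have hkd : Differentiable ℝ k := hg.sub_const _
  have hk' : ∀ x, HasDerivAt k (deriv g x) x := fun x => (hg x).hasDerivAt.sub_const _
  have hb : ∀ x, |k x| ≤ C * |x| := by
    intro x
    have := Convex.norm_image_sub_le_of_norm_deriv_le (f := g) (C := C) (s := univ) (x := 0)
      (y := x) (fun y _ => hg y) (fun y _ => hC y) convex_univ (mem_univ _) (mem_univ _)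
    simpa [hk] using this
  have hb2 : ∀ x, k x ^ 2 ≤ C ^ 2 * x ^ 2 := by
    intro x
    have h := mul_self_le_mul_self (abs_nonneg _) (hb x)
    rw [abs_mul_abs_self] at h
    nlinarith [abs_mul_abs_self x]
  have hexp : ∀ x : ℝ, Real.exp (-x ^ 2 / 2) = Real.exp (-(1/2) * x ^ 2) := by
    intro x; congr 1; ring
  have i0 : Integrable fun x : ℝ => Real.exp (-x ^ 2 / 2) := by
    simp_rw [hexp]; exact integrable_exp_neg_mul_sq (by norm_num)
  have i2 : Integrable fun x : ℝ => x ^ 2 * Real.exp (-x ^ 2 / 2) := by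
    simp_rw [hexp]
    have := integrable_rpow_mul_exp_neg_mul_sq (b := 1/2) (by norm_num) (s := 2) (by norm_num)
    simpa using this
  have j1 : Integrable fun x => k x ^ 2 * Real.exp (-x ^ 2 / 2) := by
    refine (i2.const_mul (C ^ 2)).mono'
      ((hkd.continuous.pow 2).mul (by fun_prop)).aestronglyMeasurable ?_
    refine Eventually.of_forall fun x => ?_
    rw [Real.norm_of_nonneg (by positivity), ← mul_assoc]
    exact mul_le_mul_of_nonneg_right (hb2 x) (Real.exp_pos _).le
  have j2 : Integrable fun x => deriv g x ^ 2 * Real.exp (-x ^ 2 / 2) := by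
    refine (i0.const_mul (C ^ 2)).mono' (((measurable_deriv g).pow_const 2).mul
      (by fun_prop : Continuous fun x : ℝ => Real.exp (-x ^ 2 / 2)).measurable).aestronglyMeasurable ?_
    refine Eventually.of_forall fun x => ?_
    rw [Real.norm_of_nonneg (by positivity)]
    refine mul_le_mul_of_nonneg_right ?_ (Real.exp_pos _).le
    rw [← sq_abs]
    exact pow_le_pow_left₀ (abs_nonneg _) (hC x) 2
  refine ⟨j1, j2, ?_⟩
  have hlim : ∀ l : Filter ℝ, Tendsto (fun x : ℝ => |x|) l atTop →
      Tendsto (fun x => Real.exp (-x ^ 2 / 2) * (k x ^ 2 / x)) l (𝓝 0) := by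
    intro l hl
    have h1 : Tendsto (fun x : ℝ => x ^ (1:ℝ) * Real.exp (-(1/2) * x ^ 2)) atTop (𝓝 0) := by
      have := rpow_mul_exp_neg_mul_sq_isLittleO_exp_neg (b := 1/2) (by norm_num) 1
      exact this.trans_tendsto (Real.tendsto_exp_neg_atTop_nhds_zero.comp
        (tendsto_id.const_mul_atTop (by norm_num : (0:ℝ) < 1/2)) |>.congr fun x => by simp)
    have h2 := (h1.comp hl).const_mul (C ^ 2)
    rw [mul_zero] at h2
    refine squeeze_zero_norm (fun x => ?_) h2
    simp only [Function.comp, Real.rpow_one, sq_abs]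
    rw [← hexp, norm_mul, Real.norm_of_nonneg (Real.exp_pos _).le, Real.norm_eq_abs, abs_div,
      abs_of_nonneg (sq_nonneg _)]
    have : k x ^ 2 / |x| ≤ C ^ 2 * |x| := by
      rcases eq_or_ne x 0 with rfl | hx
      · simp
      · rw [div_le_iff₀ (abs_pos.2 hx), mul_assoc, abs_mul_abs_self, ← sq]
        exact hb2 x
    nlinarith [mul_le_mul_of_nonneg_right this (Real.exp_pos (-x ^ 2 / 2)).le]
  have := integral_nonneg_of_deriv_le
    (F := fun x => Real.exp (-x ^ 2 / 2) * (k x ^ 2 / x))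
    (F' := fun x => Real.exp (-x ^ 2 / 2) * (-x) * (k x ^ 2 / x) +
      Real.exp (-x ^ 2 / 2) * ((2 * k x * deriv g x * x - k x ^ 2 * 1) / x ^ 2))
    (φ := fun x => deriv g x ^ 2 * Real.exp (-x ^ 2 / 2) - k x ^ 2 * Real.exp (-x ^ 2 / 2))
    ((by fun_prop : Continuous fun x : ℝ => Real.exp (-x ^ 2 / 2)).mul
      (continuous_sq_div hkd (by simp [hk])))
    (fun x hx => by
      refine HasDerivAt.mul ?_ ?_
      · have : HasDerivAt (fun x : ℝ => -x ^ 2 / 2) (-x) x := by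
          have := ((hasDerivAt_pow 2 x).neg.div_const 2)
          refine this.congr_deriv ?_
          push_cast; ring
        exact this.exp
      · have := ((hk' x).pow 2).div (hasDerivAt_id x) hx
        refine this.congr_deriv ?_
        simp)
    (j2.sub j1)
    (fun x hx => by
      have : (deriv g x ^ 2 * Real.exp (-x ^ 2 / 2) - k x ^ 2 * Real.exp (-x ^ 2 / 2)) -
        (Real.exp (-x ^ 2 / 2) * (-x) * (k x ^ 2 / x) +
        Real.exp (-x ^ 2 / 2) * ((2 * k x * deriv g x * x - k x ^ 2 * 1) / x ^ 2))
        = Real.exp (-x ^ 2 / 2) * (deriv g x - k x / x) ^ 2 := by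
        field_simp
        ring
      have h2 : 0 ≤ Real.exp (-x ^ 2 / 2) * (deriv g x - k x / x) ^ 2 := by positivity
      linarith)
    (hlim _ tendsto_abs_atBot_atTop) (hlim _ tendsto_abs_atTop_atTop)
  rw [integral_sub j2 j1] at this
  linarith

/-- The function `1 + 4 τ²`. -/
def quad (τ : ℝ) : ℝ := 1 + 4 * τ ^ 2

theorem one_le_quad (τ : ℝ) : 1 ≤ quad τ := by unfold quad; nlinarith [sq_nonneg τ]

theorem quad_pos (τ : ℝ) : 0 < quad τ := lt_of_lt_of_le one_pos (one_le_quad τ)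

theorem sq_le_quad (τ : ℝ) : τ ^ 2 ≤ quad τ := by unfold quad; nlinarith [sq_nonneg τ]

theorem continuous_quad : Continuous quad := by unfold quad; fun_prop

theorem continuous_quad_rpow (a : ℝ) : Continuous fun τ => quad τ ^ a :=
  continuous_quad.rpow_const fun τ => Or.inl (quad_pos τ).ne'

theorem hasDerivAt_quad_rpow (a τ : ℝ) :
    HasDerivAt (fun τ => quad τ ^ a) (8 * τ * a * (quad τ ^ a / quad τ)) τ := by
  have h : HasDerivAt quad (8 * τ) τ := by
    have := ((hasDerivAt_pow 2 τ).const_mul 4).const_add 1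
    refine this.congr_deriv ?_
    push_cast; ring
  have := h.rpow_const (p := a) (Or.inl (quad_pos τ).ne')
  rwa [Real.rpow_sub_one (quad_pos τ).ne'] at this

theorem integrable_quad_rpow {a : ℝ} (ha : a ≤ -1) : Integrable fun τ => quad τ ^ a := by
  refine (integrable_inv_one_add_sq).mono' (continuous_quad_rpow a).aestronglyMeasurable ?_
  refine Eventually.of_forall fun τ => ?_
  rw [Real.norm_of_nonneg (Real.rpow_nonneg (quad_pos τ).le _)]
  calc quad τ ^ a ≤ quad τ ^ (-1 : ℝ) := Real.rpow_le_rpow_of_exponent_le (one_le_quad τ) ha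
    _ = (quad τ)⁻¹ := Real.rpow_neg_one _
    _ ≤ (1 + τ ^ 2)⁻¹ := by
      apply inv_anti₀ (by positivity)
      unfold quad; nlinarith [sq_nonneg τ]

/-- The angular weight `q^{-(n+4)/4}`, `q = 1 + 4τ²`. -/
def angWt (n : ℕ) (τ : ℝ) : ℝ := quad τ ^ (-((n : ℝ) + 4) / 4)

theorem angWt_pos (n : ℕ) (τ : ℝ) : 0 < angWt n τ := Real.rpow_pos_of_pos (quad_pos τ) _

theorem continuous_angWt (n : ℕ) : Continuous (angWt n) := continuous_quad_rpow _

theorem integrable_angWt (n : ℕ) : Integrable (angWt n) :=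
  integrable_quad_rpow (by have : (0:ℝ) ≤ n := n.cast_nonneg; linarith)

theorem angWt_mul_quad (n : ℕ) (τ : ℝ) : angWt n τ * quad τ = quad τ ^ (-(n : ℝ) / 4) := by
  unfold angWt
  rw [← Real.rpow_add_one (quad_pos τ).ne']
  congr 1; ring

theorem hasDerivAt_angWt_mul_quad (n : ℕ) (τ : ℝ) :
    HasDerivAt (fun τ => angWt n τ * quad τ) (-2 * n * τ * angWt n τ) τ := by
  have h : (fun τ => angWt n τ * quad τ) = fun τ => quad τ ^ (-(n : ℝ) / 4) := by
    funext τ; exact angWt_mul_quad n τ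
  rw [h]
  refine (hasDerivAt_quad_rpow _ τ).congr_deriv ?_
  rw [← angWt_mul_quad, mul_div_cancel_right₀ _ (quad_pos τ).ne']
  ring

theorem angWt_mul_quad_le {n : ℕ} (hn : 2 ≤ n) (τ : ℝ) :
    angWt n τ * quad τ ≤ (Real.sqrt (quad τ))⁻¹ := by
  rw [angWt_mul_quad, Real.sqrt_eq_rpow, ← Real.rpow_neg (quad_pos τ).le]
  refine Real.rpow_le_rpow_of_exponent_le (one_le_quad τ) ?_
  have : (2:ℝ) ≤ n := by exact_mod_cast hn
  linarith

theorem abs_mul_angWt_mul_quad_le {n : ℕ} (hn : 2 ≤ n) (τ : ℝ) :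
    |τ| * (angWt n τ * quad τ) ≤ 1 := by
  have h1 : |τ| ≤ Real.sqrt (quad τ) := Real.abs_le_sqrt (sq_le_quad τ)
  have h2 : 0 < Real.sqrt (quad τ) := Real.sqrt_pos.2 (quad_pos τ)
  calc |τ| * (angWt n τ * quad τ) ≤ Real.sqrt (quad τ) * (Real.sqrt (quad τ))⁻¹ :=
        mul_le_mul h1 (angWt_mul_quad_le hn τ)
          (mul_nonneg (angWt_pos n τ).le (quad_pos τ).le) h2.le
    _ = 1 := mul_inv_cancel₀ h2.ne'

/-- The polar Poincaré inequality for functions vanishing on the equator. -/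
theorem equator_hardy {n : ℕ} (hn : 2 ≤ n) {g g' : ℝ → ℝ} (hg : ∀ τ, HasDerivAt g (g' τ) τ)
    (h0 : g 0 = 0) {C : ℝ} (hC : ∀ τ, |g τ| ≤ C)
    (hi : Integrable fun τ => angWt n τ * (quad τ * g' τ) ^ 2)
    (hi2 : Integrable fun τ => angWt n τ * g τ ^ 2) :
    ((n : ℝ) + 1) * ∫ τ, angWt n τ * g τ ^ 2 ≤ ∫ τ, angWt n τ * (quad τ * g' τ) ^ 2 := by
  have hgd : Differentiable ℝ g := fun τ => (hg τ).differentiableAt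
  have hlim : ∀ l : Filter ℝ, Tendsto (fun x : ℝ => |x|) l atTop →
      Tendsto (fun x => angWt n x * quad x * (g x ^ 2 / x)) l (𝓝 0) := by
    intro l hl
    have h2 := (tendsto_inv_atTop_zero.comp hl).const_mul (C ^ 2)
    rw [mul_zero] at h2
    refine squeeze_zero_norm (fun x => ?_) h2
    have hm : angWt n x * quad x ≤ 1 := by
      rw [angWt_mul_quad]
      refine Real.rpow_le_one_of_one_le_of_nonpos (one_le_quad x) ?_
      have : (0:ℝ) ≤ n := n.cast_nonneg
      linarith
    have hp : 0 ≤ angWt n x * quad x := mul_nonneg (angWt_pos n x).le (quad_pos x).le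
    have hgC : g x ^ 2 ≤ C ^ 2 := by
      rw [← sq_abs]; exact pow_le_pow_left₀ (abs_nonneg _) (hC x) 2
    simp only [Function.comp]
    rw [norm_mul, Real.norm_of_nonneg hp, Real.norm_eq_abs, abs_div,
      abs_of_nonneg (sq_nonneg _), div_eq_mul_inv]
    calc angWt n x * quad x * (g x ^ 2 * |x|⁻¹) ≤ 1 * (C ^ 2 * |x|⁻¹) := by gcongr
      _ = _ := one_mul _
  have := integral_nonneg_of_deriv_le
    (F := fun x => angWt n x * quad x * (g x ^ 2 / x))
    (F' := fun x => -2 * n * x * angWt n x * (g x ^ 2 / x) +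
      angWt n x * quad x * ((2 * g x * g' x * x - g x ^ 2 * 1) / x ^ 2))
    (φ := fun x => angWt n x * (quad x * g' x) ^ 2 - ((n : ℝ) + 1) * (angWt n x * g x ^ 2))
    (((continuous_angWt n).mul continuous_quad).mul (continuous_sq_div hgd h0))
    (fun x hx => by
      refine (hasDerivAt_angWt_mul_quad n x).mul ?_
      have := ((hg x).pow 2).div (hasDerivAt_id x) hx
      refine this.congr_deriv ?_
      simp)
    (hi.sub (hi2.const_mul _))
    (fun x hx => by
      have : (angWt n x * (quad x * g' x) ^ 2 - ((n : ℝ) + 1) * (angWt n x * g x ^ 2)) -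
        (-2 * n * x * angWt n x * (g x ^ 2 / x) +
          angWt n x * quad x * ((2 * g x * g' x * x - g x ^ 2 * 1) / x ^ 2))
        = angWt n x * ((quad x * g' x - g x / x) ^ 2 + (n + 3) * g x ^ 2) := by
        unfold quad
        field_simp
        ring
      have h2 : 0 ≤ angWt n x * ((quad x * g' x - g x / x) ^ 2 + (n + 3) * g x ^ 2) :=
        mul_nonneg (angWt_pos n x).le (by positivity)
      linarith)
    (hlim _ tendsto_abs_atBot_atTop) (hlim _ tendsto_abs_atTop_atTop)
  rw [integral_sub hi (hi2.const_mul _), integral_const_mul] at this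
  linarith

/-- The polar ground-state inequality with an angular potential, for functions vanishing at the
poles. -/
theorem pole_hardy {n : ℕ} (hn : 2 ≤ n) {g g' : ℝ → ℝ} (hg : ∀ τ, HasDerivAt g (g' τ) τ)
    (hbot : Tendsto g atBot (𝓝 0)) (htop : Tendsto g atTop (𝓝 0))
    (hi : Integrable fun τ => angWt n τ * (quad τ * g' τ) ^ 2)
    (hi1 : Integrable fun τ => angWt n τ * (quad τ * g τ ^ 2))
    (hi2 : Integrable fun τ => angWt n τ * g τ ^ 2) :
    ((n : ℝ) + 1) * ∫ τ, angWt n τ * g τ ^ 2 ≤ (∫ τ, angWt n τ * (quad τ * g' τ) ^ 2)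
      + ((n : ℝ) - 1) * ∫ τ, angWt n τ * (quad τ * g τ ^ 2) := by
  have hgc : Continuous g := continuous_iff_continuousAt.2 fun τ => (hg τ).continuousAt
  have hlim : ∀ l : Filter ℝ, Tendsto g l (𝓝 0) →
      Tendsto (fun x => angWt n x * quad x * (-2 * x * g x ^ 2)) l (𝓝 0) := by
    intro l hl
    have h2 := (hl.pow 2).const_mul 2
    simp only [ne_eq, OfNat.ofNat_ne_zero, not_false_eq_true, zero_pow, mul_zero] at h2
    refine squeeze_zero_norm (fun x => ?_) h2
    have hp : 0 ≤ angWt n x * quad x := mul_nonneg (angWt_pos n x).le (quad_pos x).le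
    rw [norm_mul, Real.norm_of_nonneg hp, Real.norm_eq_abs, abs_mul, abs_mul,
      abs_of_nonneg (sq_nonneg (g x)), abs_neg, abs_two]
    nlinarith [mul_le_mul_of_nonneg_right (abs_mul_angWt_mul_quad_le hn x) (sq_nonneg (g x))]
  have := integral_nonneg_of_deriv_le
    (F := fun x => angWt n x * quad x * (-2 * x * g x ^ 2))
    (F' := fun x => -2 * n * x * angWt n x * (-2 * x * g x ^ 2) +
      angWt n x * quad x * (-2 * g x ^ 2 + -2 * x * (2 * g x * g' x)))
    (φ := fun x => angWt n x * (quad x * g' x) ^ 2 +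
      ((n : ℝ) - 1) * (angWt n x * (quad x * g x ^ 2)) - ((n : ℝ) + 1) * (angWt n x * g x ^ 2))
    (((continuous_angWt n).mul continuous_quad).mul (by fun_prop))
    (fun x hx => by
      refine (hasDerivAt_angWt_mul_quad n x).mul ?_
      have := ((hasDerivAt_id x).const_mul (-2)).mul ((hg x).pow 2)
      refine this.congr_deriv ?_
      simp)
    ((hi.add (hi1.const_mul _)).sub (hi2.const_mul _))
    (fun x hx => by
      have : (angWt n x * (quad x * g' x) ^ 2 +
      ((n : ℝ) - 1) * (angWt n x * (quad x * g x ^ 2)) - ((n : ℝ) + 1) * (angWt n x * g x ^ 2)) -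
        (-2 * n * x * angWt n x * (-2 * x * g x ^ 2) +
      angWt n x * quad x * (-2 * g x ^ 2 + -2 * x * (2 * g x * g' x)))
        = angWt n x * (quad x * g' x + 2 * x * g x) ^ 2 := by
        unfold quad
        ring
      have h2 : 0 ≤ angWt n x * (quad x * g' x + 2 * x * g x) ^ 2 :=
        mul_nonneg (angWt_pos n x).le (by positivity)
      linarith)
    (hlim _ hbot) (hlim _ htop)
  have hi3 : Integrable fun x => angWt n x * (quad x * g' x) ^ 2 +
      ((n : ℝ) - 1) * (angWt n x * (quad x * g x ^ 2)) := hi.add (hi1.const_mul _)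
  rw [integral_sub hi3 (hi2.const_mul _), integral_add hi (hi1.const_mul _), integral_const_mul,
    integral_const_mul] at this
  linarith

end

/-! ### Tensorization of the variance -/

section

open Set Filter Topology ProbabilityTheory

/-- Twice the variance of `F`, in `[0, ∞]`. -/
def dblVar {X : Type*} [MeasurableSpace X] (μ : Measure X) (F : X → ℝ) : ℝ≥0∞ :=
  ∫⁻ x, ∫⁻ x', ENNReal.ofReal ((F x - F x') ^ 2) ∂μ ∂μ

theorem quadrilateral (a b c d : ℝ) :
    (a - d) ^ 2 + (b - c) ^ 2 ≤ (a - b) ^ 2 + (c - d) ^ 2 + ((a - c) ^ 2 + (b - d) ^ 2) := by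
  nlinarith [sq_nonneg (a - b - c + d)]

section Prod

variable {X Y : Type*} [MeasurableSpace X] [MeasurableSpace Y] (μ : Measure X) (ν : Measure Y)
  [IsProbabilityMeasure μ] [IsProbabilityMeasure ν]

/-- Tensorization of the variance for a product of two probability spaces. -/
theorem dblVar_prod_le {F : X × Y → ℝ} (hF : Measurable F) :
    dblVar (μ.prod ν) F ≤
      (∫⁻ y, dblVar μ (fun x => F (x, y)) ∂ν) + ∫⁻ x, dblVar ν (fun y => F (x, y)) ∂μ := by
  set k : X → Y → X → Y → ℝ≥0∞ := fun x y x' y' => ENNReal.ofReal ((F (x, y) - F (x', y')) ^ 2)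
    with hk
  have hm : ∀ {T : Type _} [MeasurableSpace T] {p p' : T → X × Y}, Measurable p → Measurable p' →
      Measurable fun t => ENNReal.ofReal ((F (p t) - F (p' t)) ^ 2) := fun hp hp' =>
    (((hF.comp hp).sub (hF.comp hp')).pow_const 2).ennreal_ofReal
  have e1 : dblVar (μ.prod ν) F = ∫⁻ z : (X × Y) × (X × Y), k z.1.1 z.1.2 z.2.1 z.2.2
      ∂((μ.prod ν).prod (μ.prod ν)) := by
    rw [lintegral_prod _ (hm measurable_fst measurable_snd).aemeasurable]
    rfl
  -- The swap exchanging the two `Y` coordinates is measure preserving.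
  have hswap : MeasurePreserving
      (fun z : (X × Y) × (X × Y) => (((z.1.1, z.2.2), (z.2.1, z.1.2)) : (X × Y) × (X × Y)))
      ((μ.prod ν).prod (μ.prod ν)) ((μ.prod ν).prod (μ.prod ν)) := by
    refine ⟨by fun_prop, ?_⟩
    symm
    refine Measure.prod_eq_generateFrom (C := image2 (· ×ˢ ·) {s : Set X | MeasurableSet s}
      {t : Set Y | MeasurableSet t}) (D := image2 (· ×ˢ ·) {s : Set X | MeasurableSet s}
      {t : Set Y | MeasurableSet t}) generateFrom_prod generateFrom_prod isPiSystem_prod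
      isPiSystem_prod ⟨fun _ => univ, fun _ => ⟨univ, .univ, univ, .univ, univ_prod_univ⟩,
        fun _ => measure_lt_top _ _, iUnion_const _⟩
      ⟨fun _ => univ, fun _ => ⟨univ, .univ, univ, .univ, univ_prod_univ⟩,
        fun _ => measure_lt_top _ _, iUnion_const _⟩ ?_
    rintro _ ⟨s, hs, t, ht, rfl⟩ _ ⟨s', hs', t', ht', rfl⟩
    rw [Measure.map_apply (by fun_prop) ((hs.prod ht).prod (hs'.prod ht'))]
    have : (fun z : (X × Y) × (X × Y) =>
        (((z.1.1, z.2.2), (z.2.1, z.1.2)) : (X × Y) × (X × Y))) ⁻¹' ((s ×ˢ t) ×ˢ (s' ×ˢ t'))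
        = (s ×ˢ t') ×ˢ (s' ×ˢ t) := by
      ext z; simp only [mem_preimage, mem_prod]; tauto
    rw [this]
    simp only [Measure.prod_prod]
    ring
  have e2 : dblVar (μ.prod ν) F = ∫⁻ z : (X × Y) × (X × Y), k z.1.1 z.2.2 z.2.1 z.1.2
      ∂((μ.prod ν).prod (μ.prod ν)) := by
    rw [e1, ← hswap.lintegral_comp (hm (by fun_prop) (by fun_prop))]
  have m1 : Measurable fun z : (X × Y) × (X × Y) => k z.1.1 z.1.2 z.2.1 z.2.2 :=
    hm (by fun_prop) (by fun_prop)
  have m3 : Measurable fun z : (X × Y) × (X × Y) => k z.1.1 z.1.2 z.2.1 z.1.2 :=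
    hm (by fun_prop) (by fun_prop)
  have m4 : Measurable fun z : (X × Y) × (X × Y) => k z.1.1 z.2.2 z.2.1 z.2.2 :=
    hm (by fun_prop) (by fun_prop)
  have m5 : Measurable fun z : (X × Y) × (X × Y) => k z.1.1 z.1.2 z.1.1 z.2.2 :=
    hm (by fun_prop) (by fun_prop)
  have m6 : Measurable fun z : (X × Y) × (X × Y) => k z.2.1 z.1.2 z.2.1 z.2.2 :=
    hm (by fun_prop) (by fun_prop)
  have hle : 2 * dblVar (μ.prod ν) F ≤
      ∫⁻ z : (X × Y) × (X × Y), (k z.1.1 z.1.2 z.2.1 z.1.2 + k z.1.1 z.2.2 z.2.1 z.2.2) +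
        (k z.1.1 z.1.2 z.1.1 z.2.2 + k z.2.1 z.1.2 z.2.1 z.2.2)
      ∂((μ.prod ν).prod (μ.prod ν)) := by
    rw [two_mul]
    nth_rewrite 1 [e1]
    rw [e2, ← lintegral_add_left m1]
    refine lintegral_mono fun z => ?_
    simp only [hk]
    rw [← ENNReal.ofReal_add (by positivity) (by positivity),
      ← ENNReal.ofReal_add (by positivity) (by positivity),
      ← ENNReal.ofReal_add (by positivity) (by positivity),
      ← ENNReal.ofReal_add (by positivity) (by positivity)]
    refine ENNReal.ofReal_le_ofReal ?_
    have := quadrilateral (F (z.1.1, z.1.2)) (F (z.2.1, z.1.2)) (F (z.1.1, z.2.2))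
      (F (z.2.1, z.2.2))
    nlinarith [this]
  have m34 : Measurable fun z : (X × Y) × (X × Y) =>
      k z.1.1 z.1.2 z.2.1 z.1.2 + k z.1.1 z.2.2 z.2.1 z.2.2 := m3.add m4
  rw [lintegral_add_left m34, lintegral_add_left m3, lintegral_add_left m5] at hle
  have f3 : ∫⁻ z : (X × Y) × (X × Y), k z.1.1 z.1.2 z.2.1 z.1.2 ∂((μ.prod ν).prod (μ.prod ν))
      = ∫⁻ y, dblVar μ (fun x => F (x, y)) ∂ν := by
    rw [lintegral_prod _ m3.aemeasurable]
    have : ∀ z : X × Y, ∫⁻ w : X × Y, k z.1 z.2 w.1 z.2 ∂(μ.prod ν) = ∫⁻ x', k z.1 z.2 x' z.2 ∂μ := by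
      intro z
      rw [lintegral_prod _ (hm (by fun_prop) (by fun_prop)).aemeasurable]
      simp [hk]
    simp_rw [this]
    have mm : Measurable fun z : X × Y => ∫⁻ x', k z.1 z.2 x' z.2 ∂μ :=
      Measurable.lintegral_prod_right' (f := fun p : (X × Y) × X => k p.1.1 p.1.2 p.2 p.1.2)
        (hm (by fun_prop) (by fun_prop))
    rw [lintegral_prod_symm _ mm.aemeasurable]
    rfl
  have f4 : ∫⁻ z : (X × Y) × (X × Y), k z.1.1 z.2.2 z.2.1 z.2.2 ∂((μ.prod ν).prod (μ.prod ν))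
      = ∫⁻ y, dblVar μ (fun x => F (x, y)) ∂ν := by
    rw [← f3, ← hswap.lintegral_comp m4]
  have f5 : ∫⁻ z : (X × Y) × (X × Y), k z.1.1 z.1.2 z.1.1 z.2.2 ∂((μ.prod ν).prod (μ.prod ν))
      = ∫⁻ x, dblVar ν (fun y => F (x, y)) ∂μ := by
    rw [lintegral_prod _ m5.aemeasurable]
    have : ∀ z : X × Y, ∫⁻ w : X × Y, k z.1 z.2 z.1 w.2 ∂(μ.prod ν) = ∫⁻ y', k z.1 z.2 z.1 y' ∂ν := by
      intro z
      rw [lintegral_prod _ (hm (by fun_prop) (by fun_prop)).aemeasurable]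
      simp [hk]
    simp_rw [this]
    have mm : Measurable fun z : X × Y => ∫⁻ y', k z.1 z.2 z.1 y' ∂ν :=
      Measurable.lintegral_prod_right' (f := fun p : (X × Y) × Y => k p.1.1 p.1.2 p.1.1 p.2)
        (hm (by fun_prop) (by fun_prop))
    rw [lintegral_prod _ mm.aemeasurable]
    rfl
  have f6 : ∫⁻ z : (X × Y) × (X × Y), k z.2.1 z.1.2 z.2.1 z.2.2 ∂((μ.prod ν).prod (μ.prod ν))
      = ∫⁻ x, dblVar ν (fun y => F (x, y)) ∂μ := by
    rw [← f5]
    rw [← (Measure.measurePreserving_swap (μ := μ.prod ν) (ν := μ.prod ν)).lintegral_comp m5]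
    refine lintegral_congr fun z => ?_
    simp only [hk, Prod.fst_swap, Prod.snd_swap]
    congr 1; ring
  rw [f3, f4, f5, f6, ← two_mul, ← two_mul, ← mul_add] at hle
  exact (ENNReal.mul_le_mul_iff_right (by norm_num) (by norm_num)).1 hle

end Prod

/-- The Efron–Stein inequality. -/
theorem dblVar_pi_le (γ : Measure ℝ) [IsProbabilityMeasure γ] (n : ℕ) {F : (Fin n → ℝ) → ℝ}
    (hF : Measurable F) :
    dblVar (Measure.pi fun _ : Fin n => γ) F ≤
      ∑ i, ∫⁻ x, dblVar γ (fun s => F (Function.update x i s)) ∂(Measure.pi fun _ : Fin n => γ) := by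
  induction n with
  | zero =>
    have : ∀ x x' : Fin 0 → ℝ, ENNReal.ofReal ((F x - F x') ^ 2) = 0 := fun x x' => by
      rw [Subsingleton.elim x x']; simp
    simp [dblVar, this]
  | succ n ih =>
    set π : Measure (Fin n → ℝ) := Measure.pi fun _ : Fin n => γ
    have hmp := (measurePreserving_piFinSuccAbove (fun _ : Fin (n + 1) => γ) 0).symm
    set e := (MeasurableEquiv.piFinSuccAbove (fun _ : Fin (n + 1) => ℝ) 0).symm with he
    have hmp' : MeasurePreserving e (γ.prod π) (Measure.pi fun _ : Fin (n + 1) => γ) := hmp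
    have he' : ∀ s y, e (s, y) = Fin.cons s y := by
      intro s y
      simp [he, MeasurableEquiv.piFinSuccAbove, Fin.insertNthEquiv]
    set G : ℝ × (Fin n → ℝ) → ℝ := fun p => F (e p)
    have hG : Measurable G := hF.comp e.measurable
    have md : ∀ {T : Type} [MeasurableSpace T] {S : Type} [MeasurableSpace S] (κ : Measure S)
        [SFinite κ] {g : T × S → ℝ}, Measurable g →
        Measurable fun t => dblVar κ fun s => g (t, s) := by
      intro T _ S _ κ _ g hg
      unfold dblVar
      refine Measurable.lintegral_prod_right'
        (f := fun p : T × S => ∫⁻ x', ENNReal.ofReal ((g (p.1, p.2) - g (p.1, x')) ^ 2) ∂κ) ?_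
      refine Measurable.lintegral_prod_right' (f := fun p : (T × S) × S =>
        ENNReal.ofReal ((g (p.1.1, p.1.2) - g (p.1.1, p.2)) ^ 2)) ?_
      exact (((hg.comp (by fun_prop)).sub (hg.comp (by fun_prop))).pow_const 2).ennreal_ofReal
    have e1 : dblVar (Measure.pi fun _ : Fin (n + 1) => γ) F = dblVar (γ.prod π) G := by
      unfold dblVar
      rw [← hmp'.lintegral_comp_emb e.measurableEmbedding]
      refine lintegral_congr fun p => ?_
      rw [← hmp'.lintegral_comp_emb e.measurableEmbedding]
    have e2 : ∀ g : (Fin (n + 1) → ℝ) → ℝ≥0∞, Measurable g →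
        ∫⁻ x, g x ∂(Measure.pi fun _ : Fin (n + 1) => γ) = ∫⁻ s, ∫⁻ y, g (Fin.cons s y) ∂π ∂γ := by
      intro g hg
      rw [← hmp'.lintegral_comp_emb e.measurableEmbedding,
        lintegral_prod (fun p => g (e p)) (hg.comp e.measurable).aemeasurable]
      simp_rw [he']
    have mu : ∀ i : Fin (n + 1), Measurable fun x : Fin (n + 1) → ℝ =>
        dblVar γ fun s => F (Function.update x i s) := fun i =>
      md γ (g := fun p : (Fin (n + 1) → ℝ) × ℝ => F (Function.update p.1 i p.2))
        (hF.comp (by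
          refine measurable_pi_iff.2 fun j => ?_
          rcases eq_or_ne j i with rfl | hj
          · simpa using measurable_snd
          · simp only [Function.update_of_ne hj]; fun_prop))
    rw [e1, Fin.sum_univ_succ]
    refine (dblVar_prod_le γ π hG).trans (add_le_add ?_ ?_)
    · rw [e2 _ (mu 0)]
      simp_rw [Fin.update_cons_zero]
      rw [lintegral_const]
      simp [G, he']
    · have hstep : ∀ s, dblVar π (fun y => G (s, y)) ≤
          ∑ i, ∫⁻ x, dblVar γ (fun t => G (s, Function.update x i t)) ∂π := fun s =>
        ih (hG.comp (by fun_prop))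
      refine (lintegral_mono hstep).trans ?_
      rw [lintegral_finsetSum]
      · refine Finset.sum_le_sum fun i _ => ?_
        rw [e2 _ (mu i.succ)]
        simp [G, he', ← Fin.cons_update]
      · intro i _
        refine Measurable.lintegral_prod_right' (f := fun p : ℝ × (Fin n → ℝ) =>
          dblVar γ (fun t => G (p.1, Function.update p.2 i t))) ?_
        refine md γ (g := fun p : (ℝ × (Fin n → ℝ)) × ℝ => G (p.1.1, Function.update p.1.2 i p.2))
          (hG.comp ?_)
        refine Measurable.prodMk (by fun_prop) (measurable_pi_iff.2 fun j => ?_)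
        rcases eq_or_ne j i with rfl | hj
        · simpa using measurable_snd
        · simp only [Function.update_of_ne hj]; fun_prop

end

/-! ### Polar coordinates in Euclidean space -/

section

open Set Filter Topology ProbabilityTheory

section Polar

variable {n : ℕ}

/-- The unit sphere of `ℝⁿ`. -/
abbrev USphere (n : ℕ) : Type := Metric.sphere (0 : EuclideanSpace ℝ (Fin n)) 1

/-- The surface measure of the unit sphere of `ℝⁿ`. -/
def surf (n : ℕ) : Measure (USphere n) := (volume : Measure (EuclideanSpace ℝ (Fin n))).toSphere

instance : IsFiniteMeasure (surf n) := by unfold surf; infer_instance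

theorem lintegral_volumeIoiPow (m : ℕ) {k : ℝ → ℝ≥0∞} (hk : Measurable k) :
    ∫⁻ r, k r ∂(Measure.volumeIoiPow m) = ∫⁻ r in Ioi (0 : ℝ), ENNReal.ofReal (r ^ m) * k r := by
  unfold Measure.volumeIoiPow
  rw [lintegral_withDensity_eq_lintegral_mul _ (by fun_prop) (by fun_prop)]
  rw [← lintegral_subtype_comap measurableSet_Ioi]
  rfl

theorem integral_volumeIoiPow (m : ℕ) (k : ℝ → ℝ) :
    ∫ r, k r ∂(Measure.volumeIoiPow m) = ∫ r in Ioi (0 : ℝ), r ^ m * k r := by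
  simp only [Measure.volumeIoiPow, ENNReal.ofReal]
  rw [integral_withDensity_eq_integral_smul (measurable_subtype_coe.pow_const _).real_toNNReal,
    integral_subtype_comap measurableSet_Ioi fun a => Real.toNNReal (a ^ m) • k a]
  refine setIntegral_congr_fun measurableSet_Ioi fun x hx => ?_
  simp only [NNReal.smul_def, smul_eq_mul]
  rw [Real.coe_toNNReal _ (pow_nonneg (le_of_lt hx) _)]

variable [Nontrivial (EuclideanSpace ℝ (Fin n))]

theorem lintegral_euclidean_polar {F : EuclideanSpace ℝ (Fin n) → ℝ≥0∞} (hF : Measurable F) :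
    ∫⁻ x, F x = ∫⁻ θ : USphere n, (∫⁻ r in Ioi (0 : ℝ),
      ENNReal.ofReal (r ^ (n - 1)) * F (r • (θ : EuclideanSpace ℝ (Fin n)))) ∂(surf n) := by
  have h1 : ∫⁻ x, F x = ∫⁻ x : ({0}ᶜ : Set (EuclideanSpace ℝ (Fin n))), F x
      ∂(volume.comap Subtype.val) := by
    rw [lintegral_subtype_comap (measurableSet_singleton _).compl, restrict_compl_singleton]
  have h2 := (volume : Measure (EuclideanSpace ℝ (Fin n))).measurePreserving_homeomorphUnitSphereProd
  have h3 := h2.lintegral_comp_emb (Homeomorph.measurableEmbedding _)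
    (fun p => F (p.2.1 • (p.1 : EuclideanSpace ℝ (Fin n))))
  have h4 : ∀ x : ({0}ᶜ : Set (EuclideanSpace ℝ (Fin n))),
      ((homeomorphUnitSphereProd _ x).2.1) • ((homeomorphUnitSphereProd _ x).1 :
        EuclideanSpace ℝ (Fin n)) = x := by
    intro x
    have : ‖(x : EuclideanSpace ℝ (Fin n))‖ ≠ 0 := norm_ne_zero_iff.2 x.2
    simp [smul_smul, this]
  simp_rw [h4] at h3
  rw [h1, h3, lintegral_prod]
  · refine lintegral_congr fun θ => ?_
    rw [lintegral_volumeIoiPow _ (k := fun r => F (r • (θ : EuclideanSpace ℝ (Fin n))))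
      (hF.comp (by fun_prop)), finrank_euclideanSpace_fin]
  · exact (hF.comp (by fun_prop)).aemeasurable

theorem integral_euclidean_polar_mul (g k : _ → ℝ) :
    ∫ x : EuclideanSpace ℝ (Fin n), g (‖x‖⁻¹ • x) * k ‖x‖ =
      (∫ θ : USphere n, g θ ∂(surf n)) * ∫ r in Ioi (0 : ℝ), r ^ (n - 1) * k r := by
  have h1 : ∫ x : EuclideanSpace ℝ (Fin n), g (‖x‖⁻¹ • x) * k ‖x‖ =
      ∫ x : ({0}ᶜ : Set (EuclideanSpace ℝ (Fin n))), g (‖x.1‖⁻¹ • x.1) * k ‖x.1‖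
      ∂(volume.comap Subtype.val) := by
    rw [integral_subtype_comap (measurableSet_singleton _).compl
      (fun x : EuclideanSpace ℝ (Fin n) => g (‖x‖⁻¹ • x) * k ‖x‖), restrict_compl_singleton]
  have h2 := (volume : Measure (EuclideanSpace ℝ (Fin n))).measurePreserving_homeomorphUnitSphereProd
  have h3 := h2.integral_comp (Homeomorph.measurableEmbedding _)
    (fun p => g p.1 * k p.2)
  rw [h1]
  simp only [homeomorphUnitSphereProd_apply_fst_coe, homeomorphUnitSphereProd_apply_snd_coe] at h3
  rw [h3, integral_prod_mul (fun θ : USphere n => g θ) (fun r : Ioi (0:ℝ) => k r),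
    integral_volumeIoiPow, finrank_euclideanSpace_fin]
  rfl

end Polar

end

/-! ### Gauge polar coordinates -/

section

open Set Filter Topology ProbabilityTheory

theorem lintegral_comp_mul {a : ℝ} (ha : 0 < a) {k : ℝ → ℝ≥0∞} (hk : Measurable k) :
    ∫⁻ x, k x = ENNReal.ofReal a * ∫⁻ x, k (a * x) := by
  conv_lhs => rw [← Real.smul_map_volume_mul_left ha.ne']
  rw [lintegral_smul_measure, lintegral_map hk (by fun_prop), abs_of_pos ha, smul_eq_mul]

theorem setLIntegral_Ioi_comp_mul {a : ℝ} (ha : 0 < a) {k : ℝ → ℝ≥0∞} (hk : Measurable k) :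
    ∫⁻ x in Ioi (0 : ℝ), k x = ENNReal.ofReal a * ∫⁻ x in Ioi (0 : ℝ), k (a * x) := by
  rw [← lintegral_indicator measurableSet_Ioi, lintegral_comp_mul ha (hk.indicator measurableSet_Ioi),
    ← lintegral_indicator measurableSet_Ioi]
  congr 2
  funext x
  simp only [indicator, mem_Ioi, mul_pos_iff_of_pos_left ha]

/-- The scale `q^{-1/4}`, `q = 1 + 4τ²`. -/
def scl (τ : ℝ) : ℝ := quad τ ^ (-(1 / 4) : ℝ)

theorem scl_pos (τ : ℝ) : 0 < scl τ := Real.rpow_pos_of_pos (quad_pos τ) _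

theorem continuous_scl : Continuous scl := continuous_quad_rpow _

theorem scl_pow (τ : ℝ) (m : ℕ) : scl τ ^ m = quad τ ^ (-(m : ℝ) / 4) := by
  unfold scl
  rw [← Real.rpow_natCast, ← Real.rpow_mul (quad_pos τ).le]
  congr 1; ring

theorem scl_pow_four_mul (τ : ℝ) : scl τ ^ 4 * quad τ = 1 := by
  rw [scl_pow]
  norm_num
  rw [Real.rpow_neg_one, inv_mul_cancel₀ (quad_pos τ).ne']

theorem angWt_eq (n : ℕ) (τ : ℝ) : angWt n τ = scl τ ^ (n + 4) := by
  rw [scl_pow, angWt]; push_cast; rfl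

theorem hasDerivAt_scl (τ : ℝ) : HasDerivAt scl (-2 * τ * (scl τ / quad τ)) τ := by
  refine (hasDerivAt_quad_rpow _ τ).congr_deriv ?_
  unfold scl; ring

variable {n : ℕ}

/-- The point with gauge `r` and angular coordinates `(θ, τ)`, `τ = t / |x|²`. -/
def polarPt (θ : EuclideanSpace ℝ (Fin n)) (τ r : ℝ) : Space n :=
  ((r * scl τ) • θ, r ^ 2 * scl τ ^ 2 * τ)

theorem continuous_polarPt : Continuous fun p : (EuclideanSpace ℝ (Fin n) × ℝ) × ℝ =>
    polarPt p.1.1 p.1.2 p.2 := by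
  unfold polarPt
  have := continuous_scl
  fun_prop

/-- The polar map on `(S^{n-1} × ℝ) × ℝ`. -/
def polarMap (p : (USphere n × ℝ) × ℝ) : Space n := polarPt p.1.1 p.1.2 p.2

theorem continuous_polarMap : Continuous (polarMap (n := n)) :=
  continuous_polarPt.comp (by fun_prop : Continuous fun p : (USphere n × ℝ) × ℝ =>
    ((((p.1.1 : EuclideanSpace ℝ (Fin n)), p.1.2), p.2) : (EuclideanSpace ℝ (Fin n) × ℝ) × ℝ))

theorem lintegral_polar (hn : 1 ≤ n) {F : Space n → ℝ≥0∞} (hF : Measurable F) :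
    ∫⁻ z, F z = ∫⁻ θ : USphere n, (∫⁻ τ : ℝ, (∫⁻ r in Ioi (0 : ℝ),
      ENNReal.ofReal (scl τ ^ (n + 2) * r ^ (n + 1)) * F (polarPt θ τ r))) ∂(surf n) := by
  have : Nonempty (Fin n) := ⟨⟨0, hn⟩⟩
  rw [Measure.volume_eq_prod, lintegral_prod _ hF.aemeasurable,
    lintegral_euclidean_polar (Measurable.lintegral_prod_right' hF)]
  refine lintegral_congr fun θ => ?_
  have h1 : ∀ r ∈ Ioi (0:ℝ), ENNReal.ofReal (r ^ (n - 1)) *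
      ∫⁻ t, F (r • (θ : EuclideanSpace ℝ (Fin n)), t) =
      ∫⁻ τ : ℝ, ENNReal.ofReal (r ^ (n + 1)) * F (r • (θ : EuclideanSpace ℝ (Fin n)), r ^ 2 * τ) := by
    intro r hr
    have hr : 0 < r := hr
    have hm : Measurable fun τ : ℝ => F (r • (θ : EuclideanSpace ℝ (Fin n)), r ^ 2 * τ) :=
      hF.comp (by fun_prop)
    rw [lintegral_comp_mul (pow_pos hr 2) (k := fun t => F (r • (θ : EuclideanSpace ℝ (Fin n)), t))
      (hF.comp (by fun_prop)), ← mul_assoc, ← ENNReal.ofReal_mul (by positivity), ← pow_add,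
      lintegral_const_mul _ hm]
    congr 3; omega
  rw [setLIntegral_congr_fun measurableSet_Ioi h1, lintegral_lintegral_swap]
  · refine lintegral_congr fun τ => ?_
    rw [setLIntegral_Ioi_comp_mul (scl_pos τ), ← lintegral_const_mul]
    · refine setLIntegral_congr_fun measurableSet_Ioi fun r hr => ?_
      have hs := scl_pos τ
      have hr : 0 < r := hr
      rw [← mul_assoc, ← ENNReal.ofReal_mul (by positivity)]
      have e1 : scl τ * (scl τ * r) ^ (n + 1) = scl τ ^ (n + 2) * r ^ (n + 1) := by ring
      have e2 : (((scl τ * r) • (θ : EuclideanSpace ℝ (Fin n)), (scl τ * r) ^ 2 * τ) : Space n) =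
          polarPt θ τ r := by
        unfold polarPt
        congr 1
        · rw [mul_comm]
        · ring
      rw [e1, e2]
    · exact Measurable.mul (by fun_prop) (hF.comp (by fun_prop))
    · exact Measurable.mul (by fun_prop) (hF.comp (by fun_prop))
  · refine AEMeasurable.mul (by fun_prop) (hF.comp ?_).aemeasurable
    fun_prop

/-- The angular measure on the gauge sphere, in the coordinates `(θ, τ)`. -/
def angMeasure (n : ℕ) : Measure (USphere n × ℝ) :=
  (surf n).prod ((volume : Measure ℝ).withDensity fun τ => ENNReal.ofReal (scl τ ^ (n + 2)))

/-- The radial measure `r^{Q-1} dr`. -/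
def radMeasure (n : ℕ) : Measure ℝ :=
  (volume.restrict (Ioi (0 : ℝ))).withDensity fun r => ENNReal.ofReal (r ^ (n + 1))

instance : SFinite (radMeasure n) := by unfold radMeasure; infer_instance

theorem integrable_scl_pow (hn : 2 ≤ n) : Integrable fun τ => scl τ ^ (n + 2) := by
  simp_rw [scl_pow]
  refine integrable_quad_rpow ?_
  have : (2:ℝ) ≤ n := by exact_mod_cast hn
  push_cast; linarith

theorem isFiniteMeasure_angMeasure (hn : 2 ≤ n) : IsFiniteMeasure (angMeasure n) := by
  have : IsFiniteMeasure ((volume : Measure ℝ).withDensity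
      fun τ => ENNReal.ofReal (scl τ ^ (n + 2))) :=
    isFiniteMeasure_withDensity_ofReal (integrable_scl_pow hn).2
  unfold angMeasure; infer_instance

instance : SFinite (angMeasure n) := by unfold angMeasure; infer_instance

theorem map_polarMap (hn : 1 ≤ n) :
    ((angMeasure n).prod (radMeasure n)).map polarMap = (volume : Measure (Space n)) := by
  have hs : Continuous scl := continuous_scl
  have hm : Measurable (polarMap (n := n)) := continuous_polarMap.measurable
  refine Measure.ext_of_lintegral _ fun F hF => ?_
  have hF' : Measurable fun p : (USphere n × ℝ) × ℝ => F (polarMap p) := hF.comp hm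
  rw [lintegral_map hF hm, lintegral_prod _ hF'.aemeasurable, angMeasure,
    lintegral_prod _ (Measurable.lintegral_prod_right' hF').aemeasurable, lintegral_polar hn hF]
  refine lintegral_congr fun θ => ?_
  have hm3 : Measurable fun τ => ∫⁻ r, F (polarMap ((θ, τ), r)) ∂(radMeasure n) :=
    (Measurable.lintegral_prod_right' hF').comp measurable_prodMk_left
  rw [lintegral_withDensity_eq_lintegral_mul _ (by fun_prop) hm3]
  refine lintegral_congr fun τ => ?_
  have hm2 : Measurable fun r => F (polarMap ((θ, τ), r)) := hF'.comp measurable_prodMk_left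
  simp only [Pi.mul_apply]
  rw [radMeasure, lintegral_withDensity_eq_lintegral_mul _ (by fun_prop) hm2,
    ← lintegral_const_mul _ (Measurable.mul (by fun_prop) hm2)]
  refine setLIntegral_congr_fun measurableSet_Ioi fun r hr => ?_
  simp only [Pi.mul_apply]
  rw [← mul_assoc, ← ENNReal.ofReal_mul (pow_nonneg (scl_pos τ).le _)]
  rfl

theorem measurePreserving_polarMap (hn : 1 ≤ n) :
    MeasurePreserving (polarMap (n := n)) ((angMeasure n).prod (radMeasure n)) volume :=
  ⟨continuous_polarMap.measurable, map_polarMap hn⟩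

theorem integral_radMeasure (k : ℝ → ℝ) :
    ∫ r, k r ∂(radMeasure n) = ∫ r in Ioi (0 : ℝ), r ^ (n + 1) * k r := by
  simp only [radMeasure, ENNReal.ofReal]
  rw [integral_withDensity_eq_integral_smul (by fun_prop)]
  refine setIntegral_congr_fun measurableSet_Ioi fun x hx => ?_
  simp only [NNReal.smul_def, smul_eq_mul]
  rw [Real.coe_toNNReal _ (pow_nonneg (le_of_lt hx) _)]

theorem integrable_radMeasure_iff {k : ℝ → ℝ} :
    Integrable k (radMeasure n) ↔ IntegrableOn (fun r => r ^ (n + 1) * k r) (Ioi 0) := by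
  simp only [radMeasure, ENNReal.ofReal]
  rw [integrable_withDensity_iff_integrable_smul (by fun_prop)]
  refine integrableOn_congr_fun (fun x hx => ?_) measurableSet_Ioi
  simp only [NNReal.smul_def, smul_eq_mul]
  rw [Real.coe_toNNReal _ (pow_nonneg (le_of_lt hx) _)]

theorem integrable_comp_polarMap (hn : 1 ≤ n) {F : Space n → ℝ} (hF : Integrable F) :
    Integrable (fun p => F (polarMap p)) ((angMeasure n).prod (radMeasure n)) :=
  (measurePreserving_polarMap hn).integrable_comp_of_integrable hF

/-- Integration in polar coordinates. -/
theorem integral_polar (hn : 1 ≤ n) {F : Space n → ℝ} (hF : Integrable F) :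
    ∫ z, F z = ∫ σ, (∫ r in Ioi (0 : ℝ), r ^ (n + 1) * F (polarMap (σ, r))) ∂(angMeasure n) := by
  have h : AEStronglyMeasurable F (((angMeasure n).prod (radMeasure n)).map polarMap) := by
    rw [map_polarMap hn]; exact hF.1
  have := integral_map continuous_polarMap.measurable.aemeasurable h
  rw [map_polarMap hn] at this
  rw [this, integral_prod _ (integrable_comp_polarMap hn hF)]
  simp_rw [integral_radMeasure]

theorem integral_angMeasure (G : USphere n → ℝ → ℝ)
    (hG : Integrable (fun σ : USphere n × ℝ => G σ.1 σ.2) (angMeasure n)) :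
    ∫ σ, G σ.1 σ.2 ∂(angMeasure n) =
      ∫ θ, (∫ τ, scl τ ^ (n + 2) * G θ τ) ∂(surf n) := by
  have hs : Continuous scl := continuous_scl
  rw [angMeasure, integral_prod _ hG]
  refine integral_congr_ae (Eventually.of_forall fun θ => ?_)
  simp only [ENNReal.ofReal]
  rw [integral_withDensity_eq_integral_smul (by fun_prop)]
  refine integral_congr_ae (Eventually.of_forall fun τ => ?_)
  simp only [NNReal.smul_def, smul_eq_mul]
  rw [Real.coe_toNNReal _ (pow_nonneg (scl_pos τ).le _)]

end

/-! ### The Gaussian Poincaré inequality -/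

section

open Set Filter Topology ProbabilityTheory

theorem dblVar_eq {X : Type*} [MeasurableSpace X] {μ : Measure X} [IsProbabilityMeasure μ]
    {g : X → ℝ} (h1 : Integrable g μ) (h2 : Integrable (fun x => g x ^ 2) μ) :
    dblVar μ g = ENNReal.ofReal (2 * ∫ x, g x ^ 2 ∂μ - 2 * (∫ x, g x ∂μ) ^ 2) := by
  have e : ∀ x x', (g x - g x') ^ 2 = g x ^ 2 - 2 * g x * g x' + g x' ^ 2 := fun x x' => by ring
  have i1 : ∀ x, Integrable (fun x' => g x ^ 2 - 2 * g x * g x') μ := fun x =>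
    (integrable_const _).sub (h1.const_mul _)
  have i2 : ∀ x, Integrable (fun x' => (g x - g x') ^ 2) μ := fun x => by
    simp_rw [e]; exact (i1 x).add h2
  have inner : ∀ x, ∫ x', (g x - g x') ^ 2 ∂μ =
      g x ^ 2 - 2 * (∫ y, g y ∂μ) * g x + ∫ y, g y ^ 2 ∂μ := by
    intro x
    simp_rw [e]
    rw [integral_add (i1 x) h2, integral_sub (integrable_const _) (h1.const_mul _),
      integral_const_mul]
    simp
    ring
  have i3 : Integrable (fun x => g x ^ 2 - 2 * (∫ y, g y ∂μ) * g x) μ := h2.sub (h1.const_mul _)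
  have i4 : Integrable (fun x => ∫ x', (g x - g x') ^ 2 ∂μ) μ := by
    simp_rw [inner]
    exact i3.add (integrable_const _)
  unfold dblVar
  simp_rw [fun x => (ofReal_integral_eq_lintegral_ofReal (i2 x)
    (Eventually.of_forall fun x' => sq_nonneg _)).symm]
  rw [← ofReal_integral_eq_lintegral_ofReal i4
    (Eventually.of_forall fun x => integral_nonneg fun x' => sq_nonneg _)]
  congr 1
  simp_rw [inner]
  rw [integral_add i3 (integrable_const _), integral_sub h2 (h1.const_mul _), integral_const_mul]
  simp
  ring

/-- The standard Gaussian measure on `ℝ`. -/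
abbrev gauss : Measure ℝ := gaussianReal 0 1

theorem gaussianPDFReal_std (x : ℝ) :
    gaussianPDFReal 0 1 x = (Real.sqrt (2 * Real.pi))⁻¹ * Real.exp (-x ^ 2 / 2) := by
  simp [gaussianPDFReal]

theorem integrable_gauss_iff {g : ℝ → ℝ} :
    Integrable g gauss ↔ Integrable fun x => g x * Real.exp (-x ^ 2 / 2) := by
  have hc : IsUnit (Real.sqrt (2 * Real.pi))⁻¹ := by
    rw [isUnit_iff_ne_zero]; positivity
  rw [gauss, gaussianReal_of_var_ne_zero _ one_ne_zero,
    integrable_withDensity_iff_integrable_smul' (measurable_gaussianPDF 0 1)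
      (Eventually.of_forall fun x => ENNReal.ofReal_lt_top),
    ← integrable_const_mul_iff hc fun x => g x * Real.exp (-x ^ 2 / 2)]
  refine integrable_congr (Eventually.of_forall fun x => ?_)
  simp only [toReal_gaussianPDF, smul_eq_mul, gaussianPDFReal_std]
  ring

theorem integral_gauss (g : ℝ → ℝ) :
    ∫ x, g x ∂gauss = (Real.sqrt (2 * Real.pi))⁻¹ * ∫ x, g x * Real.exp (-x ^ 2 / 2) := by
  rw [gauss, integral_gaussianReal_eq_integral_smul one_ne_zero, ← integral_const_mul]
  refine integral_congr_ae (Eventually.of_forall fun x => ?_)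
  simp only [smul_eq_mul, gaussianPDFReal_std]
  ring

/-- The one-dimensional Gaussian Poincaré inequality for Lipschitz functions. -/
theorem dblVar_gauss_le {g : ℝ → ℝ} (hg : Differentiable ℝ g) {C : ℝ}
    (hC : ∀ x, |deriv g x| ≤ C) :
    dblVar gauss g ≤ 2 * ∫⁻ x, ENNReal.ofReal (deriv g x ^ 2) ∂gauss := by
  obtain ⟨j1, j2, hle⟩ := gaussian_hardy hg hC
  have k1 : Integrable (fun x => (g x - g 0) ^ 2) gauss := integrable_gauss_iff.2 j1
  have k2 : Integrable (fun x => deriv g x ^ 2) gauss := integrable_gauss_iff.2 j2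
  have k0 : Integrable (fun x => g x - g 0) gauss := by
    refine (k1.add (integrable_const 1)).mono' (hg.continuous.sub continuous_const).aestronglyMeasurable
      (Eventually.of_forall fun x => ?_)
    simp only [Pi.add_apply, Real.norm_eq_abs]
    nlinarith [sq_nonneg (|g x - g 0| - 1), sq_abs (g x - g 0), abs_nonneg (g x - g 0)]
  have e : dblVar gauss g = dblVar gauss fun x => g x - g 0 := by
    unfold dblVar; simp
  rw [e, dblVar_eq k0 k1, ← ofReal_integral_eq_lintegral_ofReal k2
    (Eventually.of_forall fun x => sq_nonneg _), ← ENNReal.ofReal_ofNat 2,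
    ← ENNReal.ofReal_mul (by norm_num)]
  refine ENNReal.ofReal_le_ofReal ?_
  rw [integral_gauss, integral_gauss (fun x => deriv g x ^ 2)]
  have hc : 0 ≤ (Real.sqrt (2 * Real.pi))⁻¹ := by positivity
  nlinarith [mul_le_mul_of_nonneg_left hle hc, sq_nonneg (∫ x, g x - g 0 ∂gauss)]

/-- Averaging over one coordinate does not change the integral. -/
theorem lintegral_pi_update (γ : Measure ℝ) [IsProbabilityMeasure γ] {n : ℕ} (i : Fin n)
    {G : (Fin n → ℝ) → ℝ≥0∞} (hG : Measurable G) :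
    ∫⁻ x, (∫⁻ s, G (Function.update x i s) ∂γ) ∂(Measure.pi fun _ : Fin n => γ) =
      ∫⁻ x, G x ∂(Measure.pi fun _ : Fin n => γ) := by
  obtain ⟨m, rfl⟩ : ∃ m, n = m + 1 := ⟨n - 1, by have := i.pos; omega⟩
  have hmp := (measurePreserving_piFinSuccAbove (fun _ : Fin (m + 1) => γ) i).symm
  set e := (MeasurableEquiv.piFinSuccAbove (fun _ : Fin (m + 1) => ℝ) i).symm with he
  have he' : ∀ s y, e (s, y) = i.insertNth s y := by
    intro s y
    simp [he, MeasurableEquiv.piFinSuccAbove, Fin.insertNthEquiv]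
  have hGe : Measurable fun p => G (e p) := hG.comp e.measurable
  rw [← hmp.lintegral_comp_emb e.measurableEmbedding, ← hmp.lintegral_comp_emb e.measurableEmbedding]
  have h1 : ∀ p : ℝ × (Fin m → ℝ), ∫⁻ s, G (Function.update (e p) i s) ∂γ = ∫⁻ s, G (e (s, p.2)) ∂γ := by
    intro p
    refine lintegral_congr fun s => ?_
    rw [he' s, ← Prod.mk.eta (p := p), he' p.1, Fin.update_insertNth]
  simp_rw [h1]
  have hm : Measurable fun p : ℝ × (Fin m → ℝ) => ∫⁻ s, G (e (s, p.2)) ∂γ :=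
    Measurable.lintegral_prod_right' (f := fun q : (ℝ × (Fin m → ℝ)) × ℝ => G (e (q.2, q.1.2)))
      (hGe.comp (by fun_prop))
  rw [lintegral_prod _ hm.aemeasurable, lintegral_prod_symm _ hGe.aemeasurable]
  simp

/-- The Gaussian Poincaré inequality for functions that are Lipschitz and differentiable on almost
every coordinate line. -/
theorem dblVar_pi_gauss_le {n : ℕ} {F : (Fin n → ℝ) → ℝ} (hF : Measurable F)
    {D : Fin n → (Fin n → ℝ) → ℝ} (hD : ∀ i, Measurable (D i))
    (h : ∀ i, ∀ᵐ x ∂(Measure.pi fun _ : Fin n => gauss), ∃ C : ℝ, ∀ s,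
      HasDerivAt (fun s => F (Function.update x i s)) (D i (Function.update x i s)) s ∧
      |D i (Function.update x i s)| ≤ C) :
    dblVar (Measure.pi fun _ : Fin n => gauss) F ≤
      2 * ∑ i, ∫⁻ x, ENNReal.ofReal (D i x ^ 2) ∂(Measure.pi fun _ : Fin n => gauss) := by
  refine (dblVar_pi_le gauss n hF).trans ?_
  rw [Finset.mul_sum]
  refine Finset.sum_le_sum fun i _ => ?_
  have hm : Measurable fun x => ENNReal.ofReal (D i x ^ 2) := ((hD i).pow_const 2).ennreal_ofReal
  rw [← lintegral_pi_update gauss i hm, ← lintegral_const_mul' _ _ (by norm_num)]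
  refine lintegral_mono_ae ?_
  filter_upwards [h i] with x hx
  obtain ⟨C, hC⟩ := hx
  have hd : ∀ s, deriv (fun s => F (Function.update x i s)) s = D i (Function.update x i s) :=
    fun s => (hC s).1.deriv
  have := dblVar_gauss_le (g := fun s => F (Function.update x i s))
    (fun s => (hC s).1.differentiableAt) (C := C) (fun s => by rw [hd]; exact (hC s).2)
  simpa only [hd] using this

theorem lintegral_pi_prod (n : ℕ) {f : Fin n → ℝ → ℝ≥0∞} (hf : ∀ i, Measurable (f i)) :
    ∫⁻ x : Fin n → ℝ, ∏ i, f i (x i) = ∏ i, ∫⁻ s, f i s := by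
  induction n with
  | zero => simp [volume_pi]
  | succ n ih =>
    have hmp := (volume_preserving_piFinSuccAbove (fun _ : Fin (n + 1) => ℝ) 0).symm
    set e := (MeasurableEquiv.piFinSuccAbove (fun _ : Fin (n + 1) => ℝ) 0).symm with he
    have he' : ∀ p, e p = Fin.cons p.1 p.2 := by
      intro p
      simp [he, MeasurableEquiv.piFinSuccAbove, Fin.insertNthEquiv]
    have hp : Measurable fun x : Fin n → ℝ => ∏ i : Fin n, f i.succ (x i) :=
      Finset.measurable_prod _ fun i _ => (hf _).comp (measurable_pi_apply i)
    rw [← hmp.lintegral_comp_emb e.measurableEmbedding, Fin.prod_univ_succ, ← ih fun i => hf _,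
      Measure.volume_eq_prod, ← lintegral_prod_mul (hf 0).aemeasurable hp.aemeasurable]
    refine lintegral_congr fun p => ?_
    rw [he', Fin.prod_univ_succ]
    simp

theorem pi_gauss_eq (n : ℕ) : (Measure.pi fun _ : Fin n => gauss) =
    (volume : Measure (Fin n → ℝ)).withDensity fun x => ∏ i, gaussianPDF 0 1 (x i) := by
  refine Measure.pi_eq fun s hs => ?_
  rw [withDensity_apply _ (MeasurableSet.univ_pi hs), ← lintegral_indicator (MeasurableSet.univ_pi hs)]
  have h1 : ∀ x : Fin n → ℝ, (univ.pi s).indicator (fun x => ∏ i, gaussianPDF 0 1 (x i)) x =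
      ∏ i, (s i).indicator (gaussianPDF 0 1) (x i) := by
    intro x
    by_cases hx : x ∈ univ.pi s
    · rw [indicator_of_mem hx]
      exact Finset.prod_congr rfl fun i _ => (indicator_of_mem (hx i (mem_univ i)) _).symm
    · rw [indicator_of_notMem hx]
      simp only [Set.mem_pi, mem_univ, true_implies, not_forall] at hx
      obtain ⟨i, hi⟩ := hx
      exact (Finset.prod_eq_zero (Finset.mem_univ i) (indicator_of_notMem hi _)).symm
  simp_rw [h1]
  rw [lintegral_pi_prod n fun i => (measurable_gaussianPDF 0 1).indicator (hs i)]
  refine Finset.prod_congr rfl fun i _ => ?_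
  rw [lintegral_indicator (hs i), gauss, gaussianReal_apply _ one_ne_zero]

theorem prod_gaussianPDF {n : ℕ} (x : Fin n → ℝ) :
    ∏ i, gaussianPDF 0 1 (x i) = ENNReal.ofReal ((Real.sqrt (2 * Real.pi))⁻¹ ^ n *
      Real.exp (-‖(WithLp.toLp 2 x : EuclideanSpace ℝ (Fin n))‖ ^ 2 / 2)) := by
  simp only [gaussianPDF]
  rw [← ENNReal.ofReal_prod_of_nonneg fun i _ => gaussianPDFReal_nonneg _ _ _]
  congr 1
  simp_rw [gaussianPDFReal_std, Finset.prod_mul_distrib, ← Real.exp_sum]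
  rw [EuclideanSpace.norm_sq_eq]
  simp [Finset.sum_div, Finset.sum_neg_distrib, neg_div]

theorem integral_pi_gauss {n : ℕ} (G : EuclideanSpace ℝ (Fin n) → ℝ) :
    ∫ x : Fin n → ℝ, G (WithLp.toLp 2 x) ∂(Measure.pi fun _ : Fin n => gauss) =
      (Real.sqrt (2 * Real.pi))⁻¹ ^ n * ∫ x, G x * Real.exp (-‖x‖ ^ 2 / 2) := by
  rw [pi_gauss_eq]
  simp_rw [prod_gaussianPDF, ENNReal.ofReal]
  rw [integral_withDensity_eq_integral_smul (by fun_prop), ← integral_const_mul,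
    ← (PiLp.volume_preserving_toLp (Fin n)).integral_comp
      (MeasurableEquiv.toLp 2 (Fin n → ℝ)).measurableEmbedding]
  refine integral_congr_ae (Eventually.of_forall fun x => ?_)
  simp only [NNReal.smul_def, smul_eq_mul]
  rw [Real.coe_toNNReal _ (by positivity)]
  ring

theorem integrable_pi_gauss {n : ℕ} {G : EuclideanSpace ℝ (Fin n) → ℝ}
    (hG : Integrable fun x => G x * Real.exp (-‖x‖ ^ 2 / 2)) :
    Integrable (fun x : Fin n → ℝ => G (WithLp.toLp 2 x)) (Measure.pi fun _ : Fin n => gauss) := by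
  rw [pi_gauss_eq]
  simp_rw [prod_gaussianPDF, ENNReal.ofReal]
  rw [integrable_withDensity_iff_integrable_smul (by fun_prop)]
  have h1 := ((PiLp.volume_preserving_toLp (Fin n)).integrable_comp_emb
      (MeasurableEquiv.toLp 2 (Fin n → ℝ)).measurableEmbedding).2
      (hG.const_mul ((Real.sqrt (2 * Real.pi))⁻¹ ^ n))
  refine h1.congr (Eventually.of_forall fun x => ?_)
  simp only [NNReal.smul_def, smul_eq_mul, Function.comp]
  rw [Real.coe_toNNReal _ (by positivity)]
  ring

end

/-! ### The Poincaré inequality on the Euclidean sphere -/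

section

open Set Filter Topology ProbabilityTheory

variable {n : ℕ}

/-- The projection of the `i`-th basis vector to the orthogonal complement of `w`, `‖w‖ = 1`. -/
def tang (i : Fin n) (w : EuclideanSpace ℝ (Fin n)) : EuclideanSpace ℝ (Fin n) :=
  EuclideanSpace.single i 1 - w i • w

theorem continuous_tang (i : Fin n) : Continuous (tang i) := by unfold tang; fun_prop

theorem sum_smul_single (w : EuclideanSpace ℝ (Fin n)) :
    ∑ i, w i • EuclideanSpace.single i (1 : ℝ) = w := by
  ext j
  simp [Finset.sum_apply, Pi.single_apply]

theorem sum_sq_eq (w : EuclideanSpace ℝ (Fin n)) : ∑ i, w i ^ 2 = ‖w‖ ^ 2 := by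
  rw [EuclideanSpace.norm_sq_eq]; simp

theorem sum_smul_tang {w : EuclideanSpace ℝ (Fin n)} (hw : ‖w‖ = 1) :
    ∑ i, w i • tang i w = 0 := by
  unfold tang
  simp_rw [smul_sub, smul_smul]
  rw [Finset.sum_sub_distrib, sum_smul_single, ← Finset.sum_smul]
  simp_rw [← sq]
  rw [sum_sq_eq, hw]
  simp

/-- The homogeneous extension of degree one of the restriction of `h` to the unit sphere. -/
def homExt (h : EuclideanSpace ℝ (Fin n) → ℝ) (x : EuclideanSpace ℝ (Fin n)) : ℝ :=
  ‖x‖ * h (‖x‖⁻¹ • x)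

/-- The partial derivatives of `homExt h` away from the origin. -/
def homExtDeriv (h : EuclideanSpace ℝ (Fin n) → ℝ) (i : Fin n) (x : EuclideanSpace ℝ (Fin n)) : ℝ :=
  (‖x‖⁻¹ • x) i * h (‖x‖⁻¹ • x) + fderiv ℝ h (‖x‖⁻¹ • x) (tang i (‖x‖⁻¹ • x))

theorem hasDerivAt_homExt {h : EuclideanSpace ℝ (Fin n) → ℝ} (hh : Differentiable ℝ h) (i : Fin n)
    {y : ℝ → EuclideanSpace ℝ (Fin n)} {s : ℝ}
    (hy : HasDerivAt y (EuclideanSpace.single i 1) s) (h0 : y s ≠ 0) :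
    HasDerivAt (fun s => homExt h (y s)) (homExtDeriv h i (y s)) s := by
  have hn0 : ‖y s‖ ≠ 0 := norm_ne_zero_iff.2 h0
  have hN : HasDerivAt (fun s => ‖y s‖) ((‖y s‖⁻¹ • y s) i) s := by
    have h1 := hy.norm_sq.sqrt (by positivity)
    simp only [Real.sqrt_sq (norm_nonneg _)] at h1
    refine h1.congr_deriv ?_
    rw [EuclideanSpace.inner_single_right]
    simp
    field_simp
  have hω : HasDerivAt (fun s => ‖y s‖⁻¹ • y s) (‖y s‖⁻¹ • tang i (‖y s‖⁻¹ • y s)) s := by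
    have h1 := (hN.inv hn0).smul hy
    refine h1.congr_deriv ?_
    unfold tang
    ext j
    by_cases hj : j = i
    · simp [hj]
      field_simp
      ring
    · simp [hj]
      field_simp
  have h2 := (hh (‖y s‖⁻¹ • y s)).hasFDerivAt.comp_hasDerivAt s hω
  refine (hN.mul h2).congr_deriv ?_
  simp only [homExtDeriv, map_smul, smul_eq_mul, Function.comp]
  field_simp

theorem sum_homExtDeriv_sq (h : EuclideanSpace ℝ (Fin n) → ℝ) {x : EuclideanSpace ℝ (Fin n)}
    (hx : x ≠ 0) : ∑ i, homExtDeriv h i x ^ 2 =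
      h (‖x‖⁻¹ • x) ^ 2 + ∑ i, fderiv ℝ h (‖x‖⁻¹ • x) (tang i (‖x‖⁻¹ • x)) ^ 2 := by
  have hw : ‖‖x‖⁻¹ • x‖ = 1 := by
    rw [norm_smul, norm_inv, norm_norm, inv_mul_cancel₀ (norm_ne_zero_iff.2 hx)]
  unfold homExtDeriv
  generalize ‖x‖⁻¹ • x = w at hw
  have e : ∀ i, (w i * h w + fderiv ℝ h w (tang i w)) ^ 2 = h w ^ 2 * w i ^ 2 +
      2 * h w * fderiv ℝ h w (w i • tang i w) + fderiv ℝ h w (tang i w) ^ 2 := by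
    intro i; rw [map_smul, smul_eq_mul]; ring
  simp_rw [e]
  rw [Finset.sum_add_distrib, Finset.sum_add_distrib, ← Finset.mul_sum, ← Finset.mul_sum,
    ← map_sum, sum_smul_tang hw, sum_sq_eq, hw]
  simp

theorem norm_unit_le (x : EuclideanSpace ℝ (Fin n)) : ‖‖x‖⁻¹ • x‖ ≤ 1 := by
  rw [norm_smul, norm_inv, norm_norm]
  exact inv_mul_le_one

theorem exists_homExtDeriv_bound {h : EuclideanSpace ℝ (Fin n) → ℝ} (hh : ContDiff ℝ 1 h) :
    ∃ C, ∀ x, |h (‖x‖⁻¹ • x)| ≤ C ∧ ∀ i, |homExtDeriv h i x| ≤ C := by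
  have hc : ∀ i, Continuous fun w : EuclideanSpace ℝ (Fin n) =>
      w i * h w + fderiv ℝ h w (tang i w) := fun i => by
    have := hh.continuous
    have h2 := hh.continuous_fderiv one_ne_zero
    have h3 := continuous_tang i
    fun_prop
  have hK := isCompact_closedBall (0 : EuclideanSpace ℝ (Fin n)) 1
  obtain ⟨C0, hC0⟩ := hK.exists_bound_of_continuousOn hh.continuous.continuousOn
  choose C hC using fun i => hK.exists_bound_of_continuousOn (hc i).continuousOn
  refine ⟨C0 + ∑ i, |C i|, fun x => ?_⟩
  have hx : ‖x‖⁻¹ • x ∈ Metric.closedBall (0 : EuclideanSpace ℝ (Fin n)) 1 := by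
    simpa using norm_unit_le x
  have h0 : 0 ≤ C0 := (norm_nonneg _).trans (hC0 _ hx)
  refine ⟨(hC0 _ hx).trans (le_add_of_nonneg_right (Finset.sum_nonneg fun i _ => abs_nonneg _)),
    fun i => ?_⟩
  calc |homExtDeriv h i x| ≤ C i := hC i _ hx
    _ ≤ |C i| := le_abs_self _
    _ ≤ ∑ i, |C i| := Finset.single_le_sum (f := fun i => |C i|) (fun i _ => abs_nonneg _)
        (Finset.mem_univ i)
    _ ≤ _ := le_add_of_nonneg_left h0

theorem measurable_unit : Measurable fun x : EuclideanSpace ℝ (Fin n) => ‖x‖⁻¹ • x := by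
  fun_prop

/-- The Gaussian radial moments. -/
def gaussMoment (n k : ℕ) : ℝ := ∫ r in Ioi (0 : ℝ), r ^ (n - 1) * (r ^ k * Real.exp (-r ^ 2 / 2))

theorem gaussMoment_eq (hn : 1 ≤ n) (k : ℕ) : gaussMoment n k =
    (1 / 2 : ℝ) ^ (-((n + k : ℕ) : ℝ) / 2) * (1 / 2) * Real.Gamma (((n + k : ℕ) : ℝ) / 2) := by
  have h1 := integral_rpow_mul_exp_neg_mul_rpow (p := 2) (q := ((n + k - 1 : ℕ) : ℝ)) (b := 1 / 2)
    (by norm_num) (by have : (0:ℝ) ≤ ((n + k - 1 : ℕ) : ℝ) := Nat.cast_nonneg _; linarith)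
    (by norm_num)
  have h2 : ((n + k - 1 : ℕ) : ℝ) + 1 = ((n + k : ℕ) : ℝ) := by
    rw [Nat.cast_sub (by omega)]; push_cast; ring
  rw [h2] at h1
  rw [← h1, gaussMoment]
  refine setIntegral_congr_fun measurableSet_Ioi fun r hr => ?_
  rw [Real.rpow_natCast, ← mul_assoc, ← pow_add, Real.rpow_two]
  congr 2
  · omega
  · ring

theorem gaussMoment_pos (hn : 1 ≤ n) (k : ℕ) : 0 < gaussMoment n k := by
  rw [gaussMoment_eq hn]
  have : (0:ℝ) < ((n + k : ℕ) : ℝ) := by exact_mod_cast (by omega : 0 < n + k)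
  have := Real.Gamma_pos_of_pos (half_pos this)
  positivity

theorem gaussMoment_two (hn : 1 ≤ n) : gaussMoment n 2 = n * gaussMoment n 0 := by
  rw [gaussMoment_eq hn, gaussMoment_eq hn]
  have h0 : (0:ℝ) < n := by exact_mod_cast hn
  have e : (((n + 2 : ℕ) : ℝ)) / 2 = (n : ℝ) / 2 + 1 := by push_cast; ring
  rw [e, Real.Gamma_add_one (by positivity)]
  have e2 : (-((n + 2 : ℕ) : ℝ)) / 2 = -(n : ℝ) / 2 - 1 := by push_cast; ring
  rw [e2, Real.rpow_sub_one (by norm_num)]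
  simp only [add_zero]
  ring

theorem integrable_norm_pow_mul_exp [Nontrivial (EuclideanSpace ℝ (Fin n))] (k : ℕ) :
    Integrable fun x : EuclideanSpace ℝ (Fin n) => ‖x‖ ^ k * Real.exp (-‖x‖ ^ 2 / 2) := by
  rw [integrable_fun_norm_addHaar volume (f := fun r : ℝ => r ^ k * Real.exp (-r ^ 2 / 2)),
    finrank_euclideanSpace_fin]
  have := (integrable_rpow_mul_exp_neg_mul_sq (b := 1/2) (by norm_num) (s := ((n - 1 + k : ℕ) : ℝ))
    (by have : (0:ℝ) ≤ ((n - 1 + k : ℕ) : ℝ) := Nat.cast_nonneg _; linarith)).integrableOn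
      (s := Ioi (0:ℝ))
  refine this.congr_fun (fun r hr => ?_) measurableSet_Ioi
  simp only [smul_eq_mul]
  rw [Real.rpow_natCast, pow_add, mul_assoc]
  congr 3; ring

/-- The Poincaré inequality on the unit sphere, for functions of mean zero. -/
theorem sphere_poincare_of_integral_eq_zero (hn : 2 ≤ n) {h : EuclideanSpace ℝ (Fin n) → ℝ}
    (hh : ContDiff ℝ 1 h) (h0 : ∫ θ : USphere n, h θ ∂(surf n) = 0) :
    ((n : ℝ) - 1) * ∫ θ : USphere n, h θ ^ 2 ∂(surf n) ≤
      ∫ θ : USphere n, (∑ i, fderiv ℝ h θ (tang i θ) ^ 2) ∂(surf n) := by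
  have : Nonempty (Fin n) := ⟨⟨0, by omega⟩⟩
  have hhc := hh.continuous
  have hhf := hh.continuous_fderiv one_ne_zero
  obtain ⟨C, hC⟩ := exists_homExtDeriv_bound hh
  have mu : Measurable fun x : EuclideanSpace ℝ (Fin n) => h (‖x‖⁻¹ • x) :=
    hhc.measurable.comp measurable_unit
  have mH : Measurable (homExt h) := measurable_norm.mul mu
  have mD : ∀ i, Measurable (homExtDeriv h i) := fun i =>
    Measurable.comp (g := fun w : EuclideanSpace ℝ (Fin n) => w i * h w + fderiv ℝ h w (tang i w))
      (by
        have h3 := continuous_tang i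
        have : Continuous fun w : EuclideanSpace ℝ (Fin n) =>
          w i * h w + fderiv ℝ h w (tang i w) := by fun_prop
        exact this.measurable) measurable_unit
  have mt : Measurable (WithLp.toLp 2 : (Fin n → ℝ) → EuclideanSpace ℝ (Fin n)) := by fun_prop
  have main := dblVar_pi_gauss_le (F := fun x => homExt h (WithLp.toLp 2 x))
    (mH.comp mt) (D := fun i x => homExtDeriv h i (WithLp.toLp 2 x)) (fun i => (mD i).comp mt)
    (fun i => by
      obtain ⟨j, hj⟩ : ∃ j : Fin n, j ≠ i := by
        have : Nontrivial (Fin n) := Fin.nontrivial_iff_two_le.2 hn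
        exact exists_ne i
      have : NullSingletonClass gauss := nullSingletonClass_gaussianReal one_ne_zero
      have hnull := Measure.pi_hyperplane (fun _ : Fin n => gauss) j 0
      filter_upwards [measure_eq_zero_iff_ae_notMem.1 hnull] with x hx
      refine ⟨C, fun s => ⟨?_, (hC _).2 i⟩⟩
      refine hasDerivAt_homExt (hh.differentiable one_ne_zero) i
        (y := fun s => WithLp.toLp 2 (Function.update x i s)) ?_ ?_
      · have h1 := hasDerivAt_update x i s
        have h2 := (PiLp.continuousLinearEquiv 2 ℝ (fun _ : Fin n => ℝ)).symm.hasFDerivAt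
          (x := Function.update x i s) |>.comp_hasDerivAt s h1
        refine h2.congr_deriv ?_
        ext k
        simp
      · intro hz
        apply hx
        have := congrArg (fun v : EuclideanSpace ℝ (Fin n) => v j) hz
        simpa [Function.update_of_ne hj] using this)
  have iD : ∀ i, Integrable (fun x : Fin n → ℝ => homExtDeriv h i (WithLp.toLp 2 x) ^ 2)
      (Measure.pi fun _ : Fin n => gauss) := fun i => by
    refine Integrable.of_bound (((mD i).comp mt).pow_const 2).aestronglyMeasurable (C ^ 2)
      (Eventually.of_forall fun x => ?_)
    rw [Real.norm_of_nonneg (sq_nonneg _), ← sq_abs]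
    exact pow_le_pow_left₀ (abs_nonneg _) ((hC _).2 i) 2
  have iH2 : Integrable (fun x : Fin n → ℝ => homExt h (WithLp.toLp 2 x) ^ 2)
      (Measure.pi fun _ : Fin n => gauss) := by
    refine integrable_pi_gauss (G := fun x => homExt h x ^ 2) ?_
    refine ((integrable_norm_pow_mul_exp 2).const_mul (C ^ 2)).mono'
      ((mH.pow_const 2).mul (by fun_prop)).aestronglyMeasurable (Eventually.of_forall fun x => ?_)
    rw [Real.norm_of_nonneg (by positivity), homExt, mul_pow, ← mul_assoc]
    have : h (‖x‖⁻¹ • x) ^ 2 ≤ C ^ 2 := by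
      rw [← sq_abs]; exact pow_le_pow_left₀ (abs_nonneg _) (hC x).1 2
    have h3 : 0 ≤ ‖x‖ ^ 2 := by positivity
    refine mul_le_mul_of_nonneg_right ?_ (Real.exp_pos _).le
    nlinarith
  have iH : Integrable (fun x : Fin n → ℝ => homExt h (WithLp.toLp 2 x))
      (Measure.pi fun _ : Fin n => gauss) := by
    refine (iH2.add (integrable_const 1)).mono' (mH.comp mt).aestronglyMeasurable
      (Eventually.of_forall fun x => ?_)
    simp only [Pi.add_apply, Real.norm_eq_abs]
    set a := homExt h (WithLp.toLp 2 x)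
    nlinarith [sq_nonneg (|a| - 1), sq_abs a, abs_nonneg a]
  set c : ℝ := (Real.sqrt (2 * Real.pi))⁻¹ ^ n with hc
  have hcpos : 0 < c := by positivity
  have vH : ∫ x : Fin n → ℝ, homExt h (WithLp.toLp 2 x) ∂(Measure.pi fun _ : Fin n => gauss) = 0 := by
    rw [integral_pi_gauss]
    have := integral_euclidean_polar_mul (n := n) h (fun r => r * Real.exp (-r ^ 2 / 2))
    rw [h0, zero_mul] at this
    have e : ∀ x : EuclideanSpace ℝ (Fin n), homExt h x * Real.exp (-‖x‖ ^ 2 / 2) =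
      h (‖x‖⁻¹ • x) * (‖x‖ * Real.exp (-‖x‖ ^ 2 / 2)) := fun x => by unfold homExt; ring
    simp_rw [e, this, mul_zero]
  have vH2 : ∫ x : Fin n → ℝ, homExt h (WithLp.toLp 2 x) ^ 2 ∂(Measure.pi fun _ : Fin n => gauss) =
      c * ((∫ θ : USphere n, h θ ^ 2 ∂(surf n)) * gaussMoment n 2) := by
    rw [integral_pi_gauss fun x => homExt h x ^ 2, gaussMoment]
    rw [← integral_euclidean_polar_mul (n := n) (fun w => h w ^ 2)
      (fun r => r ^ 2 * Real.exp (-r ^ 2 / 2))]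
    congr 2
    funext x; unfold homExt; ring
  have vD : ∫ x : Fin n → ℝ, (∑ i, homExtDeriv h i (WithLp.toLp 2 x) ^ 2)
      ∂(Measure.pi fun _ : Fin n => gauss) =
      c * ((∫ θ : USphere n, (h θ ^ 2 + ∑ i, fderiv ℝ h θ (tang i θ) ^ 2) ∂(surf n)) *
        gaussMoment n 0) := by
    rw [integral_pi_gauss fun x => ∑ i, homExtDeriv h i x ^ 2, gaussMoment]
    rw [← integral_euclidean_polar_mul (n := n)
      (fun w => h w ^ 2 + ∑ i, fderiv ℝ h w (tang i w) ^ 2)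
      (fun r => r ^ 0 * Real.exp (-r ^ 2 / 2))]
    congr 1
    refine integral_congr_ae ?_
    have : ∀ᵐ x : EuclideanSpace ℝ (Fin n), x ≠ 0 := by
      simp [ae_iff]
    filter_upwards [this] with x hx
    rw [sum_homExtDeriv_sq h hx]
    ring
  rw [dblVar_eq iH iH2, vH, vH2] at main
  have e1 : 2 * ∑ i, ∫⁻ x : Fin n → ℝ, ENNReal.ofReal (homExtDeriv h i (WithLp.toLp 2 x) ^ 2)
      ∂(Measure.pi fun _ : Fin n => gauss) = ENNReal.ofReal (2 * (c *
      ((∫ θ : USphere n, (h θ ^ 2 + ∑ i, fderiv ℝ h θ (tang i θ) ^ 2) ∂(surf n)) *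
        gaussMoment n 0))) := by
    rw [← vD, integral_finsetSum _ fun i _ => iD i, ENNReal.ofReal_mul (by norm_num),
      ENNReal.ofReal_ofNat, ENNReal.ofReal_sum_of_nonneg fun i _ => integral_nonneg fun x =>
        sq_nonneg _]
    congr 1
    refine Finset.sum_congr rfl fun i _ => ?_
    rw [ofReal_integral_eq_lintegral_ofReal (iD i) (Eventually.of_forall fun x => sq_nonneg _)]
  rw [e1] at main
  have cs : ∀ g : EuclideanSpace ℝ (Fin n) → ℝ, Continuous g →
      Integrable (fun θ : USphere n => g θ) (surf n) := fun g hg =>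
    (hg.comp continuous_subtype_val).integrable_of_hasCompactSupport
      (HasCompactSupport.of_compactSpace _)
  have ct : Continuous fun w : EuclideanSpace ℝ (Fin n) => ∑ i, fderiv ℝ h w (tang i w) ^ 2 := by
    refine continuous_finsetSum _ fun i _ => ?_
    have h3 := continuous_tang i
    fun_prop
  rw [integral_add (cs (fun w => h w ^ 2) (hhc.pow 2)) (cs _ ct)] at main
  have hE : 0 ≤ ∫ θ : USphere n, (∑ i, fderiv ℝ h θ (tang i θ) ^ 2) ∂(surf n) :=
    integral_nonneg fun θ => Finset.sum_nonneg fun i _ => sq_nonneg _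
  have hA : 0 ≤ ∫ θ : USphere n, h θ ^ 2 ∂(surf n) := integral_nonneg fun θ => sq_nonneg _
  have hm := gaussMoment_pos (n := n) (by omega) 0
  rw [ENNReal.ofReal_le_ofReal_iff (by positivity), gaussMoment_two (by omega)] at main
  have : 0 ≤ 2 * c * gaussMoment n 0 *
      ((∫ θ : USphere n, (∑ i, fderiv ℝ h θ (tang i θ) ^ 2) ∂(surf n)) -
        ((n : ℝ) - 1) * ∫ θ : USphere n, h θ ^ 2 ∂(surf n)) := by nlinarith
  have := nonneg_of_mul_nonneg_right this (by positivity)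
  linarith

end

/-! ### The weighted spectral gap -/

section

open Set Filter Topology ProbabilityTheory

section Compact

variable {K : Type*} [TopologicalSpace K] [CompactSpace K] [MeasurableSpace K]
  [OpensMeasurableSpace K] {μ : Measure K} [IsFiniteMeasure μ]

theorem integrable_of_continuous_compact {k : K → ℝ} (hk : Continuous k) : Integrable k μ :=
  hk.integrable_of_hasCompactSupport (HasCompactSupport.of_compactSpace _)

theorem continuous_integral_compact {k : ℝ → K → ℝ} (hk : Continuous (Function.uncurry k)) :
    Continuous fun τ => ∫ θ, k τ θ ∂μ := by
  have := continuous_parametric_integral_of_continuous (μ := μ) hk (s := univ) isCompact_univ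
  simpa using this

theorem hasDerivAt_integral_compact [SecondCountableTopology K] {k k' : ℝ → K → ℝ} (hk : Continuous (Function.uncurry k))
    (hk' : Continuous (Function.uncurry k')) (hd : ∀ τ θ, HasDerivAt (fun τ => k τ θ) (k' τ θ) τ)
    (τ : ℝ) : HasDerivAt (fun τ => ∫ θ, k τ θ ∂μ) (∫ θ, k' τ θ ∂μ) τ := by
  obtain ⟨C, hC⟩ := ((isCompact_closedBall τ 1).prod (isCompact_univ (X := K))).exists_bound_of_continuousOn
    hk'.continuousOn
  refine (hasDerivAt_integral_of_dominated_loc_of_deriv_le (μ := μ) (bound := fun _ => C)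
    (F := k) (F' := k') (Metric.closedBall_mem_nhds τ one_pos)
    (Eventually.of_forall fun t => Continuous.aestronglyMeasurable (by fun_prop))
    (integrable_of_continuous_compact (by fun_prop))
    (Continuous.aestronglyMeasurable (by fun_prop))
    (Eventually.of_forall fun θ t ht => hC (t, θ) ⟨ht, mem_univ _⟩) (integrable_const _)
    (Eventually.of_forall fun θ t _ => hd t θ)).2

theorem integral_sub_sq_eq [NeZero μ] {k : K → ℝ} (hk : Continuous k) (a : ℝ) :
    ∫ θ, (k θ - a) ^ 2 ∂μ = ∫ θ, (k θ - (μ.real univ)⁻¹ * ∫ θ, k θ ∂μ) ^ 2 ∂μ +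
      μ.real univ * ((μ.real univ)⁻¹ * (∫ θ, k θ ∂μ) - a) ^ 2 := by
  have hM : μ.real univ ≠ 0 := measureReal_univ_ne_zero
  have i1 : Integrable k μ := integrable_of_continuous_compact hk
  have i2 : Integrable (fun θ => k θ ^ 2) μ := integrable_of_continuous_compact (by fun_prop)
  have e : ∀ b : ℝ, ∫ θ, (k θ - b) ^ 2 ∂μ =
      ∫ θ, k θ ^ 2 ∂μ - 2 * b * ∫ θ, k θ ∂μ + μ.real univ * b ^ 2 := by
    intro b
    have e1 : ∀ θ, (k θ - b) ^ 2 = k θ ^ 2 - 2 * b * k θ + b ^ 2 := fun θ => by ring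
    simp_rw [e1]
    have i3 : Integrable (fun θ => k θ ^ 2 - 2 * b * k θ) μ := i2.sub (i1.const_mul _)
    rw [integral_add i3 (integrable_const _), integral_sub i2 (i1.const_mul _),
      integral_const_mul]
    simp
  rw [e, e]
  field_simp
  ring

end Compact

variable {n : ℕ}

/-- The mean value over the unit sphere. -/
def sphereMean (k : USphere n → ℝ) : ℝ := ((surf n).real univ)⁻¹ * ∫ θ, k θ ∂(surf n)

theorem neZero_surf (hn : 1 ≤ n) : NeZero (surf n) := by
  have : Nonempty (Fin n) := ⟨⟨0, hn⟩⟩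
  exact ⟨Measure.toSphere_ne_zero _⟩

theorem integrable_angWt_mul (hn : 2 ≤ n) {G : USphere n × ℝ → ℝ} (hG : Continuous G) {C : ℝ}
    (hC : ∀ p, |scl p.2 ^ 2 * G p| ≤ C) :
    Integrable (fun p => angWt n p.2 * G p) ((surf n).prod volume) := by
  have h1 := ((integrable_scl_pow hn).comp_snd (surf n)).const_mul C
  have hw := continuous_angWt n
  refine h1.mono' (Continuous.aestronglyMeasurable (by fun_prop)) (Eventually.of_forall fun p => ?_)
  have e : angWt n p.2 * G p = scl p.2 ^ (n + 2) * (scl p.2 ^ 2 * G p) := by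
    rw [angWt_eq]; ring
  have hs := pow_pos (scl_pos p.2) (n + 2)
  rw [e, norm_mul, Real.norm_of_nonneg hs.le, Real.norm_eq_abs, mul_comm]
  exact mul_le_mul_of_nonneg_right (hC p) hs.le

theorem scl_sq_mul_quad (τ : ℝ) : scl τ ^ 2 * (scl τ ^ 2 * quad τ) = 1 := by
  rw [← mul_assoc, ← pow_add]; exact scl_pow_four_mul τ

theorem scl_le_one (τ : ℝ) : scl τ ≤ 1 :=
  Real.rpow_le_one_of_one_le_of_nonpos (one_le_quad τ) (by norm_num)

theorem tendsto_scl {l : Filter ℝ} (hl : Tendsto (fun τ : ℝ => |τ|) l atTop) :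
    Tendsto scl l (𝓝 0) := by
  have h1 : Tendsto quad l atTop := by
    refine tendsto_atTop_mono (fun τ => ?_) hl
    unfold quad
    nlinarith [sq_abs τ, sq_nonneg (|τ| - 1), abs_nonneg τ]
  exact (tendsto_rpow_neg_atTop (by norm_num)).comp h1

/-- The spectral gap of the gauge sphere, in abstract form: spherical means are subtracted and the
two parts are treated by one-dimensional inequalities. -/
theorem angular_poincare_aux (hn : 2 ≤ n) {g g' X : USphere n → ℝ → ℝ}
    (hg : Continuous (Function.uncurry g)) (hg' : Continuous (Function.uncurry g'))
    (hX : Continuous (Function.uncurry X))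
    (hd : ∀ θ τ, HasDerivAt (g θ) (g' θ τ) τ) {C : ℝ}
    (b1 : ∀ θ τ, |scl τ * (quad τ * g' θ τ)| ≤ C) (b2 : ∀ θ τ, |g θ τ| ≤ C)
    (b3 : ∀ θ θ' τ, |g θ τ - g θ' τ| ≤ C * scl τ)
    (b4 : ∀ θ τ, |scl τ ^ 2 * X θ τ| ≤ C)
    (sp : ∀ τ, ((n : ℝ) - 1) * (quad τ * ∫ θ, (g θ τ - sphereMean (fun θ => g θ τ)) ^ 2 ∂(surf n)) ≤
      ∫ θ, X θ τ ∂(surf n)) :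
    ((n : ℝ) + 1) * ∫ θ, (∫ τ, angWt n τ * (g θ τ - sphereMean (fun θ => g θ 0)) ^ 2) ∂(surf n) ≤
      ∫ θ, (∫ τ, angWt n τ * ((quad τ * g' θ τ) ^ 2 + X θ τ)) ∂(surf n) := by
  have := neZero_surf (n := n) (by omega)
  set μ := surf n with hμ
  set M := μ.real univ with hM
  have hM0 : M ≠ 0 := measureReal_univ_ne_zero
  have hMpos : 0 < M := lt_of_le_of_ne measureReal_nonneg hM0.symm
  have hC0 : 0 ≤ C := by
    obtain ⟨θ⟩ := Measure.nonempty_of_neZero μ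
    exact (abs_nonneg _).trans (b2 θ 0)
  have hq := continuous_quad
  have hs := continuous_scl
  have hw := continuous_angWt n
  have cgs : Continuous (Function.uncurry fun τ θ => g θ τ) := by fun_prop
  have cgs' : Continuous (Function.uncurry fun τ θ => g' θ τ) := by fun_prop
  set a : ℝ → ℝ := fun τ => sphereMean fun θ => g θ τ with ha
  set a' : ℝ → ℝ := fun τ => sphereMean fun θ => g' θ τ with ha'
  have ca : Continuous a := (continuous_integral_compact cgs).const_mul _
  have ca' : Continuous a' := (continuous_integral_compact cgs').const_mul _
  have da : ∀ τ, HasDerivAt a (a' τ) τ := fun τ =>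
    (hasDerivAt_integral_compact cgs cgs' (fun τ θ => hd θ τ) τ).const_mul _
  -- The mean of a bounded function obeys the same bound.
  have mean_le : ∀ {k : USphere n → ℝ} {B : ℝ}, (∀ θ, |k θ| ≤ B) → |sphereMean k| ≤ B := by
    intro k B hB
    have h1 : ‖∫ θ, k θ ∂μ‖ ≤ B * M := norm_integral_le_of_norm_le_const (Eventually.of_forall hB)
    unfold sphereMean
    rw [abs_mul, abs_of_pos (inv_pos.2 hMpos), inv_mul_le_iff₀ hMpos, mul_comm]
    exact h1
  have mean_mul : ∀ (k : USphere n → ℝ) (b : ℝ), sphereMean (fun θ => b * k θ) = b * sphereMean k := by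
    intro k b
    unfold sphereMean
    rw [integral_const_mul]; ring
  have ba : ∀ τ, |a τ| ≤ C := fun τ => mean_le fun θ => b2 θ τ
  have ba' : ∀ τ, |scl τ * (quad τ * a' τ)| ≤ C := fun τ => by
    rw [ha', ← mean_mul, ← mean_mul]
    exact mean_le fun θ => b1 θ τ
  have bw : ∀ θ τ, |g θ τ - a τ| ≤ C * scl τ := by
    intro θ τ
    have h1 : g θ τ - a τ = sphereMean fun θ' => g θ τ - g θ' τ := by
      simp only [ha, sphereMean]
      rw [integral_sub (integrable_const _) (integrable_of_continuous_compact (by fun_prop))]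
      simp only [integral_const, smul_eq_mul]
      rw [mul_sub, ← mul_assoc, inv_mul_cancel₀ hM0, one_mul]
    rw [h1]
    exact mean_le fun θ' => b3 θ θ' τ
  have sq_le : ∀ {x B : ℝ}, |x| ≤ B → x ^ 2 ≤ B ^ 2 := fun {x B} h => by
    rw [← sq_abs]; exact pow_le_pow_left₀ (abs_nonneg _) h 2
  have sone : ∀ τ, scl τ ^ 2 ≤ 1 := fun τ => pow_le_one₀ (scl_pos τ).le (scl_le_one τ)
  have spos : ∀ τ, 0 < scl τ ^ 2 := fun τ => pow_pos (scl_pos τ) 2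
  -- Integrability of the quadratic quantities on the product.
  have I1 : Integrable (fun p : USphere n × ℝ => angWt n p.2 * (quad p.2 * g' p.1 p.2) ^ 2)
      (μ.prod volume) :=
    integrable_angWt_mul hn (by fun_prop) (C := C ^ 2) fun p => by
      rw [← mul_pow, abs_of_nonneg (sq_nonneg _)]; exact sq_le (b1 _ _)
  have I2 : Integrable (fun p : USphere n × ℝ => angWt n p.2 * X p.1 p.2) (μ.prod volume) :=
    integrable_angWt_mul hn (by fun_prop) (C := C) fun p => b4 _ _
  have I3 : Integrable (fun p : USphere n × ℝ => angWt n p.2 * (quad p.2 * (g p.1 p.2 - a p.2) ^ 2))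
      (μ.prod volume) :=
    integrable_angWt_mul hn (by fun_prop) (C := C ^ 2) fun p => by
      have h1 := sq_le (bw p.1 p.2)
      have h2 := quad_pos p.2
      rw [abs_of_nonneg (by positivity)]
      calc scl p.2 ^ 2 * (quad p.2 * (g p.1 p.2 - a p.2) ^ 2)
          ≤ scl p.2 ^ 2 * (quad p.2 * (C * scl p.2) ^ 2) := by gcongr
        _ = C ^ 2 * (scl p.2 ^ 2 * (scl p.2 ^ 2 * quad p.2)) := by ring
        _ = C ^ 2 := by rw [scl_sq_mul_quad, mul_one]
  have I4 : ∀ b : ℝ → ℝ, Continuous b → (∀ τ, |b τ| ≤ C) →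
      Integrable (fun p : USphere n × ℝ => angWt n p.2 * (g p.1 p.2 - b p.2) ^ 2)
      (μ.prod volume) := fun b hb hbC =>
    integrable_angWt_mul hn (by fun_prop) (C := (2 * C) ^ 2) fun p => by
      have h1 : (g p.1 p.2 - b p.2) ^ 2 ≤ (2 * C) ^ 2 := sq_le ((abs_sub _ _).trans (by
        linarith [b2 p.1 p.2, hbC p.2]))
      rw [abs_of_nonneg (by positivity)]
      nlinarith [sone p.2, spos p.2, sq_nonneg (g p.1 p.2 - b p.2)]
  have I5 : Integrable (fun p : USphere n × ℝ => angWt n p.2 *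
      (quad p.2 * (g' p.1 p.2 - a' p.2)) ^ 2) (μ.prod volume) :=
    integrable_angWt_mul hn (by fun_prop) (C := (2 * C) ^ 2) fun p => by
      rw [← mul_pow, abs_of_nonneg (sq_nonneg _), mul_sub, mul_sub]
      exact sq_le ((abs_sub _ _).trans (by linarith [b1 p.1 p.2, ba' p.2]))
  have I6 : Integrable fun τ => angWt n τ * (quad τ * a' τ) ^ 2 := by
    have := integrable_angWt_mul hn (G := fun p : USphere n × ℝ => (quad p.2 * a' p.2) ^ 2)
      (by fun_prop) (C := C ^ 2) fun p => by
        rw [← mul_pow, abs_of_nonneg (sq_nonneg _)]; exact sq_le (ba' _)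
    exact (Integrable.comp_snd_iff (μ := μ) (f := fun τ => angWt n τ * (quad τ * a' τ) ^ 2)
      (NeZero.ne μ)).1 this
  have I7 : Integrable fun τ => angWt n τ * (a τ - a 0) ^ 2 := by
    refine ((integrable_angWt n).const_mul ((2 * C) ^ 2)).mono'
      (Continuous.aestronglyMeasurable (by fun_prop)) (Eventually.of_forall fun τ => ?_)
    have h1 : (a τ - a 0) ^ 2 ≤ (2 * C) ^ 2 := sq_le ((abs_sub _ _).trans (by
        linarith [ba τ, ba 0]))
    have := angWt_pos n τ
    rw [Real.norm_of_nonneg (by positivity), mul_comm]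
    exact mul_le_mul_of_nonneg_right h1 this.le
  have S1 := integral_integral_swap (f := fun θ τ => angWt n τ * (quad τ * g' θ τ) ^ 2) I1
  have S2 := integral_integral_swap (f := fun θ τ => angWt n τ * X θ τ) I2
  have S3 := integral_integral_swap (f := fun θ τ => angWt n τ * (quad τ * (g θ τ - a τ) ^ 2)) I3
  have I4' := I4 (fun _ => a 0) continuous_const fun _ => ba 0
  have S4 := integral_integral_swap (f := fun θ τ => angWt n τ * (g θ τ - a τ) ^ 2) (I4 a ca ba)
  have S4' := integral_integral_swap (f := fun θ τ => angWt n τ * (g θ τ - a 0) ^ 2) I4'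
  have S5 := integral_integral_swap
    (f := fun θ τ => angWt n τ * (quad τ * (g' θ τ - a' τ)) ^ 2) I5
  -- The part with spherical mean zero.
  have P1 : ((n : ℝ) + 1) * ∫ θ, (∫ τ, angWt n τ * (g θ τ - a τ) ^ 2) ∂μ ≤
      (∫ θ, (∫ τ, angWt n τ * (quad τ * (g' θ τ - a' τ)) ^ 2) ∂μ) +
      ((n : ℝ) - 1) * ∫ θ, (∫ τ, angWt n τ * (quad τ * (g θ τ - a τ) ^ 2)) ∂μ := by
    have i5 := I5.integral_prod_left
    have i3 := I3.integral_prod_left.const_mul ((n : ℝ) - 1)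
    have i4 := (I4 a ca ba).integral_prod_left.const_mul ((n : ℝ) + 1)
    rw [← integral_const_mul, ← integral_const_mul, ← integral_add i5 i3]
    refine integral_mono_ae i4 (i5.add i3) ?_
    filter_upwards [I5.prod_right_ae, I3.prod_right_ae, (I4 a ca ba).prod_right_ae] with θ h5 h3 h4
    have hlim : ∀ l : Filter ℝ, Tendsto (fun τ : ℝ => |τ|) l atTop →
        Tendsto (fun τ => g θ τ - a τ) l (𝓝 0) := fun l hl => by
      have := (tendsto_scl hl).const_mul C
      rw [mul_zero] at this
      exact squeeze_zero_norm (fun τ => bw θ τ) this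
    exact pole_hardy hn (fun τ => (hd θ τ).sub (da τ)) (hlim _ tendsto_abs_atBot_atTop)
      (hlim _ tendsto_abs_atTop_atTop) h5 h3 h4
  -- The tangential energy controls it.
  have P2 : ((n : ℝ) - 1) * ∫ θ, (∫ τ, angWt n τ * (quad τ * (g θ τ - a τ) ^ 2)) ∂μ ≤
      ∫ θ, (∫ τ, angWt n τ * X θ τ) ∂μ := by
    rw [S3, S2, ← integral_const_mul]
    refine integral_mono (I3.integral_prod_right.const_mul _) I2.integral_prod_right fun τ => ?_
    simp only [integral_const_mul]
    have := mul_le_mul_of_nonneg_left (sp τ) (angWt_pos n τ).le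
    calc _ = angWt n τ * (((n : ℝ) - 1) * (quad τ * ∫ θ, (g θ τ - a τ) ^ 2 ∂μ)) := by ring
      _ ≤ _ := this
  -- The spherical means.
  have P3 : ((n : ℝ) + 1) * ∫ τ, angWt n τ * (a τ - a 0) ^ 2 ≤
      ∫ τ, angWt n τ * (quad τ * a' τ) ^ 2 :=
    equator_hardy hn (g := fun τ => a τ - a 0) (fun τ => (da τ).sub_const _) (sub_self _)
      (C := 2 * C) (fun τ => (abs_sub _ _).trans (by linarith [ba τ, ba 0])) I6 I7
  have P4 : ∫ θ, (∫ τ, angWt n τ * (g θ τ - a 0) ^ 2) ∂μ =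
      (∫ θ, (∫ τ, angWt n τ * (g θ τ - a τ) ^ 2) ∂μ) + M * ∫ τ, angWt n τ * (a τ - a 0) ^ 2 := by
    rw [S4', S4, ← integral_const_mul,
      ← integral_add (I4 a ca ba).integral_prod_right (I7.const_mul _)]
    refine integral_congr_ae (Eventually.of_forall fun τ => ?_)
    simp only [integral_const_mul]
    rw [integral_sub_sq_eq (μ := μ) (k := fun θ => g θ τ) (by fun_prop) (a 0)]
    simp only [ha, sphereMean]
    ring
  have P5 : ∫ θ, (∫ τ, angWt n τ * (quad τ * g' θ τ) ^ 2) ∂μ =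
      (∫ θ, (∫ τ, angWt n τ * (quad τ * (g' θ τ - a' τ)) ^ 2) ∂μ) +
        M * ∫ τ, angWt n τ * (quad τ * a' τ) ^ 2 := by
    rw [S1, S5, ← integral_const_mul,
      ← integral_add I5.integral_prod_right (I6.const_mul _)]
    refine integral_congr_ae (Eventually.of_forall fun τ => ?_)
    simp only [mul_pow, integral_const_mul]
    have := integral_sub_sq_eq (μ := μ) (k := fun θ => g' θ τ) (by fun_prop) 0
    simp only [sub_zero] at this
    rw [this]
    simp only [ha', sphereMean]
    ring
  have P6 : ∫ θ, (∫ τ, angWt n τ * ((quad τ * g' θ τ) ^ 2 + X θ τ)) ∂μ =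
      (∫ θ, (∫ τ, angWt n τ * (quad τ * g' θ τ) ^ 2) ∂μ) + ∫ θ, (∫ τ, angWt n τ * X θ τ) ∂μ := by
    rw [← integral_add I1.integral_prod_left I2.integral_prod_left]
    refine integral_congr_ae ?_
    filter_upwards [I1.prod_right_ae, I2.prod_right_ae] with θ h1 h2
    rw [← integral_add h1 h2]
    simp_rw [mul_add]
  change ((n : ℝ) + 1) * ∫ θ, (∫ τ, angWt n τ * (g θ τ - a 0) ^ 2) ∂μ ≤ _
  rw [P6, P4, P5]
  nlinarith [mul_le_mul_of_nonneg_left P3 hMpos.le]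

end

/-! ### Geometry of the gauge -/

section

open Set Filter Topology

variable {n : ℕ}

theorem rho_nonneg (z : Space n) : 0 ≤ rho z := Real.rpow_nonneg (by positivity) _

theorem rho_pow_four (z : Space n) : rho z ^ 4 = ‖z.1‖ ^ 4 + 4 * z.2 ^ 2 := by
  unfold rho
  rw [← Real.rpow_natCast, ← Real.rpow_mul (by positivity)]
  norm_num

theorem rho_eq_zero_iff {z : Space n} : rho z = 0 ↔ z = 0 := by
  constructor
  · intro h
    have h4 := rho_pow_four z
    rw [h] at h4
    have h1 : ‖z.1‖ ^ 4 = 0 := by nlinarith [pow_nonneg (norm_nonneg z.1) 4, sq_nonneg z.2]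
    have h2 : z.2 ^ 2 = 0 := by nlinarith [pow_nonneg (norm_nonneg z.1) 4, sq_nonneg z.2]
    ext1
    · exact norm_eq_zero.1 (pow_eq_zero_iff (by norm_num) |>.1 h1)
    · exact pow_eq_zero_iff (by norm_num) |>.1 h2
  · rintro rfl
    simp [rho]

theorem rho_pos {z : Space n} (hz : z ≠ 0) : 0 < rho z :=
  lt_of_le_of_ne (rho_nonneg z) fun h => hz (rho_eq_zero_iff.1 h.symm)

theorem continuous_rho : Continuous (rho (n := n)) := by
  unfold rho
  exact Continuous.rpow_const (by fun_prop) fun z => Or.inr (by norm_num)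

theorem contDiffAt_rho {z : Space n} (hz : z ≠ 0) {k : WithTop ℕ∞} : ContDiffAt ℝ k rho z := by
  have h1 : ContDiff ℝ k fun z : Space n => ‖z.1‖ ^ 4 + 4 * z.2 ^ 2 := by
    have : (fun z : Space n => ‖z.1‖ ^ 4 + 4 * z.2 ^ 2) =
        fun z : Space n => (‖z.1‖ ^ 2) ^ 2 + 4 * z.2 ^ 2 := by funext z; ring
    rw [this]
    have h : ContDiff ℝ k fun z : Space n => ‖z.1‖ ^ 2 := contDiff_fst.norm_sq ℝ
    fun_prop
  refine h1.contDiffAt.rpow_const_of_ne ?_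
  rw [← rho_pow_four]
  exact (pow_pos (rho_pos hz) 4).ne'

theorem fderiv_rho {z : Space n} (hz : z ≠ 0) (η : Space n) :
    fderiv ℝ rho z η = (‖z.1‖ ^ 2 * inner ℝ z.1 η.1 + 2 * z.2 * η.2) / rho z ^ 3 := by
  have hd : HasFDerivAt rho (fderiv ℝ rho z) z :=
    ((contDiffAt_rho hz (k := 1)).differentiableAt one_ne_zero).hasFDerivAt
  have hl : HasDerivAt (fun s : ℝ => z + s • η) η 0 := by
    simpa using ((hasDerivAt_id (0:ℝ)).smul_const η).const_add z
  have h0 : z + (0:ℝ) • η = z := by simp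
  have h1 : HasDerivAt (fun s : ℝ => rho (z + s • η)) (fderiv ℝ rho z η) 0 := by
    have : HasFDerivAt rho (fderiv ℝ rho z) (z + (0:ℝ) • η) := by rw [h0]; exact hd
    exact this.comp_hasDerivAt 0 hl
  have h2 := h1.pow 4
  have hx : HasDerivAt (fun s : ℝ => (z + s • η).1) η.1 0 := hl.fst
  have ht : HasDerivAt (fun s : ℝ => (z + s • η).2) η.2 0 := hl.snd
  have h3 := ((hx.norm_sq.pow 2).add ((ht.pow 2).const_mul 4))
  have e : (fun s : ℝ => rho (z + s • η)) ^ 4 = ((fun s : ℝ => ‖(z + s • η).1‖ ^ 2) ^ 2 +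
      fun s => 4 * (fun s : ℝ => (z + s • η).2) s ^ 2) := by
    funext s
    simp only [Pi.pow_apply, Pi.add_apply]
    rw [rho_pow_four]; ring
  have h2' : HasDerivAt ((fun s : ℝ => ‖(z + s • η).1‖ ^ 2) ^ 2 +
      fun s => 4 * (fun s : ℝ => (z + s • η).2) s ^ 2) _ 0 := e ▸ h2
  have := h2'.unique h3
  simp only [h0] at this
  have hp := rho_pos hz
  rw [eq_div_iff (by positivity)]
  push_cast at this
  norm_num at this
  linarith

/-- The weight `|∇_G ϱ|² = |x|²/ϱ²`. -/
def psi (z : Space n) : ℝ := ‖z.1‖ ^ 2 / rho z ^ 2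

theorem gradSq_rho {z : Space n} (hz : z ≠ 0) : gradSq rho z = psi z := by
  have hp := rho_pos hz
  have h4 := rho_pow_four z
  unfold gradSq fieldY fieldX partialT psi
  simp_rw [fderiv_rho hz]
  simp only [EuclideanSpace.inner_single_right, inner_zero_right, conj_trivial, mul_zero, add_zero,
    zero_add, mul_one, one_mul, div_pow, mul_pow]
  rw [← Finset.sum_div, ← Finset.mul_sum, sum_sq_eq]
  field_simp
  rw [h4]
  ring

theorem rho_polarPt {θ : EuclideanSpace ℝ (Fin n)} (hθ : ‖θ‖ = 1) (τ : ℝ) {r : ℝ} (hr : 0 ≤ r) :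
    rho (polarPt θ τ r) = r := by
  have hs := scl_pow_four_mul τ
  have hp := scl_pos τ
  rw [← pow_left_inj₀ (rho_nonneg _) hr (by norm_num : (4:ℕ) ≠ 0), rho_pow_four]
  simp only [polarPt, norm_smul, hθ, Real.norm_eq_abs, mul_one]
  rw [abs_of_nonneg (by positivity)]
  unfold quad at hs
  linear_combination r ^ 4 * hs

theorem polarPt_ne_zero {θ : EuclideanSpace ℝ (Fin n)} (hθ : ‖θ‖ = 1) (τ : ℝ) {r : ℝ} (hr : 0 < r) :
    polarPt θ τ r ≠ 0 := by
  intro h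
  have := rho_eq_zero_iff.2 h
  rw [rho_polarPt hθ τ hr.le] at this
  exact hr.ne' this

theorem norm_polarPt_fst {θ : EuclideanSpace ℝ (Fin n)} (hθ : ‖θ‖ = 1) (τ : ℝ) {r : ℝ} (hr : 0 ≤ r) :
    ‖(polarPt θ τ r).1‖ = r * scl τ := by
  have := scl_pos τ
  simp only [polarPt, norm_smul, hθ, Real.norm_eq_abs, mul_one]
  rw [abs_of_nonneg (by positivity)]

theorem psi_polarPt {θ : EuclideanSpace ℝ (Fin n)} (hθ : ‖θ‖ = 1) (τ : ℝ) {r : ℝ} (hr : 0 < r) :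
    psi (polarPt θ τ r) = scl τ ^ 2 := by
  rw [psi, norm_polarPt_fst hθ τ hr.le, rho_polarPt hθ τ hr.le]
  field_simp

/-- The velocity of the ray `r ↦ polarPt θ τ r`. -/
def polarVel (θ : EuclideanSpace ℝ (Fin n)) (τ r : ℝ) : Space n :=
  (scl τ • θ, 2 * r * scl τ ^ 2 * τ)

theorem hasDerivAt_polarPt (θ : EuclideanSpace ℝ (Fin n)) (τ r : ℝ) :
    HasDerivAt (polarPt θ τ) (polarVel θ τ r) r := by
  unfold polarPt polarVel
  refine HasDerivAt.prodMk ?_ ?_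
  · have := ((hasDerivAt_id r).mul_const (scl τ)).smul_const θ
    refine this.congr_deriv ?_
    simp
  · have := ((hasDerivAt_pow 2 r).mul_const (scl τ ^ 2)).mul_const τ
    refine this.congr_deriv ?_
    simp

/-- The angular frame at `polarPt θ τ r`. -/
def frame (j : Option (Fin n)) (θ : EuclideanSpace ℝ (Fin n)) (τ r : ℝ) : Space n :=
  match j with
  | none => (r • (-(2 * τ * scl τ) • θ), r ^ 2 * scl τ ^ 2)
  | some i => (r • ((scl τ)⁻¹ • tang i θ), 0)

/-- The derivative of the angular frame along a ray. -/
def frameVel (j : Option (Fin n)) (θ : EuclideanSpace ℝ (Fin n)) (τ r : ℝ) : Space n :=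
  match j with
  | none => (-(2 * τ * scl τ) • θ, 2 * r * scl τ ^ 2)
  | some i => ((scl τ)⁻¹ • tang i θ, 0)

theorem hasDerivAt_frame (j : Option (Fin n)) (θ : EuclideanSpace ℝ (Fin n)) (τ r : ℝ) :
    HasDerivAt (frame j θ τ) (frameVel j θ τ r) r := by
  have key : ∀ v : EuclideanSpace ℝ (Fin n), HasDerivAt (fun r : ℝ => r • v) v r := fun v => by
    simpa using (hasDerivAt_id r).smul_const v
  rcases j with _ | i
  · refine HasDerivAt.prodMk (key _) ?_
    have := (hasDerivAt_pow 2 r).mul_const (scl τ ^ 2)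
    refine this.congr_deriv ?_
    simp
  · exact HasDerivAt.prodMk (key _) (hasDerivAt_const _ _)

theorem inner_tang {θ : EuclideanSpace ℝ (Fin n)} (hθ : ‖θ‖ = 1) (i : Fin n) :
    inner ℝ θ (tang i θ) = 0 := by
  unfold tang
  rw [inner_sub_right, EuclideanSpace.inner_single_right, inner_smul_right,
    real_inner_self_eq_norm_sq, hθ]
  simp

theorem fderiv_rho_frame (j : Option (Fin n)) {θ : EuclideanSpace ℝ (Fin n)} (hθ : ‖θ‖ = 1) (τ : ℝ)
    {r : ℝ} (hr : 0 < r) : fderiv ℝ rho (polarPt θ τ r) (frame j θ τ r) = 0 := by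
  rw [fderiv_rho (polarPt_ne_zero hθ τ hr), norm_polarPt_fst hθ τ hr.le]
  rcases j with _ | i
  · simp only [frame, polarPt, inner_smul_left, inner_smul_right, real_inner_self_eq_norm_sq, hθ,
      conj_trivial]
    ring
  · simp only [frame, polarPt, inner_smul_left, inner_smul_right, inner_tang hθ]
    simp

theorem fderiv_rho_polarVel {θ : EuclideanSpace ℝ (Fin n)} (hθ : ‖θ‖ = 1) (τ : ℝ)
    {r : ℝ} (hr : 0 < r) : fderiv ℝ rho (polarPt θ τ r) (polarVel θ τ r) = 1 := by
  have hs := scl_pow_four_mul τ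
  unfold quad at hs
  rw [fderiv_rho (polarPt_ne_zero hθ τ hr), norm_polarPt_fst hθ τ hr.le, rho_polarPt hθ τ hr.le]
  simp only [polarVel, polarPt, inner_smul_left, inner_smul_right, real_inner_self_eq_norm_sq, hθ,
      conj_trivial]
  rw [div_eq_one_iff_eq (by positivity)]
  linear_combination r ^ 3 * hs

theorem fst_decomp (L : Space n →L[ℝ] ℝ) (w : EuclideanSpace ℝ (Fin n)) :
    L (w, 0) = ∑ i, w i * L (EuclideanSpace.single i 1, 0) := by
  have h : ((w, 0) : Space n) = ∑ i, w i • ((EuclideanSpace.single i (1:ℝ), 0) : Space n) := by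
    ext1
    · rw [Prod.fst_sum]
      simp only [Prod.smul_fst]
      exact (sum_smul_single w).symm
    · rw [Prod.snd_sum]
      simp
  rw [h, map_sum]
  simp_rw [map_smul, smul_eq_mul]

theorem map_pair (L : Space n →L[ℝ] ℝ) (w : EuclideanSpace ℝ (Fin n)) (t : ℝ) :
    L (w, t) = L (w, 0) + t * L (0, 1) := by
  have h : ((w, t) : Space n) = (w, 0) + t • ((0, 1) : Space n) := by ext1 <;> simp
  rw [h, map_add, map_smul, smul_eq_mul]

theorem map_smul_fst (L : Space n →L[ℝ] ℝ) (a : ℝ) (w : EuclideanSpace ℝ (Fin n)) :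
    L (a • w, 0) = a * L (w, 0) := by
  have h : ((a • w, 0) : Space n) = a • ((w, 0) : Space n) := by ext1 <;> simp
  rw [h, map_smul, smul_eq_mul]

theorem map_tang (L : Space n →L[ℝ] ℝ) (i : Fin n) (w : EuclideanSpace ℝ (Fin n)) :
    L (tang i w, 0) = L (EuclideanSpace.single i 1, 0) - w i * L (w, 0) := by
  have h : ((tang i w, 0) : Space n) = (EuclideanSpace.single i 1, 0) - w i • ((w, 0) : Space n) := by
    ext1 <;> simp [tang]
  rw [h, map_sub, map_smul, smul_eq_mul]

/-- Polar form of the horizontal inner product of covectors. -/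
theorem covector_polar (L M : Space n →L[ℝ] ℝ) {θ : EuclideanSpace ℝ (Fin n)} (hθ : ‖θ‖ = 1)
    (τ : ℝ) {r : ℝ} (hr : 0 < r) :
    (∑ i, L (EuclideanSpace.single i 1, 0) * M (EuclideanSpace.single i 1, 0)) +
      ‖(polarPt θ τ r).1‖ ^ 2 * (L (0, 1) * M (0, 1)) =
    scl τ ^ 2 * (L (polarVel θ τ r) * M (polarVel θ τ r) +
      (r ^ 2)⁻¹ * ∑ j, L (frame j θ τ r) * M (frame j θ τ r)) := by
  have hs := scl_pow_four_mul τ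
  have hp := scl_pos τ
  unfold quad at hs
  rw [norm_polarPt_fst hθ τ hr.le, Fintype.sum_option]
  simp only [frame, polarVel]
  simp_rw [map_pair L (_ • _) (_ * _), map_pair M (_ • _) (_ * _), map_smul_fst, map_tang]
  set α := L (θ, 0) with hα
  set β := M (θ, 0) with hβ
  set l := fun i => L (EuclideanSpace.single i 1, 0)
  set m := fun i => M (EuclideanSpace.single i 1, 0)
  have hα' : α = ∑ i, θ i * l i := fst_decomp L θ
  have hβ' : β = ∑ i, θ i * m i := fst_decomp M θ
  have hsum : ∑ i, (r * ((scl τ)⁻¹ * (l i - θ i * α))) * (r * ((scl τ)⁻¹ * (m i - θ i * β))) =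
      r ^ 2 * ((scl τ)⁻¹) ^ 2 * ((∑ i, l i * m i) - α * β) := by
    have e : ∀ i, (r * ((scl τ)⁻¹ * (l i - θ i * α))) * (r * ((scl τ)⁻¹ * (m i - θ i * β))) =
      r ^ 2 * ((scl τ)⁻¹) ^ 2 * (l i * m i - β * (θ i * l i) - α * (θ i * m i)
        + α * β * θ i ^ 2) := fun i => by ring
    simp_rw [e]
    rw [← Finset.mul_sum, Finset.sum_add_distrib, Finset.sum_sub_distrib, Finset.sum_sub_distrib,
      ← Finset.mul_sum, ← Finset.mul_sum, ← Finset.mul_sum, ← hα', ← hβ', sum_sq_eq, hθ]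
    ring
  change (∑ i, l i * m i) + _ = _ * (_ + _ * (_ +
    ∑ i, (r * ((scl τ)⁻¹ * (l i - θ i * α))) * (r * ((scl τ)⁻¹ * (m i - θ i * β)))))
  rw [hsum]
  generalize ∑ i, l i * m i = S
  generalize L (0, 1) = b1
  generalize M (0, 1) = b2
  field_simp
  linear_combination (-(α * β) - r ^ 2 * scl τ ^ 2 * b1 * b2) * hs

end

/-! ### The inequality along a ray -/

section

open Set Filter Topology

/-- The logarithmic derivative of `f`. -/
def logDer (f : ℝ → ℝ) (r : ℝ) : ℝ := deriv f r / f r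

theorem isOpen_radii (R : ℝ≥0∞) : IsOpen (radii R) :=
  (isOpen_lt continuous_const continuous_id).inter
    (isOpen_lt ENNReal.continuous_ofReal continuous_const)

theorem mem_radii_of_le {R : ℝ≥0∞} {r s : ℝ} (hs : s ∈ radii R) (hr : 0 < r) (hrs : r ≤ s) :
    r ∈ radii R :=
  ⟨hr, (ENNReal.ofReal_le_ofReal hrs).trans_lt hs.2⟩

section Bessel

variable {m : ℕ} {R : ℝ≥0∞} {V W f : ℝ → ℝ}

theorem IsBesselPair.hasDerivAt_V {Q : ℕ} (h : IsBesselPair Q R V W f) {r : ℝ} (hr : r ∈ radii R) :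
    HasDerivAt V (deriv V r) r :=
  (((h.contDiffOn_V.contDiffAt ((isOpen_radii R).mem_nhds hr))).differentiableAt one_ne_zero).hasDerivAt

theorem IsBesselPair.continuousOn_deriv_V {Q : ℕ} (h : IsBesselPair Q R V W f) :
    ContinuousOn (deriv V) (radii R) :=
  h.contDiffOn_V.continuousOn_deriv_of_isOpen (isOpen_radii R) le_rfl

/-- The Riccati equation for the logarithmic derivative. -/
theorem IsBesselPair.riccati (h : IsBesselPair (m + 4) R V W f) {r : ℝ} (hr : r ∈ radii R) :
    HasDerivAt (fun s => s ^ (m + 3) * V s * logDer f s)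
      (-(r ^ (m + 3) * (W r + V r * logDer f r ^ 2))) r := by
  have h0 := h.pos r hr
  have h1 := (h.ode r hr).div (h.differentiableAt r hr).hasDerivAt h0.ne'
  have e : (fun s => s ^ (m + 3) * V s * logDer f s) =
      (fun s : ℝ => s ^ (m + 4 - 1) * V s * deriv f s) / f := by
    funext s
    simp only [Pi.div_apply, logDer, mul_div_assoc, Nat.add_succ_sub_one]
  rw [e]
  refine h1.congr_deriv ?_
  simp only [logDer, Nat.add_succ_sub_one]
  field_simp
  ring

theorem IsBesselPair.integrableOn_riccati (h : IsBesselPair (m + 4) R V W f)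
    (hV : ∀ r ∈ radii R, 0 ≤ V r) {a b : ℝ} (ha : 0 < a) (hb : b ∈ radii R) :
    IntegrableOn (fun r => r ^ (m + 3) * (V r * logDer f r ^ 2)) (Icc a b) := by
  have hsub : Icc a b ⊆ radii R := fun r hr => mem_radii_of_le hb (ha.trans_le hr.1) hr.2
  have cW : ContinuousOn (fun r => r ^ (m + 3) * W r) (Icc a b) :=
    (continuous_pow _).continuousOn.mul (h.contDiffOn_W.continuousOn.mono hsub)
  obtain ⟨B, hB⟩ := isCompact_Icc.exists_bound_of_continuousOn cW
  have key : IntegrableOn (fun r => r ^ (m + 3) * (W r + V r * logDer f r ^ 2) + B) (Ioc a b) := by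
    refine intervalIntegral.integrableOn_deriv_of_nonneg
      (g := fun r => -(r ^ (m + 3) * V r * logDer f r) + B * r) ?_ ?_ ?_
    · exact fun r hr => ((h.riccati (hsub hr)).continuousAt.neg.add
        (by fun_prop)).continuousWithinAt
    · intro r hr
      have := (h.riccati (hsub (Ioo_subset_Icc_self hr))).neg.add ((hasDerivAt_id r).const_mul B)
      refine this.congr_deriv ?_
      ring
    · intro r hr
      have h1 := hB r (Ioo_subset_Icc_self hr)
      have h2 : 0 ≤ r ^ (m + 3) * (V r * logDer f r ^ 2) :=
        mul_nonneg (pow_nonneg (ha.trans hr.1).le _)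
          (mul_nonneg (hV r (hsub (Ioo_subset_Icc_self hr))) (sq_nonneg _))
      have h3 := neg_abs_le (r ^ (m + 3) * W r)
      rw [Real.norm_eq_abs] at h1
      nlinarith
  rw [integrableOn_Icc_iff_integrableOn_Ioc]
  have k2 : IntegrableOn (fun r => r ^ (m + 3) * W r + B) (Ioc a b) :=
    ((cW.add continuousOn_const).integrableOn_Icc).mono_set Ioc_subset_Icc_self
  refine (key.sub k2).congr_fun (fun r _ => ?_) measurableSet_Ioc
  simp only [Pi.sub_apply]
  ring

theorem ray_radial (h : IsBesselPair (m + 4) R V W f) {a₁ : ℝ → ℝ} {a₂ r : ℝ} (hr : r ∈ radii R)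
    (ha : HasDerivAt a₁ a₂ r) :
    HasDerivAt (fun s => (m + 3) * (V s * s ^ (m + 2)) * a₁ s ^ 2 +
        s ^ (m + 3) * V s * logDer f s * a₁ s ^ 2)
      (r ^ (m + 3) * (V r * (a₂ + (m + 3) * (a₁ r / r)) ^ 2 - W r * a₁ r ^ 2 -
        (m + 3) * (V r / r ^ 2 - deriv V r / r) * a₁ r ^ 2 - V r * (a₂ - logDer f r * a₁ r) ^ 2)) r := by
  have hr0 : r ≠ 0 := hr.1.ne'
  have h1 := ((((h.hasDerivAt_V hr).mul (hasDerivAt_pow (m + 2) r)).const_mul ((m : ℝ) + 3)).mul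
    (ha.pow 2)).add ((h.riccati hr).mul (ha.pow 2))
  refine h1.congr_deriv ?_
  simp only [Pi.mul_apply, Pi.pow_apply]
  push_cast
  field_simp
  ring

theorem ray_pairing {a₁ w : ℝ → ℝ} {a₂ w' r : ℝ} (hr : 0 < r) (ha : HasDerivAt a₁ a₂ r)
    (hw : HasDerivAt w w' r) :
    HasDerivAt (fun s => -2 * s ^ (m + 3) * (w s * a₁ s))
      (r ^ (m + 3) * (-2 * (w' * a₁ r) - 2 * (w r * (a₂ + (m + 3) * (a₁ r / r))))) r := by
  have h1 := ((hasDerivAt_pow (m + 3) r).const_mul (-2)).mul (hw.mul ha)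
  refine h1.congr_deriv ?_
  simp only [Pi.mul_apply]
  push_cast
  field_simp
  ring

theorem ray_angular (h : IsBesselPair (m + 4) R V W f) (hV : ∀ r ∈ radii R, 0 ≤ V r)
    {e e₁ : ℝ → ℝ} {e₂ r : ℝ} (hr : r ∈ radii R) (hV' : DifferentiableAt ℝ (deriv V) r)
    (hcond : 0 ≤ ((m : ℝ) - 1) * (V r / r ^ 2) + 3 * (deriv V r / r) - deriv (deriv V) r)
    (he : HasDerivAt e (e₁ r) r) (he₁ : HasDerivAt e₁ e₂ r) :
    ∃ d, HasDerivAt (fun s => s ^ (m + 3) * V s * logDer f s * (e s / s) ^ 2 -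
        2 * (V s * s ^ (m + 1)) * (e s * e₁ s) +
        (deriv V s * s ^ (m + 1) - V s * s ^ m) * e s ^ 2) d r ∧
      d ≤ r ^ (m + 3) * (-2 * V r * (e₂ + (m + 3) * (e₁ r / r)) * e r / r ^ 2 +
        (m + 3) * V r * e r ^ 2 / r ^ 4 -
        (W r + (m + 3) * (V r / r ^ 2 - deriv V r / r)) * e r ^ 2 / r ^ 2 -
        V r * e₁ r ^ 2 / r ^ 2) := by
  have hr0 : r ≠ 0 := hr.1.ne'
  have hrp : 0 < r := hr.1
  have dV := h.hasDerivAt_V hr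
  have hm : HasDerivAt (fun s : ℝ => V s * s ^ m) (deriv V r * r ^ m + V r * (m * (r ^ m / r))) r := by
    refine (dV.mul (hasDerivAt_pow m r)).congr_deriv ?_
    rcases m with _ | k
    · simp
    · simp only [Nat.add_sub_cancel]
      field_simp
      ring
  have h1 := (((h.riccati hr).mul ((he.div (hasDerivAt_id r) hr0).pow 2)).sub
    (((dV.mul (hasDerivAt_pow (m + 1) r)).const_mul 2).mul (he.mul he₁))).add
    (((hV'.hasDerivAt.mul (hasDerivAt_pow (m + 1) r)).sub hm).mul (he.pow 2))
  refine ⟨_, h1, ?_⟩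
  have hs : 0 ≤ r ^ (m + 3) * (V r * ((e₁ r * r - e r) / r ^ 2 - logDer f r * (e r / r)) ^ 2) +
      r ^ (m + 1) * ((((m : ℝ) - 1) * (V r / r ^ 2) + 3 * (deriv V r / r) - deriv (deriv V) r) *
        e r ^ 2) := by
    have := hV r hr
    positivity
  refine sub_nonneg.1 (hs.trans_eq ?_)
  simp only [Pi.mul_apply, Pi.pow_apply, Pi.div_apply, Pi.sub_apply, id]
  push_cast
  field_simp
  ring

/-- The integrand of the one-dimensional inequality along a ray: `a₁, a₂` are the radial
derivatives of the function, `e j, e₁ j, e₂ j` the radial derivatives of its angular derivatives. -/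
def rayIntegrand {ι : Type*} [Fintype ι] (m : ℕ) (V W f a₁ a₂ w w' : ℝ → ℝ) (e e₁ e₂ : ι → ℝ → ℝ)
    (r : ℝ) : ℝ :=
  (V r * (a₂ r + (m + 3) * (a₁ r / r)) ^ 2 - W r * a₁ r ^ 2 -
    (m + 3) * (V r / r ^ 2 - deriv V r / r) * a₁ r ^ 2 - V r * (a₂ r - logDer f r * a₁ r) ^ 2) +
  (-2 * (w' r * a₁ r) - 2 * (w r * (a₂ r + (m + 3) * (a₁ r / r)))) +
  ∑ j, (-2 * V r * (e₂ j r + (m + 3) * (e₁ j r / r)) * e j r / r ^ 2 +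
        (m + 3) * V r * e j r ^ 2 / r ^ 4 -
        (W r + (m + 3) * (V r / r ^ 2 - deriv V r / r)) * e j r ^ 2 / r ^ 2 -
        V r * e₁ j r ^ 2 / r ^ 2)

theorem ray_inequality {ι : Type*} [Fintype ι] (h : IsBesselPair (m + 4) R V W f)
    (hV : ∀ r ∈ radii R, 0 ≤ V r) (hV' : ∀ r ∈ radii R, DifferentiableAt ℝ (deriv V) r)
    (hcond : ∀ r ∈ radii R,
      0 ≤ ((m : ℝ) - 1) * (V r / r ^ 2) + 3 * (deriv V r / r) - deriv (deriv V) r)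
    {a₁ a₂ w w' : ℝ → ℝ} {e e₁ e₂ : ι → ℝ → ℝ}
    (ha : ∀ r, 0 < r → HasDerivAt a₁ (a₂ r) r) (hw : ∀ r, 0 < r → HasDerivAt w (w' r) r)
    (he : ∀ j r, 0 < r → HasDerivAt (e j) (e₁ j r) r)
    (he₁ : ∀ j r, 0 < r → HasDerivAt (e₁ j) (e₂ j r) r)
    {b c : ℝ} (hb : 0 < b) (hbc : b ≤ c) (hc : c ∈ radii R)
    (ha0 : a₁ b = 0 ∧ a₁ c = 0) (he0 : ∀ j, e j b = 0 ∧ e j c = 0)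
    (hint : IntegrableOn (fun r => r ^ (m + 3) * rayIntegrand m V W f a₁ a₂ w w' e e₁ e₂ r)
      (Icc b c)) :
    0 ≤ ∫ r in b..c, r ^ (m + 3) * rayIntegrand m V W f a₁ a₂ w w' e e₁ e₂ r := by
  have hsub : ∀ r ∈ Icc b c, r ∈ radii R := fun r hr => mem_radii_of_le hc (hb.trans_le hr.1) hr.2
  have key : ∀ r ∈ Icc b c, ∃ d, HasDerivAt (fun s =>
      ((m + 3) * (V s * s ^ (m + 2)) * a₁ s ^ 2 + s ^ (m + 3) * V s * logDer f s * a₁ s ^ 2) +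
      (-2 * s ^ (m + 3) * (w s * a₁ s)) +
      ∑ j, (s ^ (m + 3) * V s * logDer f s * (e j s / s) ^ 2 -
        2 * (V s * s ^ (m + 1)) * (e j s * e₁ j s) +
        (deriv V s * s ^ (m + 1) - V s * s ^ m) * e j s ^ 2)) d r ∧
      d ≤ r ^ (m + 3) * rayIntegrand m V W f a₁ a₂ w w' e e₁ e₂ r := by
    intro r hr
    have hr' := hsub r hr
    choose d hd hdle using fun j => ray_angular h hV hr' (hV' r hr') (hcond r hr')
      (he j r hr'.1) (he₁ j r hr'.1)
    refine ⟨_, ((ray_radial h hr' (ha r hr'.1)).add (ray_pairing hr'.1 (ha r hr'.1)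
      (hw r hr'.1))).add (HasDerivAt.fun_sum fun j _ => hd j), ?_⟩
    refine (add_le_add le_rfl (Finset.sum_le_sum fun j _ => hdle j)).trans_eq ?_
    rw [rayIntegrand, ← Finset.mul_sum]
    ring
  choose! d hd hdle using key
  have := intervalIntegral.sub_le_integral_of_hasDeriv_right_of_le hbc
    (fun r hr => (hd r hr).continuousAt.continuousWithinAt)
    (fun r hr => (hd r (Ioo_subset_Icc_self hr)).hasDerivWithinAt) hint
    (fun r hr => hdle r (Ioo_subset_Icc_self hr))
  simpa [ha0.1, ha0.2, he0] using this

end Bessel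

end

/-! ### Radial derivatives and functions supported in an annulus -/

section

open Set Filter Topology

variable {n : ℕ}

theorem radialDeriv_eq {u : Space n → ℝ} {z : Space n} (hu : DifferentiableAt ℝ u z) :
    radialDeriv u z = (rho z)⁻¹ * fderiv ℝ u z (z.1, 2 * z.2) := by
  rcases eq_or_ne z 0 with rfl | hz
  · have h0 : rho (0 : Space n) = 0 := rho_eq_zero_iff.2 rfl
    simp [radialDeriv, h0]
  · have hp := rho_pos hz
    have h1 : dilation (rho z / rho z) z = z := by
      rw [div_self hp.ne']; simp [dilation]
    have h2 : HasDerivAt (fun s : ℝ => dilation (s / rho z) z) ((rho z)⁻¹ • (z.1, 2 * z.2)) (rho z) := by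
      have hs : HasDerivAt (fun s : ℝ => s / rho z) (rho z)⁻¹ (rho z) := by
        simpa using (hasDerivAt_id (rho z)).div_const (rho z)
      unfold dilation
      rw [Prod.smul_mk]
      refine HasDerivAt.prodMk (hs.smul_const z.1) ?_
      refine ((hs.pow 2).mul_const z.2).congr_deriv ?_
      rw [div_self hp.ne']
      simp
      ring
    have h3 : HasFDerivAt u (fderiv ℝ u z) (dilation (rho z / rho z) z) := by
      rw [h1]; exact hu.hasFDerivAt
    have h4 : HasDerivAt (fun s : ℝ => u (dilation (s / rho z) z)) _ (rho z) :=
      h3.comp_hasDerivAt (rho z) h2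
    rw [radialDeriv, h4.deriv, map_smul, smul_eq_mul]

theorem polarPt_scaled (θ : EuclideanSpace ℝ (Fin n)) (τ r : ℝ) :
    (((polarPt θ τ r).1, 2 * (polarPt θ τ r).2) : Space n) = r • polarVel θ τ r := by
  unfold polarPt polarVel
  ext1
  · simp [smul_smul]
  · simp; ring

theorem radialDeriv_polarPt {u : Space n → ℝ} {θ : EuclideanSpace ℝ (Fin n)} (hθ : ‖θ‖ = 1) (τ : ℝ)
    {r : ℝ} (hr : 0 < r) (hu : DifferentiableAt ℝ u (polarPt θ τ r)) :
    radialDeriv u (polarPt θ τ r) = fderiv ℝ u (polarPt θ τ r) (polarVel θ τ r) := by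
  rw [radialDeriv_eq hu, polarPt_scaled, map_smul, smul_eq_mul, rho_polarPt hθ τ hr.le, ← mul_assoc,
    inv_mul_cancel₀ hr.ne', one_mul]

theorem hasDerivAt_ray {u : Space n → ℝ} (hu : Differentiable ℝ u)
    {θ : EuclideanSpace ℝ (Fin n)} (hθ : ‖θ‖ = 1) (τ : ℝ) {r : ℝ} (hr : 0 < r) :
    HasDerivAt (fun r => u (polarPt θ τ r)) (radialDeriv u (polarPt θ τ r)) r := by
  rw [radialDeriv_polarPt hθ τ hr (hu _)]
  exact (hu _).hasFDerivAt.comp_hasDerivAt r (hasDerivAt_polarPt θ τ r)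

theorem frame_scaled (j : Option (Fin n)) (θ : EuclideanSpace ℝ (Fin n)) (τ r : ℝ) :
    (((frame j θ τ r).1, 2 * (frame j θ τ r).2) : Space n) = r • frameVel j θ τ r := by
  rcases j with _ | i
  · simp only [frame, frameVel]
    ext1
    · simp
    · simp; ring
  · simp [frame, frameVel]

/-- The linear map `(x, t) ↦ (x, 2t)`. -/
def eulerMap : Space n →L[ℝ] Space n :=
  (ContinuousLinearMap.fst ℝ _ _).prod ((2 : ℝ) • ContinuousLinearMap.snd ℝ _ _)

theorem eulerMap_apply (z : Space n) : eulerMap z = (z.1, 2 * z.2) := by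
  simp [eulerMap]

set_option maxHeartbeats 1000000 in
theorem hasDerivAt_ray_frame {u : Space n → ℝ} (hu : ContDiff ℝ 2 u) (j : Option (Fin n))
    {θ : EuclideanSpace ℝ (Fin n)} (hθ : ‖θ‖ = 1) (τ : ℝ) {r : ℝ} (hr : 0 < r) :
    HasDerivAt (fun r => fderiv ℝ u (polarPt θ τ r) (frame j θ τ r))
      (fderiv ℝ (radialDeriv u) (polarPt θ τ r) (frame j θ τ r)) r := by
  set p := polarPt θ τ r with hp
  have hp0 : p ≠ 0 := polarPt_ne_zero hθ τ hr
  have hd1 : ContDiff ℝ 1 (fderiv ℝ u) := hu.fderiv_right (by norm_num)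
  have hdd : HasFDerivAt (fderiv ℝ u) (fderiv ℝ (fderiv ℝ u) p) p :=
    (hd1.differentiable one_ne_zero p).hasFDerivAt
  have hfun : radialDeriv u = fun z => (rho z)⁻¹ * fderiv ℝ u z (eulerMap z) := by
    funext z
    rw [radialDeriv_eq (hu.differentiable two_ne_zero z), eulerMap_apply]
  have hρ : HasFDerivAt rho (fderiv ℝ rho p) p :=
    ((contDiffAt_rho hp0 (k := 1)).differentiableAt one_ne_zero).hasFDerivAt
  have hρ0 : rho p ≠ 0 := (rho_pos hp0).ne'
  have hinv : HasFDerivAt (fun z => (rho z)⁻¹) (-(rho p ^ 2)⁻¹ • fderiv ℝ rho p) p :=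
    (hasDerivAt_inv hρ0).comp_hasFDerivAt p hρ
  have hG : HasFDerivAt (fun z => fderiv ℝ u z (eulerMap z))
      ((fderiv ℝ u p).comp eulerMap + (fderiv ℝ (fderiv ℝ u) p).flip (eulerMap p)) p :=
    hdd.clm_apply (eulerMap (n := n)).hasFDerivAt
  have hprod := hinv.fun_mul hG
  have hsym : ∀ v w, fderiv ℝ (fderiv ℝ u) p v w = fderiv ℝ (fderiv ℝ u) p w v :=
    (hu.contDiffAt (x := p)).isSymmSndFDerivAt (by simp)
  have e1 : fderiv ℝ (radialDeriv u) p (frame j θ τ r) =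
      fderiv ℝ (fderiv ℝ u) p (polarVel θ τ r) (frame j θ τ r) +
        fderiv ℝ u p (frameVel j θ τ r) := by
    have hz : fderiv ℝ rho p (frame j θ τ r) = 0 := fderiv_rho_frame j hθ τ hr
    have hρp : rho p = r := rho_polarPt hθ τ hr.le
    have hep : eulerMap p = r • polarVel θ τ r := by rw [eulerMap_apply, hp, polarPt_scaled]
    have hef : eulerMap (frame j θ τ r) = r • frameVel j θ τ r := by
      rw [eulerMap_apply, frame_scaled]
    rw [hfun, hprod.fderiv]
    simp only [_root_.add_apply, _root_.smul_apply, smul_eq_mul,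
      ContinuousLinearMap.comp_apply, ContinuousLinearMap.flip_apply, hz, hρp, hep, hef, map_smul]
    rw [hsym (frame j θ τ r)]
    generalize fderiv ℝ (fderiv ℝ u) p (polarVel θ τ r) (frame j θ τ r) = A
    generalize fderiv ℝ u p (frameVel j θ τ r) = B
    field_simp
    ring
  rw [e1]
  exact (hdd.comp_hasDerivAt r (hasDerivAt_polarPt θ τ r)).clm_apply (hasDerivAt_frame j θ τ r)

/-- `g` vanishes outside the closed gauge annulus `a ≤ ϱ ≤ b`. -/
def AnnSupp (a b : ℝ) (g : Space n → ℝ) : Prop := ∀ z, g z ≠ 0 → rho z ∈ Icc a b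

theorem isCompact_annulus (a b : ℝ) : IsCompact {z : Space n | rho z ∈ Icc a b} := by
  refine Metric.isCompact_of_isClosed_isBounded (isClosed_Icc.preimage continuous_rho) ?_
  refine (isBounded_iff_forall_norm_le).2 ⟨b + b ^ 2, fun z hz => ?_⟩
  have h1 := rho_pow_four z
  have hb : 0 ≤ b := (rho_nonneg z).trans hz.2
  have h2 : rho z ^ 4 ≤ b ^ 4 := pow_le_pow_left₀ (rho_nonneg z) hz.2 4
  have hx : ‖z.1‖ ≤ b := by
    refine le_of_pow_le_pow_left₀ (by norm_num : 4 ≠ 0) hb ?_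
    nlinarith [sq_nonneg z.2]
  have ht : ‖z.2‖ ≤ b ^ 2 := by
    refine abs_le_of_sq_le_sq ?_ (by positivity)
    nlinarith [pow_nonneg (norm_nonneg z.1) 4, sq_nonneg z.2]
  rw [Prod.norm_def]
  exact max_le (by nlinarith [sq_nonneg b]) (by linarith)

theorem AnnSupp.tsupport_subset {a b : ℝ} {g : Space n → ℝ} (h : AnnSupp a b g) :
    tsupport g ⊆ {z | rho z ∈ Icc a b} :=
  closure_minimal (fun z hz => h z hz) (isClosed_Icc.preimage continuous_rho)

theorem AnnSupp.hasCompactSupport {a b : ℝ} {g : Space n → ℝ} (h : AnnSupp a b g) :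
    HasCompactSupport g :=
  (isCompact_annulus a b).of_isClosed_subset (isClosed_tsupport g) h.tsupport_subset

theorem AnnSupp.eq_zero {a b : ℝ} {g : Space n → ℝ} (h : AnnSupp a b g) {z : Space n}
    (hz : rho z ∉ Icc a b) : g z = 0 := by
  by_contra h0; exact hz (h z h0)

theorem AnnSupp.eventually_eq_zero {a b : ℝ} {g : Space n → ℝ} (h : AnnSupp a b g) {z : Space n}
    (hz : rho z ∉ Icc a b) : g =ᶠ[𝓝 z] 0 :=
  notMem_tsupport_iff_eventuallyEq.1 fun h' => hz (h.tsupport_subset h')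

theorem AnnSupp.fderiv_eq_zero {a b : ℝ} {g : Space n → ℝ} (h : AnnSupp a b g) {z : Space n}
    (hz : rho z ∉ Icc a b) : fderiv ℝ g z = 0 := by
  rw [(h.eventually_eq_zero hz).fderiv_eq]
  simp

theorem AnnSupp.radialDeriv {a b : ℝ} {g : Space n → ℝ} (h : AnnSupp a b g)
    (hg : Differentiable ℝ g) : AnnSupp a b (radialDeriv g) := by
  intro z hz
  by_contra h0
  rw [radialDeriv_eq (hg z), h.fderiv_eq_zero h0] at hz
  simp at hz

theorem AnnSupp.mul_left {a b : ℝ} {g : Space n → ℝ} (h : AnnSupp a b g) (k : Space n → ℝ) :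
    AnnSupp a b fun z => k z * g z := fun z hz => h z (right_ne_zero_of_mul hz)

theorem AnnSupp.add {a b : ℝ} {g k : Space n → ℝ} (h : AnnSupp a b g) (h' : AnnSupp a b k) :
    AnnSupp a b fun z => g z + k z := by
  intro z hz
  by_contra h0
  exact hz (by simp [h.eq_zero h0, h'.eq_zero h0])

theorem AnnSupp.sub {a b : ℝ} {g k : Space n → ℝ} (h : AnnSupp a b g) (h' : AnnSupp a b k) :
    AnnSupp a b fun z => g z - k z := by
  intro z hz
  by_contra h0
  exact hz (by simp [h.eq_zero h0, h'.eq_zero h0])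

/-- Smoothness of `k * g` only needs smoothness of `k` on the annulus. -/
theorem AnnSupp.contDiff_mul {a b : ℝ} {g k : Space n → ℝ} (h : AnnSupp a b g)
    {m : WithTop ℕ∞} (hg : ContDiff ℝ m g) (hk : ∀ z, rho z ∈ Icc a b → ContDiffAt ℝ m k z) :
    ContDiff ℝ m fun z => k z * g z :=
  contDiff_iff_contDiffAt.2 fun z => by
    by_cases hz : rho z ∈ Icc a b
    · exact (hk z hz).mul hg.contDiffAt
    · exact contDiffAt_const.congr_of_eventuallyEq ((h.mul_left k).eventually_eq_zero hz)

theorem AnnSupp.contDiff_radialDeriv {a b : ℝ} (ha : 0 < a) {g : Space n → ℝ} (h : AnnSupp a b g)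
    (hg : ContDiff ℝ ∞ g) : ContDiff ℝ ∞ (Grushin.radialDeriv g) := by
  have hd : Differentiable ℝ g := hg.differentiable (by simp)
  have e : Grushin.radialDeriv g = fun z => (rho z)⁻¹ * fderiv ℝ g z (eulerMap z) := by
    funext z
    rw [radialDeriv_eq (hd z), eulerMap_apply]
  rw [e]
  refine AnnSupp.contDiff_mul (a := a) (b := b) ?_ ?_ ?_
  · intro z hz
    by_contra h0
    exact hz (by simp [h.fderiv_eq_zero h0])
  · exact (hg.fderiv_right (by simp)).clm_apply (eulerMap (n := n)).contDiff
  · intro z hz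
    have hz0 : z ≠ 0 := by
      rintro rfl
      rw [rho_eq_zero_iff.2 rfl] at hz
      exact ha.not_ge hz.1
    exact (contDiffAt_rho hz0).inv (rho_pos hz0).ne'

theorem hasDerivAt_polarPt_angle (θ : EuclideanSpace ℝ (Fin n)) (τ r : ℝ) :
    HasDerivAt (fun τ => polarPt θ τ r) ((quad τ)⁻¹ • frame none θ τ r) τ := by
  have hs := hasDerivAt_scl τ
  have hq := quad_pos τ
  unfold polarPt frame
  rw [Prod.smul_mk]
  refine HasDerivAt.prodMk ?_ ?_
  · refine ((hs.const_mul r).smul_const θ).congr_deriv ?_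
    rw [smul_smul, smul_smul]
    congr 1
    field_simp
  · refine (((hs.pow 2).const_mul (r ^ 2)).mul (hasDerivAt_id τ)).congr_deriv ?_
    simp
    field_simp
    unfold quad
    ring

end

/-! ### The spectral gap of the gauge spheres -/

section

open Set Filter Topology

variable {n : ℕ}

theorem fderiv_frame_some (v : Space n → ℝ) (i : Fin n) (θ : EuclideanSpace ℝ (Fin n)) (τ r : ℝ) :
    fderiv ℝ v (polarPt θ τ r) (frame (some i) θ τ r) =
      r * (scl τ)⁻¹ * fderiv ℝ v (polarPt θ τ r) (tang i θ, 0) := by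
  simp only [frame]
  rw [map_smul_fst, map_smul_fst, mul_assoc]

theorem sphere_poincare_polar (hn : 2 ≤ n) {v : Space n → ℝ} (hv : ContDiff ℝ 1 v) (τ : ℝ) {r : ℝ}
    (hr : 0 < r) : ((n : ℝ) - 1) * (quad τ * ∫ θ : USphere n, (v (polarPt θ τ r) -
      sphereMean (fun θ : USphere n => v (polarPt θ τ r))) ^ 2 ∂(surf n)) ≤
      ∫ θ : USphere n, (∑ i, fderiv ℝ v (polarPt θ τ r) (frame (some i) θ τ r) ^ 2) ∂(surf n) := by
  have hvd : Differentiable ℝ v := hv.differentiable one_ne_zero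
  have eX := fderiv_frame_some v
  have hsp := scl_pos τ
  have hs4 := scl_pow_four_mul τ
  have := neZero_surf (n := n) (by omega)
  have hM0 : (surf n).real univ ≠ 0 := measureReal_univ_ne_zero
  set A := sphereMean (fun θ : USphere n => v (polarPt θ τ r)) with hA
  set h : EuclideanSpace ℝ (Fin n) → ℝ := fun x => v (polarPt x τ r) - A with hh
  have hpt : ∀ x, HasFDerivAt (fun x : EuclideanSpace ℝ (Fin n) => polarPt x τ r)
      (((r * scl τ) • ContinuousLinearMap.id ℝ (EuclideanSpace ℝ (Fin n))).prod
        (0 : EuclideanSpace ℝ (Fin n) →L[ℝ] ℝ)) x := by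
    intro x
    unfold polarPt
    exact ((hasFDerivAt_id x).const_smul (r * scl τ)).prodMk (hasFDerivAt_const _ _)
  have hc : ContDiff ℝ 1 h := by
    refine ContDiff.sub (hv.comp ?_) contDiff_const
    unfold polarPt
    fun_prop
  have hfd : ∀ (θ : USphere n) (i : Fin n), fderiv ℝ h θ (tang i θ) =
      scl τ ^ 2 * fderiv ℝ v (polarPt θ τ r) (frame (some i) θ τ r) := by
    intro θ i
    have h1 := (((hvd _).hasFDerivAt.comp (θ : EuclideanSpace ℝ (Fin n)) (hpt θ)).sub_const A).fderiv
    have h2 : fderiv ℝ h θ = _ := h1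
    rw [h2, eX]
    simp only [ContinuousLinearMap.comp_apply, ContinuousLinearMap.prod_apply,
      _root_.smul_apply, ContinuousLinearMap.id_apply,
      _root_.zero_apply]
    rw [map_smul_fst]
    field_simp
  have ch : Continuous fun θ : USphere n => v (polarPt θ τ r) := by
    refine hv.continuous.comp ?_
    unfold polarPt
    fun_prop
  have hmean : ∫ θ : USphere n, h θ ∂(surf n) = 0 := by
    simp only [hh]
    rw [integral_sub (integrable_of_continuous_compact ch) (integrable_const _)]
    simp only [integral_const, smul_eq_mul, hA, sphereMean]
    rw [mul_inv_cancel_left₀ hM0, sub_self]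
  have := sphere_poincare_of_integral_eq_zero hn hc hmean
  simp_rw [hfd, mul_pow, ← Finset.mul_sum] at this
  rw [integral_const_mul] at this
  have h5 := mul_le_mul_of_nonneg_left this (quad_pos τ).le
  have e : quad τ * ((scl τ ^ 2) ^ 2 * ∫ θ : USphere n,
      (∑ i, fderiv ℝ v (polarPt θ τ r) (frame (some i) θ τ r) ^ 2) ∂(surf n)) =
      ∫ θ : USphere n,
      (∑ i, fderiv ℝ v (polarPt θ τ r) (frame (some i) θ τ r) ^ 2) ∂(surf n) := by
    linear_combination (∫ θ : USphere n,
      (∑ i, fderiv ℝ v (polarPt θ τ r) (frame (some i) θ τ r) ^ 2) ∂(surf n)) * hs4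
  rw [e] at h5
  refine le_trans (le_of_eq ?_) h5
  ring

/-- The spectral gap of the gauge sphere of radius `r`. -/
theorem angular_poincare (hn : 2 ≤ n) {v : Space n → ℝ} (hv : ContDiff ℝ 1 v)
    (hvc : HasCompactSupport v) {r : ℝ} (hr : 0 < r) :
    ((n : ℝ) + 1) * ∫ θ : USphere n, (∫ τ, angWt n τ * (v (polarPt θ τ r) -
      sphereMean (fun θ : USphere n => v (polarPt θ 0 r))) ^ 2) ∂(surf n) ≤
    ∫ θ : USphere n, (∫ τ, angWt n τ *
      ∑ j, fderiv ℝ v (polarPt θ τ r) (frame j θ τ r) ^ 2) ∂(surf n) := by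
  have hvd : Differentiable ℝ v := hv.differentiable one_ne_zero
  have hvc0 := hv.continuous
  have hv' := hv.continuous_fderiv one_ne_zero
  obtain ⟨M₁, hM₁⟩ := hvc.exists_bound_of_continuous hvc0
  obtain ⟨M₂, hM₂⟩ := (hvc.fderiv (𝕜 := ℝ)).exists_bound_of_continuous hv'
  set M := max M₁ M₂
  have hM0 : 0 ≤ M := (norm_nonneg _).trans ((hM₁ 0).trans (le_max_left _ _))
  have hMv : ∀ z, |v z| ≤ M := fun z => (hM₁ z).trans (le_max_left _ _)
  have hMd : ∀ z η, |fderiv ℝ v z η| ≤ M * ‖η‖ := fun z η =>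
    ((fderiv ℝ v z).le_opNorm η).trans (by gcongr; exact (hM₂ z).trans (le_max_right _ _))
  have hs := continuous_scl
  have hq := continuous_quad
  have cp : Continuous fun p : USphere n × ℝ => polarPt (p.1 : EuclideanSpace ℝ (Fin n)) p.2 r := by
    unfold polarPt; fun_prop
  have cf : ∀ j, Continuous fun p : USphere n × ℝ =>
      frame j (p.1 : EuclideanSpace ℝ (Fin n)) p.2 r := by
    intro j
    rcases j with _ | i
    · unfold frame; fun_prop
    · unfold frame
      have := continuous_tang i
      have h2 : Continuous fun p : USphere n × ℝ => (scl p.2)⁻¹ :=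
        (hs.comp continuous_snd).inv₀ fun p => (scl_pos p.2).ne'
      simp only
      fun_prop
  have tang_le : ∀ (i : Fin n) (θ : USphere n), ‖tang i (θ : EuclideanSpace ℝ (Fin n))‖ ≤ 2 := by
    intro i θ
    have h1 : ‖(θ : EuclideanSpace ℝ (Fin n))‖ = 1 := norm_eq_of_mem_sphere θ
    have h2 : ‖(θ : EuclideanSpace ℝ (Fin n)) i‖ ≤ 1 := (PiLp.norm_apply_le _ i).trans h1.le
    refine (norm_sub_le _ _).trans ?_
    rw [norm_smul, h1]
    simp only [PiLp.norm_single, norm_one, mul_one]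
    linarith
  have eX := fderiv_frame_some v
  have bX : ∀ (i : Fin n) (θ : USphere n) z, fderiv ℝ v z (tang i θ, 0) ^ 2 ≤ (2 * M) ^ 2 := by
    intro i θ z
    rw [← sq_abs]
    refine pow_le_pow_left₀ (abs_nonneg _) ((hMd z _).trans ?_) 2
    have : ‖((tang i (θ : EuclideanSpace ℝ (Fin n)), 0) : Space n)‖ ≤ 2 := by
      rw [Prod.norm_def]
      exact max_le (tang_le i θ) (by simp)
    nlinarith
  have key := angular_poincare_aux hn (g := fun θ τ => v (polarPt θ τ r))
    (g' := fun θ τ => fderiv ℝ v (polarPt θ τ r) ((quad τ)⁻¹ • frame none θ τ r))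
    (X := fun θ τ => ∑ i, fderiv ℝ v (polarPt θ τ r) (frame (some i) θ τ r) ^ 2)
    (C := M + M * (r + r ^ 2) + M * r * 2 + n * (r ^ 2 * (2 * M) ^ 2))
    (hvc0.comp cp)
    ((hv'.comp cp).clm_apply ((hq.inv₀ fun τ => (quad_pos τ).ne').comp continuous_snd |>.smul (cf none)))
    (continuous_finsetSum _ fun i _ => ((hv'.comp cp).clm_apply (cf (some i))).pow 2)
    (fun θ τ => (hvd _).hasFDerivAt.comp_hasDerivAt τ (hasDerivAt_polarPt_angle _ τ r))
    (fun θ τ => by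
      have hq0 := (quad_pos τ).ne'
      have hsp := scl_pos τ
      have hs4 := scl_pow_four_mul τ
      rw [map_smul, smul_eq_mul, mul_inv_cancel_left₀ hq0, ← smul_eq_mul, ← map_smul]
      refine (hMd _ _).trans ?_
      have h1 : ‖scl τ • frame none (θ : EuclideanSpace ℝ (Fin n)) τ r‖ ≤ r + r ^ 2 := by
        have hθ : ‖(θ : EuclideanSpace ℝ (Fin n))‖ = 1 := norm_eq_of_mem_sphere θ
        simp only [frame, Prod.smul_mk, smul_smul, Prod.norm_def, norm_smul, hθ, mul_one, norm_mul,
          norm_neg, Real.norm_eq_abs, smul_eq_mul, abs_of_pos hsp, abs_of_pos hr, norm_pow, abs_two]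
        have h2 : 2 * |τ| * scl τ ^ 2 ≤ 1 := by
          refine le_of_pow_le_pow_left₀ two_ne_zero one_pos.le ?_
          unfold quad at hs4
          rw [mul_pow, mul_pow, sq_abs]
          nlinarith [pow_pos hsp 4]
        have h3 : scl τ ^ 3 ≤ 1 := pow_le_one₀ hsp.le (scl_le_one τ)
        refine max_le ?_ ?_
        · nlinarith [sq_nonneg r]
        · nlinarith [sq_nonneg r]
      have h2 := mul_le_mul_of_nonneg_left h1 hM0
      have h3 : 0 ≤ M * r * 2 := by positivity
      have h4 : 0 ≤ (n:ℝ) * (r ^ 2 * (2 * M) ^ 2) := by positivity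
      linarith)
    (fun θ τ => (hMv _).trans (by
      have h2 : 0 ≤ M * (r + r ^ 2) := by positivity
      have h3 : 0 ≤ M * r * 2 := by positivity
      have h4 : 0 ≤ (n:ℝ) * (r ^ 2 * (2 * M) ^ 2) := by positivity
      linarith))
    (fun θ θ' τ => by
      have hsp := scl_pos τ
      have h1 := Convex.norm_image_sub_le_of_norm_fderiv_le (𝕜 := ℝ) (f := v) (C := M) (s := univ)
        (x := polarPt θ' τ r) (y := polarPt θ τ r) (fun z _ => hvd z)
        (fun z _ => (hM₂ z).trans (le_max_right _ _)) convex_univ (mem_univ _) (mem_univ _)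
      have h2 : ‖polarPt (θ : EuclideanSpace ℝ (Fin n)) τ r - polarPt θ' τ r‖ ≤ r * scl τ * 2 := by
        simp only [polarPt, Prod.mk_sub_mk, sub_self, ← smul_sub]
        rw [Prod.norm_def]
        simp only [norm_zero, norm_smul, Real.norm_eq_abs, abs_mul, abs_of_pos hr, abs_of_pos hsp]
        refine max_le ?_ (by positivity)
        gcongr
        refine (norm_sub_le _ _).trans ?_
        rw [norm_eq_of_mem_sphere θ, norm_eq_of_mem_sphere θ']
        norm_num
      refine h1.trans ((mul_le_mul_of_nonneg_left h2 hM0).trans ?_)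
      have h3 : 0 ≤ M * (r + r ^ 2) := by positivity
      have h4 : 0 ≤ (n:ℝ) * (r ^ 2 * (2 * M) ^ 2) := by positivity
      nlinarith)
    (fun θ τ => by
      have hsp := scl_pos τ
      simp_rw [eX]
      have e : scl τ ^ 2 * ∑ i, (r * (scl τ)⁻¹ * fderiv ℝ v (polarPt θ τ r) (tang i θ, 0)) ^ 2 =
          r ^ 2 * ∑ i, fderiv ℝ v (polarPt θ τ r) (tang i θ, 0) ^ 2 := by
        rw [Finset.mul_sum, Finset.mul_sum]
        refine Finset.sum_congr rfl fun i _ => ?_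
        field_simp
      rw [e, abs_of_nonneg (by positivity)]
      have h1 : ∑ i : Fin n, fderiv ℝ v (polarPt θ τ r) (tang i θ, 0) ^ 2 ≤ n * (2 * M) ^ 2 := by
        refine (Finset.sum_le_card_nsmul _ _ _ fun i _ => bX i θ _).trans ?_
        simp
      have h2 : 0 ≤ M * (r + r ^ 2) := by positivity
      have h3 : 0 ≤ M * r * 2 := by positivity
      nlinarith [sq_nonneg r])
    (fun τ => sphere_poincare_polar hn hv τ hr)
  refine key.trans (le_of_eq ?_)
  refine integral_congr_ae (Eventually.of_forall fun θ => ?_)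
  refine integral_congr_ae (Eventually.of_forall fun τ => ?_)
  simp only [Fintype.sum_option, map_smul, smul_eq_mul]
  rw [mul_inv_cancel_left₀ (quad_pos τ).ne']

end

/-! ### Green's formula and the integrated spectral gap -/

section

open Set Filter Topology

variable {n : ℕ}

/-- The horizontal inner product `⟨∇_G v, ∇_G u⟩`. -/
def gradInner (v u : Space n → ℝ) (z : Space n) : ℝ :=
  (∑ i, fieldX i v z * fieldX i u z) + ‖z.1‖ ^ 2 * (partialT v z * partialT u z)

theorem gradInner_self (u : Space n → ℝ) (z : Space n) : gradInner u u z = gradSq u z := by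
  simp only [gradInner, gradSq, fieldY, sq]
  ring

theorem gradInner_polarPt (v u : Space n → ℝ) {θ : EuclideanSpace ℝ (Fin n)} (hθ : ‖θ‖ = 1)
    (τ : ℝ) {r : ℝ} (hr : 0 < r) :
    gradInner v u (polarPt θ τ r) =
      scl τ ^ 2 * (fderiv ℝ v (polarPt θ τ r) (polarVel θ τ r) *
        fderiv ℝ u (polarPt θ τ r) (polarVel θ τ r) + (r ^ 2)⁻¹ *
          ∑ j, fderiv ℝ v (polarPt θ τ r) (frame j θ τ r) *
            fderiv ℝ u (polarPt θ τ r) (frame j θ τ r)) :=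
  covector_polar _ _ hθ τ hr

theorem continuous_fderiv_apply {v : Space n → ℝ} (hv : ContDiff ℝ 1 v) (η : Space n) :
    Continuous fun z => fderiv ℝ v z η :=
  (hv.continuous_fderiv one_ne_zero).clm_apply continuous_const

theorem contDiff_fderiv_apply {u : Space n → ℝ} (hu : ContDiff ℝ 2 u) (η : Space n) :
    ContDiff ℝ 1 fun z => fderiv ℝ u z η :=
  (hu.fderiv_right (by norm_num)).clm_apply contDiff_const

theorem integral_mul_fderiv_fderiv {w u : Space n → ℝ} (hw : ContDiff ℝ 1 w)
    (hwc : HasCompactSupport w) (hu : ContDiff ℝ 2 u) (η : Space n) :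
    ∫ z, w z * fderiv ℝ (fun z => fderiv ℝ u z η) z η =
      - ∫ z, fderiv ℝ w z η * fderiv ℝ u z η := by
  have hg := contDiff_fderiv_apply hu η
  have : (volume : Measure (Space n)).IsAddHaarMeasure :=
    Measure.prod.instIsAddHaarMeasure volume volume
  refine integral_mul_fderiv_eq_neg_fderiv_mul_of_integrable ?_ ?_ ?_
    (fun z _ => hw.differentiable one_ne_zero z) (fun z _ => hg.differentiable one_ne_zero z)
  · exact ((continuous_fderiv_apply hw η).mul hg.continuous).integrable_of_hasCompactSupport
      (HasCompactSupport.mul_right (hwc.fderiv_apply (𝕜 := ℝ) η))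
  · exact (hw.continuous.mul (continuous_fderiv_apply hg η)).integrable_of_hasCompactSupport
      hwc.mul_right
  · exact (hw.continuous.mul hg.continuous).integrable_of_hasCompactSupport hwc.mul_right

theorem contDiff_norm_fst_sq {k : WithTop ℕ∞} : ContDiff ℝ k fun z : Space n => ‖z.1‖ ^ 2 :=
  contDiff_fst.norm_sq ℝ

theorem fderiv_norm_fst_sq_mul {v : Space n → ℝ} (hv : Differentiable ℝ v) (z : Space n) :
    fderiv ℝ (fun z : Space n => ‖z.1‖ ^ 2 * v z) z (0, 1) = ‖z.1‖ ^ 2 * fderiv ℝ v z (0, 1) := by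
  have h1 : HasFDerivAt (fun z : Space n => ‖z.1‖ ^ 2) _ z := (hasFDerivAt_fst (p := z)).norm_sq
  rw [(h1.fun_mul (hv z).hasFDerivAt).fderiv]
  simp

/-- Green's formula for the Grushin operator. -/
theorem integral_mul_laplacian {v u : Space n → ℝ} (hv : ContDiff ℝ 1 v)
    (hvc : HasCompactSupport v) (hu : ContDiff ℝ 2 u) :
    Integrable (fun z => v z * laplacian u z) ∧ Integrable (gradInner v u) ∧
    ∫ z, v z * laplacian u z = - ∫ z, gradInner v u z := by
  have hw : ContDiff ℝ 1 fun z : Space n => ‖z.1‖ ^ 2 * v z := contDiff_norm_fst_sq.mul hv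
  have hwc : HasCompactSupport fun z : Space n => ‖z.1‖ ^ 2 * v z := hvc.mul_left
  have cL : ∀ η, Continuous fun z => fderiv ℝ (fun z => fderiv ℝ u z η) z η := fun η =>
    continuous_fderiv_apply (contDiff_fderiv_apply hu η) η
  have i1 : ∀ i : Fin n, Integrable fun z => v z * fieldX i (fieldX i u) z := fun i =>
    (hv.continuous.mul (cL _)).integrable_of_hasCompactSupport hvc.mul_right
  have i2 : Integrable fun z : Space n => (‖z.1‖ ^ 2 * v z) * partialT (partialT u) z :=
    (hw.continuous.mul (cL _)).integrable_of_hasCompactSupport hwc.mul_right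
  have j : ∀ (w : Space n → ℝ) (_ : ContDiff ℝ 1 w) (_ : HasCompactSupport w) (η : Space n),
      Integrable fun z => fderiv ℝ w z η * fderiv ℝ u z η := fun w hw hwc η =>
    ((continuous_fderiv_apply hw η).mul
      (contDiff_fderiv_apply hu η).continuous).integrable_of_hasCompactSupport
      (HasCompactSupport.mul_right (hwc.fderiv_apply (𝕜 := ℝ) η))
  have eL : ∀ z, v z * laplacian u z = (∑ i, v z * fieldX i (fieldX i u) z) +
      (‖z.1‖ ^ 2 * v z) * partialT (partialT u) z := fun z => by
    rw [laplacian, mul_add, Finset.mul_sum]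
    ring
  have eG : ∀ z, gradInner v u z = (∑ i, fieldX i v z * fieldX i u z) +
      fderiv ℝ (fun z : Space n => ‖z.1‖ ^ 2 * v z) z (0, 1) * fderiv ℝ u z (0, 1) := fun z => by
    rw [fderiv_norm_fst_sq_mul (hv.differentiable one_ne_zero), gradInner, mul_assoc]
    rfl
  have eG' : gradInner v u = _ := funext eG
  have s1 : Integrable fun z => ∑ i, v z * fieldX i (fieldX i u) z :=
    integrable_finsetSum _ fun i _ => i1 i
  have s2 : Integrable fun z => ∑ i, fieldX i v z * fieldX i u z :=
    integrable_finsetSum _ fun i _ => j v hv hvc _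
  have j2 : ∀ i : Fin n, Integrable fun z => fieldX i v z * fieldX i u z := fun i => j v hv hvc _
  have t2 := j _ hw hwc (0, 1)
  refine ⟨(integrable_congr (Eventually.of_forall eL)).2 (s1.add i2), eG' ▸ s2.add t2, ?_⟩
  simp_rw [eL, eG]
  rw [integral_add s1 i2, integral_add s2 t2, integral_finsetSum _ fun i _ => i1 i,
    integral_finsetSum _ fun i _ => j2 i, neg_add, ← Finset.sum_neg_distrib]
  congr 1
  · exact Finset.sum_congr rfl fun i _ => integral_mul_fderiv_fderiv hv hvc hu _
  · exact integral_mul_fderiv_fderiv hw hwc hu (0, 1)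

theorem AnnSupp.continuous {a b : ℝ} {g : Space n → ℝ} (h : AnnSupp a b g)
    (hc : ∀ z, rho z ∈ Icc a b → ContinuousAt g z) : Continuous g :=
  continuous_iff_continuousAt.2 fun z => by
    by_cases hz : rho z ∈ Icc a b
    · exact hc z hz
    · exact continuousAt_const.congr (h.eventually_eq_zero hz).symm

theorem AnnSupp.integrable {a b : ℝ} {g : Space n → ℝ} (h : AnnSupp a b g)
    (hc : ∀ z, rho z ∈ Icc a b → ContinuousAt g z) : Integrable g :=
  (h.continuous hc).integrable_of_hasCompactSupport h.hasCompactSupport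

/-- The mean of `u` over the equator of the gauge sphere of radius `r`. -/
def equatorMean (u : Space n → ℝ) (r : ℝ) : ℝ :=
  sphereMean fun θ : USphere n => u (polarPt θ 0 r)

theorem contDiff_equatorMean {u : Space n → ℝ} (hu : ContDiff ℝ 1 u) :
    ContDiff ℝ 1 (equatorMean u) := by
  have hd : Differentiable ℝ u := hu.differentiable one_ne_zero
  have cp : Continuous fun p : ℝ × USphere n => polarPt (p.2 : EuclideanSpace ℝ (Fin n)) 0 p.1 := by
    unfold polarPt; fun_prop
  have cv : Continuous fun p : ℝ × USphere n => polarVel (p.2 : EuclideanSpace ℝ (Fin n)) 0 p.1 := by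
    unfold polarVel; fun_prop
  have ck : Continuous (Function.uncurry fun (r : ℝ) (θ : USphere n) => u (polarPt θ 0 r)) :=
    hu.continuous.comp cp
  have ck' : Continuous (Function.uncurry fun (r : ℝ) (θ : USphere n) =>
      fderiv ℝ u (polarPt θ 0 r) (polarVel θ 0 r)) :=
    ((hu.continuous_fderiv one_ne_zero).comp cp).clm_apply cv
  have h1 := fun r : ℝ => (hasDerivAt_integral_compact (μ := surf n) ck ck' (fun r θ =>
    (hd _).hasFDerivAt.comp_hasDerivAt r (hasDerivAt_polarPt _ 0 r)) r).const_mul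
      ((surf n).real univ)⁻¹
  have h2 : ∀ r, HasDerivAt (equatorMean u) _ r := h1
  refine contDiff_one_iff_deriv.2 ⟨fun r => (h2 r).differentiableAt, ?_⟩
  have e : deriv (equatorMean u) = _ := funext fun r => (h2 r).deriv
  rw [e]
  exact (continuous_integral_compact ck').const_mul _

theorem AnnSupp.equatorMean_eq_zero {a b : ℝ} {u : Space n → ℝ} (h : AnnSupp a b u) {r : ℝ}
    (hr : 0 ≤ r) (hr' : r ∉ Icc a b) : equatorMean u r = 0 := by
  have : ∀ θ : USphere n, u (polarPt θ 0 r) = 0 := fun θ =>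
    h.eq_zero (by rwa [rho_polarPt (norm_eq_of_mem_sphere θ) 0 hr])
  simp [equatorMean, sphereMean, this]

theorem AnnSupp.equatorMean_rho {a b : ℝ} {u : Space n → ℝ} (h : AnnSupp a b u) :
    AnnSupp a b fun z : Space n => equatorMean u (rho z) := by
  intro z hz
  by_contra h0
  exact hz (h.equatorMean_eq_zero (rho_nonneg z) h0)

theorem integral_nonneg_of_angular (hn : 1 ≤ n) {F : Space n → ℝ} (hF : Integrable F)
    (h : ∀ r, 0 < r → 0 ≤ ∫ σ, F (polarMap (σ, r)) ∂(angMeasure n)) : 0 ≤ ∫ z, F z := by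
  have hm : AEStronglyMeasurable F (((angMeasure n).prod (radMeasure n)).map polarMap) := by
    rw [map_polarMap hn]; exact hF.1
  have := integral_map continuous_polarMap.measurable.aemeasurable hm
  rw [map_polarMap hn] at this
  rw [this, integral_prod_symm _ (integrable_comp_polarMap hn hF), integral_radMeasure]
  exact setIntegral_nonneg measurableSet_Ioi fun r hr =>
    mul_nonneg (pow_nonneg (le_of_lt hr) _) (h r hr)

theorem gradSq_sub_polarPt {u : Space n → ℝ} (hu : Differentiable ℝ u)
    {θ : EuclideanSpace ℝ (Fin n)} (hθ : ‖θ‖ = 1) (τ : ℝ) {r : ℝ} (hr : 0 < r) :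
    gradSq u (polarPt θ τ r) - psi (polarPt θ τ r) * radialDeriv u (polarPt θ τ r) ^ 2 =
      scl τ ^ 2 * ((r ^ 2)⁻¹ * ∑ j, fderiv ℝ u (polarPt θ τ r) (frame j θ τ r) ^ 2) := by
  rw [← gradInner_self, gradInner_polarPt _ _ hθ τ hr, psi_polarPt hθ τ hr,
    radialDeriv_polarPt hθ τ hr (hu _)]
  simp only [← sq]
  ring

theorem continuous_gradSq {u : Space n → ℝ} (hu : ContDiff ℝ 1 u) : Continuous (gradSq u) := by
  unfold gradSq fieldY fieldX partialT
  have := continuous_fderiv_apply hu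
  fun_prop

theorem AnnSupp.gradSq {a b : ℝ} {u : Space n → ℝ} (h : AnnSupp a b u) :
    AnnSupp a b (gradSq u) := by
  intro z hz
  by_contra h0
  exact hz (by simp [Grushin.gradSq, fieldY, fieldX, partialT, h.fderiv_eq_zero h0])

/-- The spectral gap, integrated over all gauge spheres with a radial weight. -/
theorem integral_gap_nonneg (hn : 2 ≤ n) {a b : ℝ} {u : Space n → ℝ} (hu : ContDiff ℝ 1 u)
    (hs : AnnSupp a b u) {k : ℝ → ℝ} (hk : ∀ r ∈ Icc a b, 0 ≤ k r)
    (hint : Integrable fun z => k (rho z) *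
      ((rho z ^ 2)⁻¹ * (gradSq u z - psi z * radialDeriv u z ^ 2) -
        (n + 1) * (rho z ^ 4)⁻¹ * (psi z * (u z - equatorMean u (rho z)) ^ 2))) :
    0 ≤ ∫ z, k (rho z) *
      ((rho z ^ 2)⁻¹ * (gradSq u z - psi z * radialDeriv u z ^ 2) -
        (n + 1) * (rho z ^ 4)⁻¹ * (psi z * (u z - equatorMean u (rho z)) ^ 2)) := by
  have hd : Differentiable ℝ u := hu.differentiable one_ne_zero
  have := isFiniteMeasure_angMeasure hn
  have cs := continuous_scl
  refine integral_nonneg_of_angular (by omega) hint fun r hr => ?_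
  have hθ : ∀ σ : USphere n × ℝ, ‖(σ.1 : EuclideanSpace ℝ (Fin n))‖ = 1 := fun σ =>
    norm_eq_of_mem_sphere σ.1
  have hrho : ∀ σ : USphere n × ℝ, rho (polarMap (σ, r)) = r := fun σ => rho_polarPt (hθ σ) _ hr.le
  have cp : Continuous fun σ : USphere n × ℝ => polarMap (σ, r) :=
    continuous_polarMap.comp (by fun_prop)
  have cv : Continuous fun σ : USphere n × ℝ => polarVel (σ.1 : EuclideanSpace ℝ (Fin n)) σ.2 r := by
    unfold polarVel; fun_prop
  simp only [hrho]
  rw [integral_const_mul]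
  by_cases hab : r ∈ Icc a b
  swap
  · have hz : ∀ σ : USphere n × ℝ, rho (polarMap (σ, r)) ∉ Icc a b := fun σ => by rwa [hrho]
    simp only [hs.eq_zero (hz _), hs.gradSq.eq_zero (hz _), (hs.radialDeriv hd).eq_zero (hz _),
      hs.equatorMean_eq_zero hr.le hab]
    simp
  refine mul_nonneg (hk r hab) ?_
  set S : USphere n × ℝ → ℝ := fun σ =>
    ∑ j, fderiv ℝ u (polarPt σ.1 σ.2 r) (frame j (σ.1 : EuclideanSpace ℝ (Fin n)) σ.2 r) ^ 2 with hS
  have e1 : ∀ σ : USphere n × ℝ, (r ^ 2)⁻¹ * (gradSq u (polarMap (σ, r)) -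
      psi (polarMap (σ, r)) * radialDeriv u (polarMap (σ, r)) ^ 2) =
      (r ^ 4)⁻¹ * (scl σ.2 ^ 2 * S σ) := fun σ => by
    have := gradSq_sub_polarPt hd (hθ σ) σ.2 hr
    simp only [polarMap] at *
    rw [this]
    simp only [hS]
    field_simp
  have e2 : ∀ σ : USphere n × ℝ, psi (polarMap (σ, r)) = scl σ.2 ^ 2 := fun σ =>
    psi_polarPt (hθ σ) _ hr
  simp_rw [e1, e2]
  obtain ⟨C, hC⟩ := hs.gradSq.hasCompactSupport.exists_bound_of_continuous (continuous_gradSq hu)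
  obtain ⟨M, hM⟩ := hs.hasCompactSupport.exists_bound_of_continuous hu.continuous
  have i1 : Integrable (fun σ => scl σ.2 ^ 2 * S σ) (angMeasure n) := by
    have e : ∀ σ : USphere n × ℝ, scl σ.2 ^ 2 * S σ = r ^ 2 * (gradSq u (polarMap (σ, r)) -
        scl σ.2 ^ 2 * fderiv ℝ u (polarMap (σ, r))
          (polarVel (σ.1 : EuclideanSpace ℝ (Fin n)) σ.2 r) ^ 2) := fun σ => by
      have h1 := e1 σ
      have h2 := radialDeriv_polarPt (hθ σ) σ.2 hr (hd _)
      rw [e2] at h1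
      simp only [polarMap] at *
      rw [h2] at h1
      field_simp at h1
      linear_combination -h1
    refine Integrable.of_bound ?_ (r ^ 2 * C) (Eventually.of_forall fun σ => ?_)
    · rw [funext e]
      exact (continuous_const.mul (((continuous_gradSq hu).comp cp).sub
        (((cs.comp continuous_snd).pow 2).mul ((((hu.continuous_fderiv one_ne_zero).comp
          cp).clm_apply cv).pow 2)))).aestronglyMeasurable
    · have h0 : 0 ≤ scl σ.2 ^ 2 * S σ :=
        mul_nonneg (sq_nonneg _) (Finset.sum_nonneg fun j _ => sq_nonneg _)
      rw [Real.norm_of_nonneg h0, e]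
      have h1 := (le_abs_self _).trans (hC (polarMap (σ, r)))
      gcongr
      have : 0 ≤ scl σ.2 ^ 2 * fderiv ℝ u (polarMap (σ, r))
          (polarVel (σ.1 : EuclideanSpace ℝ (Fin n)) σ.2 r) ^ 2 := by positivity
      linarith
  have i2 : Integrable (fun σ : USphere n × ℝ => scl σ.2 ^ 2 *
      (u (polarMap (σ, r)) - equatorMean u r) ^ 2) (angMeasure n) := by
    refine Integrable.of_bound ?_ ((M + |equatorMean u r|) ^ 2) (Eventually.of_forall fun σ => ?_)
    · exact (((cs.comp continuous_snd).pow 2).mul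
        (((hu.continuous.comp cp).sub continuous_const).pow 2)).aestronglyMeasurable
    · rw [Real.norm_of_nonneg (by positivity)]
      have h1 : scl σ.2 ^ 2 ≤ 1 := pow_le_one₀ (scl_pos _).le (scl_le_one _)
      have h2 : (u (polarMap (σ, r)) - equatorMean u r) ^ 2 ≤ (M + |equatorMean u r|) ^ 2 := by
        rw [← sq_abs]
        exact pow_le_pow_left₀ (abs_nonneg _) ((abs_sub _ _).trans
          (add_le_add (hM _) le_rfl)) 2
      nlinarith [sq_nonneg (u (polarMap (σ, r)) - equatorMean u r)]
  rw [integral_sub (i1.const_mul _) (i2.const_mul _), integral_const_mul, integral_const_mul,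
    integral_angMeasure (fun θ τ => scl τ ^ 2 * S (θ, τ)) i1,
    integral_angMeasure (fun θ τ => scl τ ^ 2 *
      (u (polarMap ((θ, τ), r)) - equatorMean u r) ^ 2) i2]
  have e3 : ∀ τ x, scl τ ^ (n + 2) * (scl τ ^ 2 * x) = angWt n τ * x := fun τ x => by
    rw [angWt_eq]; ring
  simp_rw [e3]
  have := angular_poincare hn hu hs.hasCompactSupport hr
  have h4 : (0:ℝ) ≤ (r ^ 4)⁻¹ := by positivity
  have h5 := mul_le_mul_of_nonneg_left this h4
  rw [sub_nonneg]
  refine le_trans (le_of_eq ?_) h5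
  simp only [polarMap, equatorMean]
  ring

end

/-! ### Integrability of the last term -/

section

open Set Filter Topology

variable {n : ℕ}

theorem ae_radMeasure_pos : ∀ᵐ r ∂(radMeasure n), 0 < r :=
  (withDensity_absolutelyContinuous _ _).ae_le (ae_restrict_mem measurableSet_Ioi)

theorem map_rho (hn : 1 ≤ n) :
    (volume : Measure (Space n)).map rho = (angMeasure n univ) • radMeasure n := by
  rw [← map_polarMap hn, Measure.map_map continuous_rho.measurable continuous_polarMap.measurable,
    ← Measure.map_snd_prod]
  refine Measure.map_congr ?_
  filter_upwards [Measure.quasiMeasurePreserving_snd.ae ae_radMeasure_pos] with p hp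
  exact rho_polarPt (norm_eq_of_mem_sphere p.1.1) _ hp.le

theorem integrable_comp_rho (hn : 2 ≤ n) {g : ℝ → ℝ} (hg : Integrable g (radMeasure n)) :
    Integrable fun z : Space n => g (rho z) := by
  have := isFiniteMeasure_angMeasure hn
  have h : Integrable g ((volume : Measure (Space n)).map rho) := by
    rw [map_rho (by omega)]
    exact hg.smul_measure (measure_ne_top _ _)
  exact h.comp_measurable continuous_rho.measurable

section Bessel

variable {m : ℕ} {R : ℝ≥0∞} {V W f : ℝ → ℝ} {a b : ℝ}

theorem Icc_subset_radii (ha : 0 < a) (hb : b ∈ radii R) : Icc a b ⊆ radii R :=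
  fun _ hr => mem_radii_of_le hb (ha.trans_le hr.1) hr.2

theorem IsBesselPair.integrable_indicator_sq (h : IsBesselPair (m + 4) R V W f)
    (hV : ∀ r ∈ radii R, 0 ≤ V r) (ha : 0 < a) (hb : b ∈ radii R) :
    Integrable ((Icc a b).indicator fun r => V r * logDer f r ^ 2) (radMeasure (m + 2)) := by
  rw [integrable_radMeasure_iff]
  have e : (fun r => r ^ (m + 2 + 1) * (Icc a b).indicator (fun r => V r * logDer f r ^ 2) r) =
      (Icc a b).indicator fun r => r ^ (m + 3) * (V r * logDer f r ^ 2) := by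
    funext r
    by_cases hr : r ∈ Icc a b <;> simp [hr]
  rw [e]
  exact ((integrable_indicator_iff measurableSet_Icc).2
    (h.integrableOn_riccati hV ha hb)).integrableOn

theorem IsBesselPair.integrable_indicator (h : IsBesselPair (m + 4) R V W f)
    (hV : ∀ r ∈ radii R, 0 ≤ V r) (ha : 0 < a) (hb : b ∈ radii R) :
    Integrable ((Icc a b).indicator fun r => V r * logDer f r) (radMeasure (m + 2)) := by
  have hsub := Icc_subset_radii ha hb
  have hf : ContinuousOn f (Icc a b) := fun r hr =>
    (h.differentiableAt r (hsub hr)).continuousAt.continuousWithinAt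
  have cV : ContinuousOn V (Icc a b) := h.contDiffOn_V.continuousOn.mono hsub
  have hm : Measurable ((Icc a b).indicator fun r => V r * logDer f r) := by
    have e : ((Icc a b).indicator fun r => V r * logDer f r) = fun r =>
        (Icc a b).indicator V r * (deriv f r / (Icc a b).indicator f r) := by
      funext r
      by_cases hr : r ∈ Icc a b <;> simp [hr, logDer]
    rw [e]
    have h1 : ∀ g : ℝ → ℝ, ContinuousOn g (Icc a b) → Measurable ((Icc a b).indicator g) :=
      fun g hg => by
        have := (hg.measurable_piecewise (g := (0 : ℝ → ℝ)) continuous_zero.continuousOn measurableSet_Icc)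
        rwa [piecewise_eq_indicator] at this
    exact (h1 V cV).mul ((measurable_deriv f).div (h1 f hf))
  have iV : Integrable ((Icc a b).indicator V) (radMeasure (m + 2)) := by
    rw [integrable_radMeasure_iff]
    have e : (fun r => r ^ (m + 2 + 1) * (Icc a b).indicator V r) =
        (Icc a b).indicator fun r => r ^ (m + 3) * V r := by
      funext r
      by_cases hr : r ∈ Icc a b <;> simp [hr]
    rw [e]
    exact ((integrable_indicator_iff measurableSet_Icc).2
      (((continuous_pow _).continuousOn.mul cV).integrableOn_compact isCompact_Icc)).integrableOn
  refine (iV.add (h.integrable_indicator_sq hV ha hb)).mono' hm.aestronglyMeasurable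
    (Eventually.of_forall fun r => ?_)
  by_cases hr : r ∈ Icc a b
  · simp only [hr, indicator_of_mem, Pi.add_apply]
    have hv := hV r (hsub hr)
    rw [norm_mul, Real.norm_of_nonneg hv, Real.norm_eq_abs, ← sq_abs (logDer f r)]
    nlinarith [mul_nonneg hv (sq_nonneg (|logDer f r| - 1)),
      mul_nonneg hv (sq_nonneg (logDer f r)), abs_nonneg (logDer f r), sq_abs (logDer f r)]
  · simp [hr]

theorem hasFDerivAt_rho {z : Space n} (hz : z ≠ 0) : HasFDerivAt rho (fderiv ℝ rho z) z :=
  ((contDiffAt_rho hz (k := 1)).differentiableAt one_ne_zero).hasFDerivAt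

theorem ne_zero_of_rho_mem (ha : 0 < a) {z : Space n} (hz : rho z ∈ Icc a b) : z ≠ 0 := by
  rintro rfl
  rw [rho_eq_zero_iff.2 rfl] at hz
  exact ha.not_ge hz.1

theorem fderiv_div_radial {g : Space n → ℝ} {z : Space n} (hz : z ≠ 0)
    (hg : DifferentiableAt ℝ g z) (hf : DifferentiableAt ℝ f (rho z)) (h0 : f (rho z) ≠ 0)
    (η : Space n) :
    fderiv ℝ (fun w => g w / f (rho w)) z η =
      (fderiv ℝ g z η - logDer f (rho z) * g z * fderiv ℝ rho z η) / f (rho z) := by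
  have h1 : HasFDerivAt (fun w => f (rho w)) (deriv f (rho z) • fderiv ℝ rho z) z :=
    hf.hasDerivAt.comp_hasFDerivAt z (hasFDerivAt_rho hz)
  have h2 : HasFDerivAt (fun w => (f (rho w))⁻¹)
      (-(f (rho z) ^ 2)⁻¹ • (deriv f (rho z) • fderiv ℝ rho z)) z :=
    (hasDerivAt_inv h0).comp_hasFDerivAt z h1
  have h3 := hg.hasFDerivAt.fun_mul h2
  have e : (fun w => g w / f (rho w)) = fun w => g w * (f (rho w))⁻¹ :=
    funext fun w => div_eq_mul_inv _ _
  rw [e, h3.fderiv]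
  simp only [_root_.add_apply, _root_.smul_apply, smul_eq_mul, logDer]
  field_simp
  ring

theorem gradSq_div_radial {g : Space n → ℝ} {z : Space n} (hz : z ≠ 0)
    (hg : DifferentiableAt ℝ g z) (hf : DifferentiableAt ℝ f (rho z)) (h0 : f (rho z) ≠ 0) :
    gradSq (fun w => g w / f (rho w)) z * f (rho z) ^ 2 =
      gradSq g z - 2 * logDer f (rho z) * (g z * gradInner g rho z) +
        logDer f (rho z) ^ 2 * (g z ^ 2 * gradSq rho z) := by
  simp only [← gradInner_self, gradInner, fieldX, partialT, fderiv_div_radial hz hg hf h0]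
  have e : ∀ η : Space n,
      (fderiv ℝ g z η - logDer f (rho z) * g z * fderiv ℝ rho z η) / f (rho z) *
      ((fderiv ℝ g z η - logDer f (rho z) * g z * fderiv ℝ rho z η) / f (rho z)) =
      (fderiv ℝ g z η * fderiv ℝ g z η - 2 * logDer f (rho z) * (g z *
        (fderiv ℝ g z η * fderiv ℝ rho z η)) + logDer f (rho z) ^ 2 * (g z ^ 2 *
        (fderiv ℝ rho z η * fderiv ℝ rho z η))) / f (rho z) ^ 2 := by
    intro η
    field_simp
    ring
  simp only [e, ← Finset.sum_div, Finset.sum_add_distrib, Finset.sum_sub_distrib, ← Finset.mul_sum]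
  field_simp
  ring

theorem continuousAt_radial {k : ℝ → ℝ} (hk : ContinuousOn k (radii R)) {z : Space n}
    (hz : rho z ∈ radii R) : ContinuousAt (fun z : Space n => k (rho z)) z :=
  ContinuousAt.comp (f := rho) (hk.continuousAt ((isOpen_radii R).mem_nhds hz))
    continuous_rho.continuousAt

theorem continuousAt_psi {z : Space n} (hz : z ≠ 0) : ContinuousAt psi z := by
  unfold psi
  exact (by fun_prop : Continuous fun z : Space n => ‖z.1‖ ^ 2).continuousAt.div
    (continuous_rho.continuousAt.pow 2) (pow_ne_zero _ (rho_pos hz).ne')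

theorem AnnSupp.gradSq_div {u : Space n → ℝ} (hu : AnnSupp a b u) :
    AnnSupp a b (Grushin.gradSq fun w => u w / f (rho w)) := by
  refine AnnSupp.gradSq fun z hz => hu z fun h0 => hz ?_
  simp [h0]

/-- The last integrand of the inequality is integrable. -/
theorem IsBesselPair.integrable_gradSq_div (h : IsBesselPair (m + 4) R V W f)
    (hV : ∀ r ∈ radii R, 0 ≤ V r) (ha : 0 < a) (hb : b ∈ radii R) {g : Space (m + 2) → ℝ}
    (hg : ContDiff ℝ 1 g) (hs : AnnSupp a b g) :
    Integrable fun z => V (rho z) * gradSq (fun w => g w / f (rho w)) z * f (rho z) ^ 2 := by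
  have hsub := Icc_subset_radii ha hb
  have hgd := hg.differentiable one_ne_zero
  have hz0 : ∀ z : Space (m + 2), rho z ∈ Icc a b → z ≠ 0 := fun z => ne_zero_of_rho_mem ha
  set A₁ : Space (m + 2) → ℝ := fun z => -2 * gradInner g rho z * g z
  set A₂ : Space (m + 2) → ℝ := fun z => psi z * g z * g z
  have s₁ : AnnSupp a b A₁ := hs.mul_left _
  have s₂ : AnnSupp a b A₂ := hs.mul_left _
  have cρ : ∀ z : Space (m + 2), z ≠ 0 → ∀ η, ContinuousAt (fun z => fderiv ℝ rho z η) z :=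
    fun z hz η => ((((contDiffAt_rho hz (k := 2)).fderiv_right (m := 1) (by norm_num)).clm_apply
      contDiffAt_const).continuousAt)
  have c₁ : Continuous A₁ := s₁.continuous fun z hz => by
    refine (continuousAt_const.mul ?_).mul hg.continuous.continuousAt
    unfold gradInner
    refine (tendsto_finsetSum _ fun i _ => ?_).add
      (ContinuousAt.mul (by fun_prop) (ContinuousAt.mul ?_ (cρ z (hz0 z hz) _)))
    · exact (ContinuousAt.mul (continuous_fderiv_apply hg _).continuousAt (cρ z (hz0 z hz) _))
    · exact (continuous_fderiv_apply hg _).continuousAt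
  have c₂ : Continuous A₂ := s₂.continuous fun z hz =>
    ((continuousAt_psi (hz0 z hz)).mul hg.continuous.continuousAt).mul hg.continuous.continuousAt
  obtain ⟨C₁, hC₁⟩ := s₁.hasCompactSupport.exists_bound_of_continuous c₁
  obtain ⟨C₂, hC₂⟩ := s₂.hasCompactSupport.exists_bound_of_continuous c₂
  have i₀ : Integrable fun z => V (rho z) * gradSq g z :=
    (hs.gradSq.mul_left _).integrable fun z hz =>
      (continuousAt_radial h.contDiffOn_V.continuousOn (hsub hz)).mul
        (continuous_gradSq hg).continuousAt
  have i₁ := (integrable_comp_rho (by omega) (h.integrable_indicator hV ha hb)).bdd_mul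
    c₁.aestronglyMeasurable (Eventually.of_forall hC₁)
  have i₂ := (integrable_comp_rho (by omega) (h.integrable_indicator_sq hV ha hb)).bdd_mul
    c₂.aestronglyMeasurable (Eventually.of_forall hC₂)
  refine ((i₀.add i₁).add i₂).congr (Eventually.of_forall fun z => ?_)
  simp only [Pi.add_apply]
  by_cases hz : rho z ∈ Icc a b
  · rw [mul_assoc (V (rho z)) (gradSq _ z), gradSq_div_radial (hz0 z hz) (hgd z) (h.differentiableAt _ (hsub hz))
      (h.pos _ (hsub hz)).ne', gradSq_rho (hz0 z hz), indicator_of_mem hz, indicator_of_mem hz]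
    simp only [A₁, A₂]
    ring
  · rw [hs.gradSq_div.eq_zero hz, hs.gradSq.eq_zero hz, s₁.eq_zero hz, s₂.eq_zero hz]
    ring

end Bessel

end

/-! ### The multiplier and the pointwise identity -/

section

open Set Filter Topology

variable {n m : ℕ} {R : ℝ≥0∞} {V W f : ℝ → ℝ} {a b : ℝ}

/-- The radial part `u_ϱϱ + (Q - 1) ϱ⁻¹ u_ϱ` of `ℒ_G u / ψ`, where `Q = m + 4`. -/
def radialPart (m : ℕ) (u : Space n → ℝ) (z : Space n) : ℝ :=
  radialDeriv (radialDeriv u) z + (m + 3) * ((rho z)⁻¹ * radialDeriv u z)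

/-- The rescaled deviation of `u` from its mean on the equator. -/
def gapTerm (u : Space n → ℝ) (z : Space n) : ℝ :=
  (rho z ^ 2)⁻¹ * (u z - equatorMean u (rho z))

/-- The test function against which `ℒ_G u` is integrated. -/
def multiplier (m : ℕ) (V : ℝ → ℝ) (u : Space n → ℝ) (z : Space n) : ℝ :=
  V (rho z) * (radialPart m u z - (m + 3) * gapTerm u z)

theorem fderiv_radial_frame {k : ℝ → ℝ} (j : Option (Fin n)) {θ : EuclideanSpace ℝ (Fin n)}
    (hθ : ‖θ‖ = 1) (τ : ℝ) {r : ℝ} (hr : 0 < r) (hk : DifferentiableAt ℝ k r) :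
    fderiv ℝ (fun z => k (rho z)) (polarPt θ τ r) (frame j θ τ r) = 0 := by
  have hρ := rho_polarPt hθ τ hr.le
  have h1 : HasFDerivAt (fun z : Space n => k (rho z)) (deriv k r • fderiv ℝ rho (polarPt θ τ r))
      (polarPt θ τ r) := by
    refine HasDerivAt.comp_hasFDerivAt (h₂ := k) _ ?_ (hasFDerivAt_rho (polarPt_ne_zero hθ τ hr))
    rw [hρ]
    exact hk.hasDerivAt
  rw [h1.fderiv, _root_.smul_apply, fderiv_rho_frame j hθ τ hr, smul_zero]

theorem differentiableAt_radial {k : ℝ → ℝ} {θ : EuclideanSpace ℝ (Fin n)}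
    (hθ : ‖θ‖ = 1) (τ : ℝ) {r : ℝ} (hr : 0 < r) (hk : DifferentiableAt ℝ k r) :
    DifferentiableAt ℝ (fun z : Space n => k (rho z)) (polarPt θ τ r) := by
  refine DifferentiableAt.comp (g := k) (f := rho) _ ?_
    (hasFDerivAt_rho (polarPt_ne_zero hθ τ hr)).differentiableAt
  rwa [rho_polarPt hθ τ hr.le]

theorem fderiv_radial_mul_frame {k : ℝ → ℝ} {g : Space n → ℝ} (j : Option (Fin n))
    {θ : EuclideanSpace ℝ (Fin n)} (hθ : ‖θ‖ = 1) (τ : ℝ) {r : ℝ} (hr : 0 < r)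
    (hk : DifferentiableAt ℝ k r) (hg : DifferentiableAt ℝ g (polarPt θ τ r)) :
    fderiv ℝ (fun z => k (rho z) * g z) (polarPt θ τ r) (frame j θ τ r) =
      k r * fderiv ℝ g (polarPt θ τ r) (frame j θ τ r) := by
  rw [fderiv_fun_mul (differentiableAt_radial hθ τ hr hk) hg]
  simp only [_root_.add_apply, _root_.smul_apply, fderiv_radial_frame j hθ τ hr hk,
    rho_polarPt hθ τ hr.le, smul_eq_mul, mul_zero, add_zero]

theorem differentiableAt_radial_mul {k : ℝ → ℝ} {g : Space n → ℝ}
    {θ : EuclideanSpace ℝ (Fin n)} (hθ : ‖θ‖ = 1) (τ : ℝ) {r : ℝ} (hr : 0 < r)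
    (hk : DifferentiableAt ℝ k r) (hg : DifferentiableAt ℝ g (polarPt θ τ r)) :
    DifferentiableAt ℝ (fun z => k (rho z) * g z) (polarPt θ τ r) :=
  (differentiableAt_radial hθ τ hr hk).fun_mul hg

theorem fderiv_multiplier_frame {u : Space n → ℝ} (hu : Differentiable ℝ u)
    (hu₁ : Differentiable ℝ (radialDeriv u)) (hu₂ : Differentiable ℝ (radialDeriv (radialDeriv u)))
    (hc : Differentiable ℝ (equatorMean u)) (j : Option (Fin n))
    {θ : EuclideanSpace ℝ (Fin n)} (hθ : ‖θ‖ = 1) (τ : ℝ) {r : ℝ} (hr : 0 < r)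
    (hV : DifferentiableAt ℝ V r) :
    fderiv ℝ (multiplier m V u) (polarPt θ τ r) (frame j θ τ r) =
      V r * (fderiv ℝ (radialDeriv (radialDeriv u)) (polarPt θ τ r) (frame j θ τ r) +
        (m + 3) * (r⁻¹ * fderiv ℝ (radialDeriv u) (polarPt θ τ r) (frame j θ τ r)) -
        (m + 3) * ((r ^ 2)⁻¹ * fderiv ℝ u (polarPt θ τ r) (frame j θ τ r))) := by
  have k1 : DifferentiableAt ℝ (fun r : ℝ => r⁻¹) r := differentiableAt_inv hr.ne'
  have k2 : DifferentiableAt ℝ (fun r : ℝ => (r ^ 2)⁻¹) r :=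
    (differentiableAt_pow 2).inv (pow_ne_zero 2 hr.ne')
  have d0 : DifferentiableAt ℝ (fun z : Space n => equatorMean u (rho z)) (polarPt θ τ r) :=
    differentiableAt_radial hθ τ hr (hc r)
  have d1 := differentiableAt_radial_mul hθ τ hr k1 (hu₁ _)
  have dg : DifferentiableAt ℝ (fun z => u z - equatorMean u (rho z)) (polarPt θ τ r) :=
    (hu _).fun_sub d0
  have d2 := differentiableAt_radial_mul hθ τ hr k2 dg
  have e1 := fderiv_radial_mul_frame j hθ τ hr k1 (hu₁ _)
  have e2 := fderiv_radial_mul_frame j hθ τ hr k2 dg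
  rw [fderiv_fun_sub (hu _) d0, _root_.sub_apply, fderiv_radial_frame j hθ τ hr (hc r),
    sub_zero] at e2
  have hB : DifferentiableAt ℝ (radialPart m u) (polarPt θ τ r) :=
    (hu₂ _).fun_add (d1.const_mul ((m : ℝ) + 3))
  have hG : DifferentiableAt ℝ (fun z => (m + 3) * gapTerm u z) (polarPt θ τ r) :=
    d2.const_mul ((m : ℝ) + 3)
  have eB : fderiv ℝ (radialPart m u) (polarPt θ τ r) = _ :=
    fderiv_fun_add (hu₂ _) (d1.const_mul ((m : ℝ) + 3))
  have eG : fderiv ℝ (fun z => (m + 3) * gapTerm u z) (polarPt θ τ r) = _ :=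
    fderiv_const_mul d2 ((m : ℝ) + 3)
  have e3 : fderiv ℝ (multiplier m V u) (polarPt θ τ r) (frame j θ τ r) = _ :=
    fderiv_radial_mul_frame j hθ τ hr hV (hB.fun_sub hG)
  rw [e3, fderiv_fun_sub hB hG, _root_.sub_apply, eB, eG, _root_.add_apply,
    fderiv_const_mul d1]
  simp only [_root_.smul_apply, smul_eq_mul, e1, e2]

theorem AnnSupp.const_mul {u : Space n → ℝ} (h : AnnSupp a b u) (c : ℝ) :
    AnnSupp a b fun z => c * u z := h.mul_left _

theorem AnnSupp.radialPart {u : Space n → ℝ} (h : AnnSupp a b u) (hu : Differentiable ℝ u)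
    (hu₁ : Differentiable ℝ (Grushin.radialDeriv u)) : AnnSupp a b (radialPart m u) :=
  ((h.radialDeriv hu).radialDeriv hu₁).add (((h.radialDeriv hu).mul_left _).const_mul _)

theorem AnnSupp.gapTerm {u : Space n → ℝ} (h : AnnSupp a b u) : AnnSupp a b (gapTerm u) :=
  (h.sub h.equatorMean_rho).mul_left _

theorem AnnSupp.multiplier {u : Space n → ℝ} (h : AnnSupp a b u) (hu : Differentiable ℝ u)
    (hu₁ : Differentiable ℝ (Grushin.radialDeriv u)) : AnnSupp a b (multiplier m V u) :=
  ((h.radialPart hu hu₁).sub (h.gapTerm.const_mul _)).mul_left _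

theorem AnnSupp.contDiff {k : WithTop ℕ∞} {g : Space n → ℝ} (h : AnnSupp a b g)
    (hc : ∀ z, rho z ∈ Icc a b → ContDiffAt ℝ k g z) : ContDiff ℝ k g :=
  contDiff_iff_contDiffAt.2 fun z => by
    by_cases hz : rho z ∈ Icc a b
    · exact hc z hz
    · exact contDiffAt_const.congr_of_eventuallyEq (h.eventually_eq_zero hz)

theorem AnnSupp.contDiff_gapTerm (ha : 0 < a) {u : Space n → ℝ} (h : AnnSupp a b u)
    (hu : ContDiff ℝ 1 u) : ContDiff ℝ 1 (Grushin.gapTerm u) :=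
  h.gapTerm.contDiff fun z hz => by
    have hz0 := ne_zero_of_rho_mem ha hz
    have hρ := contDiffAt_rho hz0 (k := 1)
    exact ((hρ.pow 2).inv (pow_ne_zero 2 (rho_pos hz0).ne')).mul
      (hu.contDiffAt.sub ((contDiff_equatorMean hu).contDiffAt.comp z hρ))

theorem AnnSupp.contDiff_radialPart (ha : 0 < a) {u : Space n → ℝ} (h : AnnSupp a b u)
    (hu : ContDiff ℝ ∞ u) : ContDiff ℝ 1 (Grushin.radialPart m u) := by
  have hu₁ := h.contDiff_radialDeriv ha hu
  have h₁ := h.radialDeriv (hu.differentiable (by simp))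
  have hu₂ := h₁.contDiff_radialDeriv ha hu₁
  refine (h.radialPart (hu.differentiable (by simp))
    (hu₁.differentiable (by simp))).contDiff fun z hz => ?_
  have hz0 := ne_zero_of_rho_mem ha hz
  exact (hu₂.of_le (by simp)).contDiffAt.add (contDiffAt_const.mul
    (((contDiffAt_rho hz0).inv (rho_pos hz0).ne').mul (hu₁.of_le (by simp)).contDiffAt))

theorem contDiffAt_radial (hV : ContDiffOn ℝ 1 V (radii R)) {z : Space n} (hz : rho z ∈ radii R) :
    ContDiffAt ℝ 1 (fun z : Space n => V (rho z)) z := by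
  have hz0 : z ≠ 0 := fun h => hz.1.ne' (rho_eq_zero_iff.2 h)
  exact ContDiffAt.comp (g := V) z (hV.contDiffAt ((isOpen_radii R).mem_nhds hz))
    (contDiffAt_rho hz0)

theorem AnnSupp.contDiff_multiplier (ha : 0 < a) (hb : b ∈ radii R) {u : Space n → ℝ}
    (h : AnnSupp a b u) (hu : ContDiff ℝ ∞ u) (hV : ContDiffOn ℝ 1 V (radii R)) :
    ContDiff ℝ 1 (Grushin.multiplier m V u) := by
  have hu₁ := h.contDiff_radialDeriv ha hu
  refine (h.multiplier (hu.differentiable (by simp))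
    (hu₁.differentiable (by simp))).contDiff fun z hz => ?_
  exact (contDiffAt_radial hV (Icc_subset_radii ha hb hz)).mul
    ((h.contDiff_radialPart ha hu).contDiffAt.sub
      (contDiffAt_const.mul (h.contDiff_gapTerm ha (hu.of_le (by simp))).contDiffAt))

/-- The integrand controlled by the spectral gap of the gauge spheres. -/
def gapIntegrand (m : ℕ) (V : ℝ → ℝ) (u : Space n → ℝ) (z : Space n) : ℝ :=
  (m + 3) * V (rho z) * ((rho z ^ 2)⁻¹ * (gradSq u z - psi z * radialDeriv u z ^ 2) -
    (n + 1) * (rho z ^ 4)⁻¹ * (psi z * (u z - equatorMean u (rho z)) ^ 2))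

/-- The part of the lower bound for the left hand side that involves no integration by parts. -/
def radialEnergy (m : ℕ) (V : ℝ → ℝ) (u : Space n → ℝ) (z : Space n) : ℝ :=
  psi z * (V (rho z) * radialPart m u z ^ 2 - 2 * (multiplier m V u z * radialPart m u z) -
    V (rho z) * ((m + 3) * gapTerm u z) ^ 2)

/-- The difference of the two sides, after integration by parts and without the spectral gap. -/
def defect (m : ℕ) (V W f : ℝ → ℝ) (u : Space n → ℝ) (z : Space n) : ℝ :=
  radialEnergy m V u z - 2 * gradInner (multiplier m V u) u z - W (rho z) * gradSq u z -
    (m + 3) * ((V (rho z) / rho z ^ 2 - deriv V (rho z) / rho z) * gradSq u z) -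
    V (rho z) * gradSq (fun w => radialDeriv u w / f (rho w)) z * f (rho z) ^ 2 -
    gapIntegrand m V u z

theorem defect_polarPt (h : IsBesselPair (m + 4) R V W f) (ha : 0 < a) (hb : b ∈ radii R)
    {u : Space (m + 2) → ℝ} (hs : AnnSupp a b u) (hu : ContDiff ℝ ∞ u)
    {θ : EuclideanSpace ℝ (Fin (m + 2))} (hθ : ‖θ‖ = 1) (τ : ℝ) {r : ℝ} (hr : r ∈ Icc a b) :
    defect m V W f u (polarPt θ τ r) = scl τ ^ 2 * rayIntegrand m V W f
      (fun r => radialDeriv u (polarPt θ τ r))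
      (fun r => radialDeriv (radialDeriv u) (polarPt θ τ r))
      (fun r => multiplier m V u (polarPt θ τ r))
      (fun r => radialDeriv (multiplier m V u) (polarPt θ τ r))
      (fun j r => fderiv ℝ u (polarPt θ τ r) (frame j θ τ r))
      (fun j r => fderiv ℝ (radialDeriv u) (polarPt θ τ r) (frame j θ τ r))
      (fun j r => fderiv ℝ (radialDeriv (radialDeriv u)) (polarPt θ τ r) (frame j θ τ r)) r := by
  have hR := Icc_subset_radii ha hb hr
  have hr0 : 0 < r := hR.1
  have hu₁ := hs.contDiff_radialDeriv ha hu
  have hd : Differentiable ℝ u := hu.differentiable (by simp)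
  have hd₁ : Differentiable ℝ (radialDeriv u) := hu₁.differentiable (by simp)
  have hs₁ := hs.radialDeriv hd
  have hd₂ : Differentiable ℝ (radialDeriv (radialDeriv u)) :=
    (hs₁.contDiff_radialDeriv ha hu₁).differentiable (by simp)
  have hdv : Differentiable ℝ (multiplier m V u) :=
    (hs.contDiff_multiplier ha hb hu h.contDiffOn_V).differentiable one_ne_zero
  have hu' : ContDiff ℝ 1 u := hu.of_le (by simp)
  have hc := (contDiff_equatorMean hu').differentiable one_ne_zero
  have hf0 := (h.pos r hR).ne'
  have hρ := rho_polarPt hθ τ hr0.le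
  have hp0 := polarPt_ne_zero hθ τ hr0
  have hψ := psi_polarPt hθ τ hr0
  have eE : gradSq u (polarPt θ τ r) = scl τ ^ 2 * (radialDeriv u (polarPt θ τ r) ^ 2 +
      (r ^ 2)⁻¹ * ∑ j, fderiv ℝ u (polarPt θ τ r) (frame j θ τ r) ^ 2) := by
    have := gradSq_sub_polarPt hd hθ τ hr0
    rw [hψ] at this
    linear_combination this
  have eI : gradInner (multiplier m V u) u (polarPt θ τ r) =
      scl τ ^ 2 * (radialDeriv (multiplier m V u) (polarPt θ τ r) * radialDeriv u (polarPt θ τ r) +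
      (r ^ 2)⁻¹ * ∑ j, V r * (fderiv ℝ (radialDeriv (radialDeriv u)) (polarPt θ τ r) (frame j θ τ r) +
        (m + 3) * (r⁻¹ * fderiv ℝ (radialDeriv u) (polarPt θ τ r) (frame j θ τ r)) -
        (m + 3) * ((r ^ 2)⁻¹ * fderiv ℝ u (polarPt θ τ r) (frame j θ τ r))) *
        fderiv ℝ u (polarPt θ τ r) (frame j θ τ r)) := by
    rw [gradInner_polarPt _ _ hθ τ hr0, ← radialDeriv_polarPt hθ τ hr0 (hdv _),
      ← radialDeriv_polarPt hθ τ hr0 (hd _)]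
    simp only [fderiv_multiplier_frame hd hd₁ hd₂ hc _ hθ τ hr0
      (h.hasDerivAt_V hR).differentiableAt]
  have eD : gradSq (fun w => radialDeriv u w / f (rho w)) (polarPt θ τ r) * f r ^ 2 =
      scl τ ^ 2 * ((radialDeriv (radialDeriv u) (polarPt θ τ r) -
        logDer f r * radialDeriv u (polarPt θ τ r)) ^ 2 +
        (r ^ 2)⁻¹ * ∑ j, fderiv ℝ (radialDeriv u) (polarPt θ τ r) (frame j θ τ r) ^ 2) := by
    have hfd : DifferentiableAt ℝ f (rho (polarPt θ τ r)) := by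
      rw [hρ]; exact h.differentiableAt r hR
    have key : ∀ η, fderiv ℝ (fun w => radialDeriv u w / f (rho w)) (polarPt θ τ r) η = _ :=
      fderiv_div_radial hp0 (hd₁ _) hfd (hρ.symm ▸ hf0)
    rw [← gradInner_self, gradInner_polarPt _ _ hθ τ hr0]
    simp only [key, hρ, fderiv_rho_polarVel hθ τ hr0, fderiv_rho_frame _ hθ τ hr0, mul_zero,
      sub_zero, mul_one, ← radialDeriv_polarPt hθ τ hr0 (hd₁ _)]
    have e : ∀ x : ℝ, x / f r * (x / f r) = x ^ 2 * (f r ^ 2)⁻¹ := fun x => by field_simp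
    simp only [e, ← Finset.sum_mul]
    field_simp
  unfold defect radialEnergy gapIntegrand rayIntegrand
  rw [mul_assoc (V (rho (polarPt θ τ r))) (gradSq _ _), hρ, eD, eE, eI, hψ]
  have hB : radialPart m u (polarPt θ τ r) = radialDeriv (radialDeriv u) (polarPt θ τ r) +
      (m + 3) * (r⁻¹ * radialDeriv u (polarPt θ τ r)) := by rw [radialPart, hρ]
  have hg : gapTerm u (polarPt θ τ r) = (r ^ 2)⁻¹ * (u (polarPt θ τ r) - equatorMean u r) := by
    rw [gapTerm, hρ]
  rw [hB, hg]
  have sq_sum : ∀ x y z : Option (Fin (m + 2)) → ℝ, ∑ j, V r * (x j + (m + 3) * (r⁻¹ * y j) -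
      (m + 3) * ((r ^ 2)⁻¹ * z j)) * z j = V r * (∑ j, x j * z j + (m + 3) * (r⁻¹ *
        ∑ j, y j * z j) - (m + 3) * ((r ^ 2)⁻¹ * ∑ j, z j ^ 2)) := fun x y z => by
    simp only [Finset.mul_sum, ← Finset.sum_add_distrib, ← Finset.sum_sub_distrib]
    exact Finset.sum_congr rfl fun j _ => by ring
  have ray_sum : ∀ x y z : Option (Fin (m + 2)) → ℝ, ∑ j,
      (-2 * V r * (x j + (m + 3) * (y j / r)) * z j / r ^ 2 + (m + 3) * V r * z j ^ 2 / r ^ 4 -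
        (W r + (m + 3) * (V r / r ^ 2 - deriv V r / r)) * z j ^ 2 / r ^ 2 - V r * y j ^ 2 / r ^ 2) =
      -2 * V r * (r ^ 2)⁻¹ * (∑ j, x j * z j + (m + 3) * (r⁻¹ * ∑ j, y j * z j)) +
        (m + 3) * V r * (r ^ 4)⁻¹ * ∑ j, z j ^ 2 -
        (W r + (m + 3) * (V r / r ^ 2 - deriv V r / r)) * (r ^ 2)⁻¹ * ∑ j, z j ^ 2 -
        V r * (r ^ 2)⁻¹ * ∑ j, y j ^ 2 := fun x y z => by
    simp only [Finset.mul_sum, ← Finset.sum_add_distrib, ← Finset.sum_sub_distrib]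
    exact Finset.sum_congr rfl fun j _ => by ring
  rw [sq_sum (fun j => fderiv ℝ (radialDeriv (radialDeriv u)) (polarPt θ τ r) (frame j θ τ r))
    (fun j => fderiv ℝ (radialDeriv u) (polarPt θ τ r) (frame j θ τ r))
    (fun j => fderiv ℝ u (polarPt θ τ r) (frame j θ τ r)), ray_sum]
  generalize ∑ j, fderiv ℝ (radialDeriv (radialDeriv u)) (polarPt θ τ r) (frame j θ τ r) *
    fderiv ℝ u (polarPt θ τ r) (frame j θ τ r) = A
  generalize ∑ j, fderiv ℝ (radialDeriv u) (polarPt θ τ r) (frame j θ τ r) *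
    fderiv ℝ u (polarPt θ τ r) (frame j θ τ r) = B
  generalize ∑ j, fderiv ℝ u (polarPt θ τ r) (frame j θ τ r) ^ 2 = C
  generalize ∑ j, fderiv ℝ (radialDeriv u) (polarPt θ τ r) (frame j θ τ r) ^ 2 = E
  push_cast
  field_simp
  ring

end

/-! ### The Hardy–Rellich inequality -/

section

open Set Filter Topology

variable {n m : ℕ} {R : ℝ≥0∞} {V W f : ℝ → ℝ} {a b : ℝ}

theorem AnnSupp.mono {a' b' : ℝ} {u : Space n → ℝ} (h : AnnSupp a b u) (ha : a' ≤ a) (hb : b ≤ b') :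
    AnnSupp a' b' u := fun z hz => Icc_subset_Icc ha hb (h z hz)

theorem AnnSupp.gradInner_right (v : Space n → ℝ) {u : Space n → ℝ} (h : AnnSupp a b u) :
    AnnSupp a b (gradInner v u) := by
  intro z hz
  by_contra h0
  exact hz (by simp [gradInner, fieldX, partialT, h.fderiv_eq_zero h0])

theorem AnnSupp.laplacian {u : Space n → ℝ} (h : AnnSupp a b u) : AnnSupp a b (laplacian u) := by
  have h1 : ∀ η, AnnSupp a b fun z => fderiv ℝ u z η := fun η z hz => by
    by_contra h0
    exact hz (by simp [h.fderiv_eq_zero h0])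
  intro z hz
  by_contra h0
  refine hz ?_
  have h2 : ∀ η, fderiv ℝ (fun z => fderiv ℝ u z η) z = 0 := fun η => (h1 η).fderiv_eq_zero h0
  have h3 : ∀ i, fieldX i (fieldX i u) z = 0 := fun i => by
    change fderiv ℝ (fun z => fderiv ℝ u z (EuclideanSpace.single i 1, 0)) z _ = 0
    rw [h2, _root_.zero_apply]
  have h4 : partialT (partialT u) z = 0 := by
    change fderiv ℝ (fun z => fderiv ℝ u z (0, 1)) z _ = 0
    rw [h2, _root_.zero_apply]
  simp [Grushin.laplacian, h3, h4]

theorem AnnSupp.radialEnergy {u : Space n → ℝ} (h : AnnSupp a b u) (hu : Differentiable ℝ u)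
    (hu₁ : Differentiable ℝ (Grushin.radialDeriv u)) : AnnSupp a b (radialEnergy m V u) := by
  intro z hz
  by_contra h0
  exact hz (by simp [Grushin.radialEnergy, (h.radialPart hu hu₁).eq_zero h0, h.gapTerm.eq_zero h0])

theorem AnnSupp.gapIntegrand {u : Space n → ℝ} (h : AnnSupp a b u) (hu : Differentiable ℝ u) :
    AnnSupp a b (gapIntegrand m V u) := by
  intro z hz
  by_contra h0
  exact hz (by simp [Grushin.gapIntegrand, (h.radialDeriv hu).eq_zero h0, h.gradSq.eq_zero h0,
    h.eq_zero h0, h.equatorMean_rho.eq_zero h0])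

theorem AnnSupp.defect {u : Space n → ℝ} (h : AnnSupp a b u) (hu : Differentiable ℝ u)
    (hu₁ : Differentiable ℝ (Grushin.radialDeriv u)) : AnnSupp a b (defect m V W f u) := by
  intro z hz
  by_contra h0
  exact hz (by simp [Grushin.defect, (h.radialEnergy hu hu₁).eq_zero h0,
    (h.gapIntegrand hu).eq_zero h0, (h.gradInner_right _).eq_zero h0, h.gradSq.eq_zero h0,
    (h.radialDeriv hu).gradSq_div.eq_zero h0])

theorem integrable_radialEnergy (hV : ContDiffOn ℝ 1 V (radii R)) (ha : 0 < a) (hb : b ∈ radii R)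
    {u : Space n → ℝ} (hs : AnnSupp a b u) (hu : ContDiff ℝ ∞ u) :
    Integrable (radialEnergy m V u) := by
  have hu₁ := hs.contDiff_radialDeriv ha hu
  refine (hs.radialEnergy (hu.differentiable (by simp))
    (hu₁.differentiable (by simp))).integrable fun z hz => ?_
  have hR := Icc_subset_radii ha hb hz
  have cB := (hs.contDiff_radialPart (m := m) ha hu).continuous.continuousAt (x := z)
  have cg := (hs.contDiff_gapTerm ha (hu.of_le (by simp))).continuous.continuousAt (x := z)
  have cv := (hs.contDiff_multiplier (m := m) ha hb hu hV).continuous.continuousAt (x := z)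
  have cV := continuousAt_radial hV.continuousOn hR
  exact (continuousAt_psi (ne_zero_of_rho_mem ha hz)).mul (((cV.mul (cB.pow 2)).sub
    (continuousAt_const.mul (cv.mul cB))).sub (cV.mul ((continuousAt_const.mul cg).pow 2)))

theorem integrable_gapIntegrand (hV : ContDiffOn ℝ 1 V (radii R)) (ha : 0 < a) (hb : b ∈ radii R)
    {u : Space n → ℝ} (hs : AnnSupp a b u) (hu : ContDiff ℝ ∞ u) :
    Integrable (gapIntegrand m V u) := by
  have hu₁ := hs.contDiff_radialDeriv ha hu
  have hu' : ContDiff ℝ 1 u := hu.of_le (by simp)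
  refine (hs.gapIntegrand (hu.differentiable (by simp))).integrable fun z hz => ?_
  have hR := Icc_subset_radii ha hb hz
  have hz0 := ne_zero_of_rho_mem ha hz
  have cρ := continuous_rho.continuousAt (x := z)
  have hρ := (rho_pos hz0).ne'
  have cψ := continuousAt_psi hz0
  have cc : ContinuousAt (fun z : Space n => equatorMean u (rho z)) z :=
    ((contDiff_equatorMean hu').continuous.comp continuous_rho).continuousAt
  exact (continuousAt_const.mul (continuousAt_radial hV.continuousOn hR)).mul
    ((((cρ.pow 2).inv₀ (pow_ne_zero 2 hρ)).mul ((continuous_gradSq hu').continuousAt.sub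
      (cψ.mul (hu₁.continuous.continuousAt.pow 2)))).sub
    ((continuousAt_const.mul ((cρ.pow 4).inv₀ (pow_ne_zero 4 hρ))).mul
      (cψ.mul ((hu.continuous.continuousAt.sub cc).pow 2))))

theorem integrable_radial_mul_gradSq {k : ℝ → ℝ} (hk : ContinuousOn k (radii R)) (ha : 0 < a)
    (hb : b ∈ radii R) {u : Space n → ℝ} (hs : AnnSupp a b u) (hu : ContDiff ℝ 1 u) :
    Integrable fun z => k (rho z) * gradSq u z :=
  (hs.gradSq.mul_left _).integrable fun _ hz =>
    (continuousAt_radial hk (Icc_subset_radii ha hb hz)).mul (continuous_gradSq hu).continuousAt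

theorem continuousOn_weight {Q : ℕ} (h : IsBesselPair Q R V W f) :
    ContinuousOn (fun r => V r / r ^ 2 - deriv V r / r) (radii R) :=
  (h.contDiffOn_V.continuousOn.div (continuous_pow 2).continuousOn
    fun _ hr => pow_ne_zero 2 hr.1.ne').sub
    (h.continuousOn_deriv_V.div continuousOn_id fun _ hr => hr.1.ne')

theorem integrable_defect (h : IsBesselPair (m + 4) R V W f) (hV : ∀ r ∈ radii R, 0 ≤ V r)
    (ha : 0 < a) (hb : b ∈ radii R)
    {u : Space (m + 2) → ℝ} (hs : AnnSupp a b u) (hu : ContDiff ℝ ∞ u) :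
    Integrable (defect m V W f u) := by
  have hu' : ContDiff ℝ 1 u := hu.of_le (by simp)
  have hu₁ := hs.contDiff_radialDeriv ha hu
  have hs₁ := hs.radialDeriv (hu.differentiable (by simp))
  have hd₁ : Differentiable ℝ (radialDeriv u) := hu₁.differentiable (by simp)
  have hG := (integral_mul_laplacian (hs.contDiff_multiplier (m := m) ha hb hu h.contDiffOn_V)
    (hs.multiplier (hu.differentiable (by simp)) hd₁).hasCompactSupport
      (contDiff_infty.1 hu 2)).2.1
  exact (((((integrable_radialEnergy h.contDiffOn_V ha hb hs hu).sub (hG.const_mul 2)).sub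
    (integrable_radial_mul_gradSq h.contDiffOn_W.continuousOn ha hb hs hu')).sub
    ((integrable_radial_mul_gradSq (continuousOn_weight h) ha hb hs hu').const_mul _)).sub
    (h.integrable_gradSq_div hV ha hb (hu₁.of_le (by simp)) hs₁)).sub
    (integrable_gapIntegrand h.contDiffOn_V ha hb hs hu)

theorem integral_ray_defect_nonneg (h : IsBesselPair (m + 4) R V W f)
    (hV : ∀ r ∈ radii R, 0 ≤ V r) (hV' : ∀ r ∈ radii R, DifferentiableAt ℝ (deriv V) r)
    (hcond : ∀ r ∈ radii R,
      0 ≤ ((m : ℝ) - 1) * (V r / r ^ 2) + 3 * (deriv V r / r) - deriv (deriv V) r)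
    (ha : 0 < a) (hb : b ∈ radii R) {u : Space (m + 2) → ℝ} (hs : AnnSupp a b u)
    (hu : ContDiff ℝ ∞ u) {θ : EuclideanSpace ℝ (Fin (m + 2))} (hθ : ‖θ‖ = 1) (τ : ℝ) :
    0 ≤ ∫ r in Ioi (0 : ℝ), r ^ (m + 3) * defect m V W f u (polarPt θ τ r) := by
  have hnhds : ∀ᶠ r in 𝓝 b, r ∈ radii R := (isOpen_radii R).mem_nhds hb
  obtain ⟨c, hbc, hc⟩ := hnhds.exists_gt
  have ha2 : 0 < a / 2 := by positivity
  have hu₁ := hs.contDiff_radialDeriv ha hu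
  have hd : Differentiable ℝ u := hu.differentiable (by simp)
  have hs₁ := hs.radialDeriv hd
  have hd₁ : Differentiable ℝ (radialDeriv u) := hu₁.differentiable (by simp)
  have hdv : Differentiable ℝ (multiplier m V u) :=
    (hs.contDiff_multiplier ha hb hu h.contDiffOn_V).differentiable one_ne_zero
  have hs' : AnnSupp (a / 2) c u := hs.mono (by linarith) hbc.le
  by_cases hac : a / 2 ≤ c
  swap
  · have : ∀ z, defect m V W f u z = 0 := fun z =>
      (hs'.defect hd hd₁).eq_zero (by rw [Icc_eq_empty hac]; exact fun h => h)
    simp [this]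
  have hsub : Icc (a / 2) c ⊆ Ioi (0 : ℝ) := fun r hr => ha2.trans_le hr.1
  have hz : ∀ r ∈ Ioi (0 : ℝ) \ Icc (a / 2) c,
      r ^ (m + 3) * defect m V W f u (polarPt θ τ r) = 0 := fun r hr => by
    rw [(hs'.defect hd hd₁).eq_zero, mul_zero]
    rw [rho_polarPt hθ τ (le_of_lt hr.1)]
    exact hr.2
  rw [setIntegral_eq_of_subset_of_forall_sdiff_eq_zero measurableSet_Ioi hsub hz]
  have e := fun r (hr : r ∈ Icc (a / 2) c) => defect_polarPt (m := m) h ha2 hc hs' hu hθ τ hr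
  rw [setIntegral_congr_fun measurableSet_Icc (g := fun r => scl τ ^ 2 * (r ^ (m + 3) *
    rayIntegrand m V W f
      (fun r => radialDeriv u (polarPt θ τ r))
      (fun r => radialDeriv (radialDeriv u) (polarPt θ τ r))
      (fun r => multiplier m V u (polarPt θ τ r))
      (fun r => radialDeriv (multiplier m V u) (polarPt θ τ r))
      (fun j r => fderiv ℝ u (polarPt θ τ r) (frame j θ τ r))
      (fun j r => fderiv ℝ (radialDeriv u) (polarPt θ τ r) (frame j θ τ r))
      (fun j r => fderiv ℝ (radialDeriv (radialDeriv u)) (polarPt θ τ r) (frame j θ τ r)) r))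
    fun r hr => by simp only [e r hr]; ring]
  rw [integral_const_mul]
  refine mul_nonneg (sq_nonneg _) ?_
  by_cases hint : IntegrableOn (fun r => r ^ (m + 3) * rayIntegrand m V W f
      (fun r => radialDeriv u (polarPt θ τ r))
      (fun r => radialDeriv (radialDeriv u) (polarPt θ τ r))
      (fun r => multiplier m V u (polarPt θ τ r))
      (fun r => radialDeriv (multiplier m V u) (polarPt θ τ r))
      (fun j r => fderiv ℝ u (polarPt θ τ r) (frame j θ τ r))
      (fun j r => fderiv ℝ (radialDeriv u) (polarPt θ τ r) (frame j θ τ r))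
      (fun j r => fderiv ℝ (radialDeriv (radialDeriv u)) (polarPt θ τ r) (frame j θ τ r)) r)
      (Icc (a / 2) c)
  swap
  · exact (integral_undef hint).ge
  rw [integral_Icc_eq_integral_Ioc, ← intervalIntegral.integral_of_le hac]
  have out : ∀ r, r = a / 2 ∨ r = c → rho (polarPt θ τ r) ∉ Icc a b := by
    rintro r (rfl | rfl) hr
    · rw [rho_polarPt hθ τ ha2.le] at hr; linarith [hr.1]
    · rw [rho_polarPt hθ τ hc.1.le] at hr; linarith [hr.2]
  exact ray_inequality h hV hV' hcond (fun r hr => hasDerivAt_ray hd₁ hθ τ hr)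
    (fun r hr => hasDerivAt_ray hdv hθ τ hr)
    (fun j r hr => hasDerivAt_ray_frame (contDiff_infty.1 hu 2) j hθ τ hr)
    (fun j r hr => hasDerivAt_ray_frame (contDiff_infty.1 hu₁ 2) j hθ τ hr) ha2 hac hc
    ⟨hs₁.eq_zero (out _ (Or.inl rfl)), hs₁.eq_zero (out _ (Or.inr rfl))⟩
    (fun j => ⟨by rw [hs.fderiv_eq_zero (out _ (Or.inl rfl)), _root_.zero_apply],
      by rw [hs.fderiv_eq_zero (out _ (Or.inr rfl)), _root_.zero_apply]⟩) hint

theorem integral_defect_nonneg (h : IsBesselPair (m + 4) R V W f)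
    (hV : ∀ r ∈ radii R, 0 ≤ V r) (hV' : ∀ r ∈ radii R, DifferentiableAt ℝ (deriv V) r)
    (hcond : ∀ r ∈ radii R,
      0 ≤ ((m : ℝ) - 1) * (V r / r ^ 2) + 3 * (deriv V r / r) - deriv (deriv V) r)
    (ha : 0 < a) (hb : b ∈ radii R) {u : Space (m + 2) → ℝ} (hs : AnnSupp a b u)
    (hu : ContDiff ℝ ∞ u) : 0 ≤ ∫ z, defect m V W f u z := by
  rw [integral_polar (by omega) (integrable_defect h hV ha hb hs hu)]
  exact integral_nonneg fun σ => integral_ray_defect_nonneg h hV hV' hcond ha hb hs hu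
    (norm_eq_of_mem_sphere σ.1) σ.2

theorem ae_fst_ne_zero (hn : 1 ≤ n) : ∀ᵐ z : Space n, z.1 ≠ 0 := by
  have : Nonempty (Fin n) := ⟨⟨0, by omega⟩⟩
  have h : ∀ᵐ x : EuclideanSpace ℝ (Fin n), x ≠ 0 := by
    simp [ae_iff]
  exact Measure.quasiMeasurePreserving_fst.ae h

theorem psi_pos {z : Space n} (hz : z.1 ≠ 0) : 0 < psi z := by
  have h0 : z ≠ 0 := fun h => hz (by rw [h]; rfl)
  have := rho_pos h0
  have := norm_pos_iff.2 hz
  unfold psi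
  positivity

theorem radialEnergy_add_le {u : Space n → ℝ} {z : Space n} (hz : z.1 ≠ 0) (hV : 0 ≤ V (rho z)) :
    radialEnergy m V u z + 2 * (multiplier m V u z * laplacian u z) ≤
      V (rho z) * (laplacian u z ^ 2 / gradSq rho z) := by
  have h0 : z ≠ 0 := fun h => hz (by rw [h]; rfl)
  have hψ := psi_pos hz
  rw [gradSq_rho h0]
  have e : V (rho z) * (laplacian u z ^ 2 / psi z) -
      (radialEnergy m V u z + 2 * (multiplier m V u z * laplacian u z)) =
      V (rho z) * psi z * (laplacian u z / psi z - radialPart m u z + (m + 3) * gapTerm u z) ^ 2 := by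
    unfold radialEnergy multiplier
    field_simp
    ring
  have : 0 ≤ V (rho z) * psi z *
      (laplacian u z / psi z - radialPart m u z + (m + 3) * gapTerm u z) ^ 2 := by positivity
  linarith

theorem ofReal_integral_le_lintegral_ofReal {α : Type*} [MeasurableSpace α] {μ : Measure α}
    {g : α → ℝ} (hg : Integrable g μ) :
    ENNReal.ofReal (∫ x, g x ∂μ) ≤ ∫⁻ x, ENNReal.ofReal (g x) ∂μ := by
  rw [integral_eq_lintegral_pos_part_sub_lintegral_neg_part hg]
  exact (ENNReal.ofReal_le_ofReal (sub_le_self _ ENNReal.toReal_nonneg)).trans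
    ENNReal.ofReal_toReal_le

theorem measurableSet_ball (n : ℕ) (R : ℝ≥0∞) : MeasurableSet (ball n R) :=
  (isOpen_lt (ENNReal.continuous_ofReal.comp continuous_rho) continuous_const).measurableSet

theorem AnnSupp.setIntegral_ball {g : Space n → ℝ} (hg : AnnSupp a b g) (ha : 0 < a)
    (hb : b ∈ radii R) : ∫ z in ball n R, g z = ∫ z, g z :=
  setIntegral_eq_integral_of_forall_compl_eq_zero fun z hz => by
    by_contra h0
    exact hz (Icc_subset_radii ha hb (hg z h0)).2

/-- The Hardy–Rellich inequality for functions supported in a gauge annulus. -/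
theorem hardy_rellich_of_annSupp (h : IsBesselPair (m + 4) R V W f)
    (hV : ∀ r ∈ radii R, 0 ≤ V r) (hV' : ∀ r ∈ radii R, DifferentiableAt ℝ (deriv V) r)
    (hcond : ∀ r ∈ radii R,
      0 ≤ ((m : ℝ) - 1) * (V r / r ^ 2) + 3 * (deriv V r / r) - deriv (deriv V) r)
    (ha : 0 < a) (hb : b ∈ radii R) {u : Space (m + 2) → ℝ} (hs : AnnSupp a b u)
    (hu : ContDiff ℝ ∞ u) :
    ENNReal.ofReal
        ((∫ z in ball (m + 2) R, W (rho z) * gradSq u z)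
          + (m + 3) * (∫ z in ball (m + 2) R,
              (V (rho z) / rho z ^ 2 - deriv V (rho z) / rho z) * gradSq u z)
          + ∫ z in ball (m + 2) R,
              V (rho z) * gradSq (fun w => radialDeriv u w / f (rho w)) z * f (rho z) ^ 2)
      ≤ ∫⁻ z in ball (m + 2) R,
          ENNReal.ofReal (V (rho z) * (laplacian u z ^ 2 / gradSq rho z)) := by
  have hu' : ContDiff ℝ 1 u := hu.of_le (by simp)
  have hd : Differentiable ℝ u := hu.differentiable (by simp)
  have hu₁ := hs.contDiff_radialDeriv ha hu
  have hs₁ := hs.radialDeriv hd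
  have hd₁ : Differentiable ℝ (radialDeriv u) := hu₁.differentiable (by simp)
  obtain ⟨iL, iG, green⟩ := integral_mul_laplacian
    (hs.contDiff_multiplier (m := m) ha hb hu h.contDiffOn_V)
    (hs.multiplier hd hd₁).hasCompactSupport (contDiff_infty.1 hu 2)
  have iE := integrable_radialEnergy (m := m) h.contDiffOn_V ha hb hs hu
  have i1 := integrable_radial_mul_gradSq h.contDiffOn_W.continuousOn ha hb hs hu'
  have i2 := integrable_radial_mul_gradSq (continuousOn_weight h) ha hb hs hu'
  have i3 := h.integrable_gradSq_div hV ha hb (hu₁.of_le (by simp)) hs₁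
  have i4 := integrable_gapIntegrand (m := m) h.contDiffOn_V ha hb hs hu
  have s3 : AnnSupp a b fun z =>
      V (rho z) * gradSq (fun w => radialDeriv u w / f (rho w)) z * f (rho z) ^ 2 := by
    intro z hz
    by_contra h0
    exact hz (by simp [hs₁.gradSq_div.eq_zero h0])
  have sT : AnnSupp a b fun z =>
      radialEnergy m V u z + 2 * (multiplier m V u z * laplacian u z) :=
    (hs.radialEnergy hd hd₁).add ((hs.laplacian.mul_left _).const_mul _)
  have iT := iE.add (iL.const_mul 2)
  rw [(hs.gradSq.mul_left _).setIntegral_ball ha hb, (hs.gradSq.mul_left _).setIntegral_ball ha hb,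
    s3.setIntegral_ball ha hb]
  have key : (∫ z, W (rho z) * gradSq u z) + (m + 3) * (∫ z,
      (V (rho z) / rho z ^ 2 - deriv V (rho z) / rho z) * gradSq u z) +
      (∫ z, V (rho z) * gradSq (fun w => radialDeriv u w / f (rho w)) z * f (rho z) ^ 2) ≤
      ∫ z in ball (m + 2) R, (radialEnergy m V u z + 2 * (multiplier m V u z * laplacian u z)) := by
    rw [sT.setIntegral_ball ha hb, integral_add iE (iL.const_mul 2), integral_const_mul, green]
    have hdef := integral_defect_nonneg h hV hV' hcond ha hb hs hu
    have hgap : 0 ≤ ∫ z, gapIntegrand m V u z :=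
      integral_gap_nonneg (k := fun r => (m + 3) * V r) (by omega) hu' hs
        (fun r hr => mul_nonneg (by positivity) (hV r (Icc_subset_radii ha hb hr))) i4
    have j1 := iE.sub (iG.const_mul 2)
    have j2 := j1.sub i1
    have j3 := j2.sub (i2.const_mul ((m : ℝ) + 3))
    have q1 := integral_sub iE (iG.const_mul 2)
    have q2 := integral_sub j1 i1
    have q3 := integral_sub j2 (i2.const_mul ((m : ℝ) + 3))
    have q4 := integral_sub j3 i3
    have q5 := integral_sub (j3.sub i3) i4
    simp only [Pi.sub_apply, integral_const_mul] at q1 q2 q3 q4 q5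
    unfold defect at hdef
    linarith
  refine (ENNReal.ofReal_le_ofReal key).trans
    ((ofReal_integral_le_lintegral_ofReal iT.integrableOn).trans (lintegral_mono_ae ?_))
  filter_upwards [ae_restrict_mem (measurableSet_ball _ R),
    ae_restrict_of_ae (ae_fst_ne_zero (n := m + 2) (by omega))] with z hz hz1
  have h0 : z ≠ 0 := fun h => hz1 (by rw [h]; rfl)
  exact ENNReal.ofReal_le_ofReal (radialEnergy_add_le hz1 (hV _ ⟨rho_pos h0, hz⟩))

theorem exists_annSupp (hR : 0 < R) {u : Space n → ℝ} (hu : HasCompactSupport u)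
    (hs : tsupport u ⊆ ball n R \ {0}) : ∃ a b, 0 < a ∧ b ∈ radii R ∧ AnnSupp a b u := by
  rcases (tsupport u).eq_empty_or_nonempty with he | hne
  · obtain ⟨x, hx0, hxR⟩ := exists_between hR
    have hx : x ≠ ⊤ := (hxR.trans_le le_top).ne
    refine ⟨1, x.toReal, one_pos, ⟨ENNReal.toReal_pos hx0.ne' hx, ?_⟩, fun z hz => ?_⟩
    · rwa [ENNReal.ofReal_toReal hx]
    · exact absurd (subset_tsupport u hz) (by simp [he])
  · have hK : IsCompact (tsupport u) := hu
    obtain ⟨z₁, h₁, hmin⟩ := hK.exists_isMinOn hne continuous_rho.continuousOn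
    obtain ⟨z₂, h₂, hmax⟩ := hK.exists_isMaxOn hne continuous_rho.continuousOn
    exact ⟨rho z₁, rho z₂, rho_pos (hs h₁).2, ⟨rho_pos (hs h₂).2, (hs h₂).1⟩, fun z hz =>
      ⟨hmin (subset_tsupport u hz), hmax (subset_tsupport u hz)⟩⟩

end

end Grushin

end

theorem theorem1p3 (n : ℕ) (hQ : 4 ≤ homDim n) (R : ℝ≥0∞) (hR : 0 < R) (V W f : ℝ → ℝ)
    (hVW : IsBesselPair (homDim n) R V W f)
    (hV : ∀ r ∈ radii R, 0 ≤ V r)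
    (hV' : ∀ r ∈ radii R, DifferentiableAt ℝ (deriv V) r)
    (hcond : ∀ r ∈ radii R,
      0 ≤ ((homDim n : ℝ) - 5) * (V r / r ^ 2) + 3 * (deriv V r / r) - deriv (deriv V) r)
    (u : Space n → ℝ) (hu : ContDiff ℝ ∞ u) (hu_compact : HasCompactSupport u)
    (hu_supp : tsupport u ⊆ ball n R \ {0}) :
    IntegrableOn (fun z => W (rho z) * gradSq u z) (ball n R) ∧
    IntegrableOn
      (fun z => (V (rho z) / rho z ^ 2 - deriv V (rho z) / rho z) * gradSq u z) (ball n R) ∧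
    IntegrableOn
      (fun z => V (rho z) * gradSq (fun w => radialDeriv u w / f (rho w)) z * f (rho z) ^ 2)
      (ball n R) ∧
    ENNReal.ofReal
        ((∫ z in ball n R, W (rho z) * gradSq u z)
          + ((homDim n : ℝ) - 1) * (∫ z in ball n R,
              (V (rho z) / rho z ^ 2 - deriv V (rho z) / rho z) * gradSq u z)
          + ∫ z in ball n R,
              V (rho z) * gradSq (fun w => radialDeriv u w / f (rho w)) z * f (rho z) ^ 2)
      ≤ ∫⁻ z in ball n R, ENNReal.ofReal (V (rho z) * (laplacian u z ^ 2 / gradSq rho z)) := by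
  obtain ⟨m, rfl⟩ : ∃ m, n = m + 2 := ⟨n - 2, by unfold homDim at hQ; omega⟩
  obtain ⟨a, b, ha, hb, hs⟩ := exists_annSupp hR hu_compact hu_supp
  have h : IsBesselPair (m + 4) R V W f := hVW
  have hu' : ContDiff ℝ 1 u := hu.of_le (by simp)
  have e1 : ((homDim (m + 2) : ℕ) : ℝ) - 1 = m + 3 := by
    unfold homDim; push_cast; ring
  have e5 : ((homDim (m + 2) : ℕ) : ℝ) - 5 = m - 1 := by
    unfold homDim; push_cast; ring
  rw [e5] at hcond
  rw [e1]
  refine ⟨(integrable_radial_mul_gradSq h.contDiffOn_W.continuousOn ha hb hs hu').integrableOn,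
    (integrable_radial_mul_gradSq (continuousOn_weight h) ha hb hs hu').integrableOn,
    (h.integrable_gradSq_div hV ha hb ((hs.contDiff_radialDeriv ha hu).of_le (by simp))
      (hs.radialDeriv (hu.differentiable (by simp)))).integrableOn,
    hardy_rellich_of_annSupp h hV hV' hcond ha hb hs hu⟩
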